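/- **Setting.** Let $P$ be a set of $n\ge 2$ distinct points in the plane with measurements $m:P\to\mathbb R$ and baseline weights $b:P\to\mathbb R$. For an axis-parallel rectangle $R=[x_1,x_2]\times[y_1,y_2]$ put $$m_R=\frac{\sum_{p\in P\cap R}m(p)}{\sum_{p\in P}m(p)},\qquad b_R=\frac{\sum_{p\in P\cap R}b(p)}{\sum_{p\in P}b(p)} .$$ For a constant factor $c>0$ the Gaussian scan statistic is $$d_G(m_R,b_R)=c\,\frac{(m_R-b_R)^2}{b_R(1-b_R)} .$$ Fix a support constant $C>0$ and let $S_n=[C/n,\,1-C/n]^2$; a rectangle $R$ is *admissible* (contains constant measure) if $(m_R,b_R)\in S_n$. A linear function is a map $\ell(x,y)=a_1x+a_2y+a_3$. The model of computation is the real RAM: one fixed program, using natural numbers (addition, truncated subtraction, comparison) for counting and indirect addressing, and real numbers with exact unit-cost $+,-,\times,\div$ and comparison, without rounding; the only program constants are natural numbers. The input consists of $n$, $\varepsilon$, $C$, $c$ and the coordinates, measurements and baseline weights of the points. **Theorem.** Fix constants $C>0$ and $c_1,c_2>0$. There are a real RAM program and a constant $K$, depending only on $C,c_1,c_2$, such that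 for all $n\ge 2$, $0<\varepsilon\le 1$ and $c>0$ the following hold. 1. On every set $P$ of $n$ points with $c_1\le m(p),b(p)\le c_2$ for all $p\in P$, the program halts after at most $K\,\frac1\varepsilon\,n^2\log^2 n$ steps. If an admissible rectangle exists, then the program outputs an admissible rectangle $R$ and the value $d_G(m_R,b_R)$, and this is a $1/(1+\varepsilon)$ approximation to the maximum discrepancy: $$d_G(m_R,b_R)\ \ge\ \frac1{1+\varepsilon}\,d_G(m_{R'},b_{R'})\quad\text{for every admissible rectangle }R'.$$ 2. There are relative $\varepsilon$-approximate families of size $O(\frac1\varepsilon\log n)$ for $d_G$ at every scale of deviation $|x-y|$. Precisely, for every $w>0$ there is a nonempty finite set $L$ of at most $K\,\frac1\varepsilon\log n$ linear functions such that $\ell\le d_G$ on $S_n$ for all $\ell\in L$ and $$\max_{\ell\in L}\ell(x,y)\ \le\ d_G(x,y)\ \le\ (1+\varepsilon)\max_{\ell\in L}\ell(x,y)\quad\text{for all }(x,y)\in S_n\text{ with }\tfrac Cn w\le|x-y|\le w .$$ This range of points suffices for maximization: if $A\subseteq S_n$ and $w=\max_{(x,y)\in A}|x-y|$, then every point of $A$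 at which $d_G$ is maximal over $A$ satisfies $\frac Cn w\le|x-y|\le w$. -/

import Mathlib

/-! ## The real RAM

A random access machine with natural-number registers and arrays (used for counting and for
addressing) and real-number registers and arrays.  Naturals can be added, subtracted and compared,
reals can be added, subtracted, multiplied, divided and compared, all exactly and at unit cost.
There is no rounding and no passage from reals to naturals, and the only constants of a program are
natural numbers.  Programs are finite structured texts. -/

namespace RealRAM

/-- Natural-number expressions.  `load a i` reads cell `i` of the natural-number array `a`. -/
inductive IExp : Type
  | const (k : ℕ)
  | reg (r : ℕ)
  | load (a : ℕ) (i : IExp)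
  | add (e f : IExp)
  | sub (e f : IExp)

/-- Real-number expressions.  `load a i` reads cell `i` of the real array `a`. -/
inductive RExp : Type
  | ofNat (e : IExp)
  | reg (r : ℕ)
  | load (a : ℕ) (i : IExp)
  | add (e f : RExp)
  | sub (e f : RExp)
  | mul (e f : RExp)
  | div (e f : RExp)

/-- Tests: `ilt` is `<` on naturals, `rlt` is `<` on reals. -/
inductive BExp : Type
  | ilt (e f : IExp)
  | rlt (e f : RExp)
  | not (p : BExp)
  | and (p q : BExp)

/-- Programs.  Register and array names occur literally in the text; only array indices are
computed. -/
inductive Cmd : Type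
  | skip
  | iset (r : ℕ) (e : IExp)
  | rset (r : ℕ) (e : RExp)
  | istore (a : ℕ) (i e : IExp)
  | rstore (a : ℕ) (i : IExp) (e : RExp)
  | seq (p q : Cmd)
  | ite (t : BExp) (p q : Cmd)
  | loop (t : BExp) (p : Cmd)

/-- Memory contents: registers `ireg r`, `rreg r`; cell `i` of array `a` is `iarr a i`,
`rarr a i`. -/
structure State where
  ireg : ℕ → ℕ
  rreg : ℕ → ℝ
  iarr : ℕ → ℕ → ℕ
  rarr : ℕ → ℕ → ℝ

/-- Value of a natural-number expression; subtraction is truncated at `0`. -/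
def IExp.eval (s : State) : IExp → ℕ
  | .const k => k
  | .reg r => s.ireg r
  | .load a i => s.iarr a (i.eval s)
  | .add e f => e.eval s + f.eval s
  | .sub e f => e.eval s - f.eval s

/-- Number of elementary operations in a natural-number expression. -/
def IExp.cost : IExp → ℕ
  | .const _ => 1
  | .reg _ => 1
  | .load _ i => i.cost + 1
  | .add e f => e.cost + f.cost + 1
  | .sub e f => e.cost + f.cost + 1

/-- Value of a real expression; a division by `0` returns `0` (the divisor can be tested). -/
noncomputable def RExp.eval (s : State) : RExp → ℝ
  | .ofNat e => (e.eval s : ℝ)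
  | .reg r => s.rreg r
  | .load a i => s.rarr a (i.eval s)
  | .add e f => e.eval s + f.eval s
  | .sub e f => e.eval s - f.eval s
  | .mul e f => e.eval s * f.eval s
  | .div e f => e.eval s / f.eval s

/-- Number of elementary operations in a real expression. -/
def RExp.cost : RExp → ℕ
  | .ofNat e => e.cost + 1
  | .reg _ => 1
  | .load _ i => i.cost + 1
  | .add e f => e.cost + f.cost + 1
  | .sub e f => e.cost + f.cost + 1
  | .mul e f => e.cost + f.cost + 1
  | .div e f => e.cost + f.cost + 1

/-- The test `t` succeeds in the state `s`. -/
def BExp.Holds (s : State) : BExp → Prop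
  | .ilt e f => e.eval s < f.eval s
  | .rlt e f => e.eval s < f.eval s
  | .not p => ¬ p.Holds s
  | .and p q => p.Holds s ∧ q.Holds s

/-- Number of elementary operations in a test. -/
def BExp.cost : BExp → ℕ
  | .ilt e f => e.cost + f.cost + 1
  | .rlt e f => e.cost + f.cost + 1
  | .not p => p.cost + 1
  | .and p q => p.cost + q.cost + 1

/-- Overwrite a natural-number register. -/
def State.setI (s : State) (r v : ℕ) : State :=
  { s with ireg := Function.update s.ireg r v }

/-- Overwrite a real register. -/
def State.setR (s : State) (r : ℕ) (v : ℝ) : State :=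
  { s with rreg := Function.update s.rreg r v }

/-- Overwrite one cell of a natural-number array. -/
def State.storeI (s : State) (a i v : ℕ) : State :=
  { s with iarr := Function.update s.iarr a (Function.update (s.iarr a) i v) }

/-- Overwrite one cell of a real array. -/
def State.storeR (s : State) (a i : ℕ) (v : ℝ) : State :=
  { s with rarr := Function.update s.rarr a (Function.update (s.rarr a) i v) }

/-- `Exec p s t s'`: started in the state `s`, the program `p` halts in the state `s'` after
exactly `t` elementary steps. -/
inductive Exec : Cmd → State → ℕ → State → Prop
  | skip (s : State) : Exec .skip s 1 s
  | iset (r : ℕ) (e : IExp) (s : State) :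
      Exec (.iset r e) s (e.cost + 1) (s.setI r (e.eval s))
  | rset (r : ℕ) (e : RExp) (s : State) :
      Exec (.rset r e) s (e.cost + 1) (s.setR r (e.eval s))
  | istore (a : ℕ) (i e : IExp) (s : State) :
      Exec (.istore a i e) s (i.cost + e.cost + 1) (s.storeI a (i.eval s) (e.eval s))
  | rstore (a : ℕ) (i : IExp) (e : RExp) (s : State) :
      Exec (.rstore a i e) s (i.cost + e.cost + 1) (s.storeR a (i.eval s) (e.eval s))
  | seq {p q : Cmd} {s s₁ s₂ : State} {t₁ t₂ : ℕ} :
      Exec p s t₁ s₁ → Exec q s₁ t₂ s₂ → Exec (.seq p q) s (t₁ + t₂) s₂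
  | ite_true {b : BExp} {p q : Cmd} {s s' : State} {t : ℕ} :
      b.Holds s → Exec p s t s' → Exec (.ite b p q) s (b.cost + t + 1) s'
  | ite_false {b : BExp} {p q : Cmd} {s s' : State} {t : ℕ} :
      ¬ b.Holds s → Exec q s t s' → Exec (.ite b p q) s (b.cost + t + 1) s'
  | loop_false {b : BExp} {p : Cmd} {s : State} :
      ¬ b.Holds s → Exec (.loop b p) s (b.cost + 1) s
  | loop_true {b : BExp} {p : Cmd} {s s₁ s₂ : State} {t₁ t₂ : ℕ} :
      b.Holds s → Exec p s t₁ s₁ → Exec (.loop b p) s₁ t₂ s₂ →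
        Exec (.loop b p) s (b.cost + t₁ + t₂ + 1) s₂

end RealRAM

/-! ## Scan statistics over axis-parallel rectangles -/

namespace ScanStat

/-- `n` distinct points in the plane, with measurements `m` and baseline weights `b`.
For Gaussian data `y i` of variance `1 / τ i ^ 2` one has `b i = τ i ^ 2` and
`m i = τ i ^ 2 * y i`. -/
structure PointSet (n : ℕ) where
  pt : Fin n → ℝ × ℝ
  pt_injective : Function.Injective pt
  m : Fin n → ℝ
  b : Fin n → ℝ

variable {n : ℕ}

open Classical in
/-- The fraction of the total of the weights `w` that is carried by the points in the region `R`. -/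
noncomputable def PointSet.fraction (P : PointSet n) (w : Fin n → ℝ) (R : Set (ℝ × ℝ)) : ℝ :=
  (∑ i with P.pt i ∈ R, w i) / ∑ i, w i

/-- The point `(m_R, b_R)` of a region `R`. -/
noncomputable def PointSet.coords (P : PointSet n) (R : Set (ℝ × ℝ)) : ℝ × ℝ :=
  (P.fraction P.m R, P.fraction P.b R)

/-- All measurements and baseline weights lie in `[c₁, c₂]`. -/
def PointSet.BoundedBy (P : PointSet n) (c₁ c₂ : ℝ) : Prop :=
  ∀ i, P.m i ∈ Set.Icc c₁ c₂ ∧ P.b i ∈ Set.Icc c₁ c₂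

/-- The square `S_n = [C/n, 1 - C/n]²`. -/
noncomputable def supportSquare (C : ℝ) (n : ℕ) : Set (ℝ × ℝ) :=
  Set.Icc (C / n) (1 - C / n) ×ˢ Set.Icc (C / n) (1 - C / n)

/-- The closed axis-parallel rectangle `[lo.1, hi.1] × [lo.2, hi.2]` has the required support:
its point `(m_R, b_R)` lies in `S_n`. -/
def PointSet.Admissible (P : PointSet n) (C : ℝ) (lo hi : ℝ × ℝ) : Prop :=
  P.coords (Set.Icc lo hi) ∈ supportSquare C n

/-- The Gaussian scan statistic `c (m_R - b_R)² / (b_R (1 - b_R))` at `p = (m_R, b_R)`. -/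
noncomputable def gaussian (c : ℝ) (p : ℝ × ℝ) : ℝ :=
  c * ((p.1 - p.2) ^ 2 / (p.2 * (1 - p.2)))

/-- The linear function `a₁ x + a₂ y + a₃` with coefficients `(a₁, a₂, a₃)`. -/
def linear (a : ℝ × ℝ × ℝ) (p : ℝ × ℝ) : ℝ :=
  a.1 * p.1 + a.2.1 * p.2 + a.2.2

/-- The upper envelope of a nonempty finite collection of linear functions. -/
noncomputable def envelope (L : Finset (ℝ × ℝ × ℝ)) (hL : L.Nonempty) (p : ℝ × ℝ) : ℝ :=
  L.sup' hL fun a => linear a p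

/-- `L` is a relative `ε`-approximate family of `d` on `S`. -/
def IsRelativeFamily (ε : ℝ) (d : ℝ × ℝ → ℝ) (S : Set (ℝ × ℝ)) (L : Finset (ℝ × ℝ × ℝ)) : Prop :=
  ∃ hL : L.Nonempty, ∀ p ∈ S,
    envelope L hL p ≤ d p ∧ d p ≤ (1 + ε) * envelope L hL p

/-- The points of `S_n` whose deviation `|m_R - b_R|` is at most `w` and at least `(C/n) w`. -/
def deviationBand (C : ℝ) (n : ℕ) (w : ℝ) : Set (ℝ × ℝ) :=
  {p ∈ supportSquare C n | C / n * w ≤ |p.1 - p.2| ∧ |p.1 - p.2| ≤ w}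

/-- Initial memory.  Natural register `0` holds `n`; real registers `0`, `1`, `2` hold `ε`, the
support constant `C` and the factor `c`; real arrays `0`, `1`, `2`, `3` hold the abscissas,
ordinates, measurements and baseline weights.  Everything else is `0`. -/
noncomputable def PointSet.input (P : PointSet n) (ε C c : ℝ) : RealRAM.State where
  ireg := fun r => if r = 0 then n else 0
  rreg := fun r => if r = 0 then ε else if r = 1 then C else if r = 2 then c else 0
  iarr := fun _ _ => 0
  rarr := fun a i =>
    if h : i < n then
      match a with
      | 0 => (P.pt ⟨i, h⟩).1
      | 1 => (P.pt ⟨i, h⟩).2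
      | 2 => P.m ⟨i, h⟩
      | 3 => P.b ⟨i, h⟩
      | _ => 0
    else 0

/-- The output in the state `s`, a rectangle in real registers `0`, `1` (lower left corner) and
`2`, `3` (upper right corner) and a value in real register `4`, is correct: the rectangle is
admissible, the value is its discrepancy, and this is at least `1 / (1 + ε)` times the
discrepancy of every admissible rectangle. -/
def PointSet.CorrectOutput (P : PointSet n) (ε C c : ℝ) (s : RealRAM.State) : Prop :=
  P.Admissible C (s.rreg 0, s.rreg 1) (s.rreg 2, s.rreg 3) ∧
  s.rreg 4 = gaussian c (P.coords (Set.Icc (s.rreg 0, s.rreg 1) (s.rreg 2, s.rreg 3))) ∧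
  ∀ lo hi : ℝ × ℝ, P.Admissible C lo hi →
    1 / (1 + ε) * gaussian c (P.coords (Set.Icc lo hi)) ≤ s.rreg 4

end ScanStat

/-! Put h = y(1-y) and t = (x-y)/h, so that the statistic without its factor c is t²h. For constants
t₀ and z the function 2t₀(x-y) - t₀²(y - 2zy + z²) is linear in (x,y), and the statistic exceeds it
by exactly h(t-t₀)² + t₀²(y-z)² (`stat_sub_fam`). It is therefore a lower bound for 0 < y < 1, and a
good one if t₀ is relatively close to t and z is close to y compared with √h. Slopes t₀ in geometric
progression with ratio 1+1/N, and N+1 base points z that are dense near 0 and 1 (`exists_gridPt`),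
leave a relative error of at most 37/N², which is at most ε/2 once N²ε ≥ 74; thus N has order 1/√ε.
On the band (C/n)w ≤ |x-y| ≤ w the slopes |t| span a ratio of order n², so O(N log n) slopes and
O(log n/ε) functions suffice (`exists_relativeFamily`). Points below the band are beaten by a point
of deviation w (`stat_le_of_small`).

It remains to maximise one linear function over boxes in O(n² log n) steps. With the points sorted
by ordinate, fix a lowest point p of the box and sweep upwards. A box of the current strip that
contains p consists of the column of p, a reach to the left and a reach to the right, and its linear
value is the corresponding sum (`Inst.sides_eq_rankBox`). The best reach on one side is a maximal
prefix sum, which a binary tree maintains at logarithmic cost per insertion (`TreeOK.subtree`).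

The support constraints are handled by counting. A normalised weight is at least δ = c₁/(n c₂), so
k0 = ⌈C c₂/c₁⌉ points weigh at least C/n. Upper bound: it is automatic in a strip of weight at most
1 - C/n, and any other strip misses fewer than k0 points, hence is one of at most k0² strips that
are searched exhaustively (`Inst.exists_extreme_strip`). Lower bound: each side keeps its k0 nearest
occupied abscissas out of the tree, in a window. A reach beyond a full window has enough weight by
itself, so the other side may be chosen freely; the remaining boxes are given by two window
prefixes, and these (k0+1)² pairs are tried one by one (`SideInv.reach_cases`, `evalC_spec`).

A sweep finds only the value and the strip of a best box. An exhaustive O(n²) search of this strip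
then records a box whose statistic is at least the statistic of the best one (`roundC_spec`). Rounds
for x-y and y-x determine a scale w, and rounds for all members of the family at this scale give the
approximation (`searchC_spec`). All programs are verified in a Hoare logic with time bounds, `Runs`,
whose frame conditions are computed from the program text. -/

set_option linter.unusedSimpArgs false

/-! ## Time-bounded total correctness for the real RAM -/

namespace RealRAM

infixr:60 " ;; " => Cmd.seq

/-- Does the program text write the natural register `r`? -/
def Cmd.wI : Cmd → ℕ → Bool
  | .iset r _, x => x == r
  | .seq p q, x => p.wI x || q.wI x
  | .ite _ p q, x => p.wI x || q.wI x
  | .loop _ p, x => p.wI x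
  | _, _ => false

/-- Does the program text write the real register `r`? -/
def Cmd.wR : Cmd → ℕ → Bool
  | .rset r _, x => x == r
  | .seq p q, x => p.wR x || q.wR x
  | .ite _ p q, x => p.wR x || q.wR x
  | .loop _ p, x => p.wR x
  | _, _ => false

/-- Does the program text write the natural array `a`? -/
def Cmd.wIA : Cmd → ℕ → Bool
  | .istore a _ _, x => x == a
  | .seq p q, x => p.wIA x || q.wIA x
  | .ite _ p q, x => p.wIA x || q.wIA x
  | .loop _ p, x => p.wIA x
  | _, _ => false

/-- Does the program text write the real array `a`? -/
def Cmd.wRA : Cmd → ℕ → Bool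
  | .rstore a _ _, x => x == a
  | .seq p q, x => p.wRA x || q.wRA x
  | .ite _ p q, x => p.wRA x || q.wRA x
  | .loop _ p, x => p.wRA x
  | _, _ => false

/-- The two states agree on everything that `p` does not write. -/
structure Same (p : Cmd) (s s' : State) : Prop where
  i : ∀ r, p.wI r = false → s'.ireg r = s.ireg r
  r : ∀ r, p.wR r = false → s'.rreg r = s.rreg r
  ia : ∀ a, p.wIA a = false → s'.iarr a = s.iarr a
  ra : ∀ a, p.wRA a = false → s'.rarr a = s.rarr a

theorem Same.refl (p : Cmd) (s : State) : Same p s s :=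
  ⟨fun _ _ => rfl, fun _ _ => rfl, fun _ _ => rfl, fun _ _ => rfl⟩

theorem Same.trans {p : Cmd} {s s' s'' : State} (h : Same p s s') (h' : Same p s' s'') :
    Same p s s'' :=
  ⟨fun r hr => (h'.i r hr).trans (h.i r hr), fun r hr => (h'.r r hr).trans (h.r r hr),
    fun r hr => (h'.ia r hr).trans (h.ia r hr), fun r hr => (h'.ra r hr).trans (h.ra r hr)⟩

theorem Same.weaken {p q : Cmd} {s s' : State} (h : Same p s s')
    (h1 : ∀ x, q.wI x = false → p.wI x = false) (h2 : ∀ x, q.wR x = false → p.wR x = false)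
    (h3 : ∀ x, q.wIA x = false → p.wIA x = false) (h4 : ∀ x, q.wRA x = false → p.wRA x = false) :
    Same q s s' :=
  ⟨fun r hr => h.i r (h1 r hr), fun r hr => h.r r (h2 r hr), fun r hr => h.ia r (h3 r hr),
    fun r hr => h.ra r (h4 r hr)⟩

/-- The frame rule. The write sets are Boolean functions of the program text, so for a concrete
program the side condition that a register or array is untouched holds by `rfl`. -/
theorem Exec.same {p : Cmd} {s s' : State} {t : ℕ} (h : Exec p s t s') : Same p s s' := by
  induction h with
  | skip s => exact Same.refl _ _
  | iset r e s =>
    refine ⟨fun x hx => ?_, fun _ _ => rfl, fun _ _ => rfl, fun _ _ => rfl⟩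
    have : x ≠ r := by simpa [Cmd.wI] using hx
    simp [State.setI, this]
  | rset r e s =>
    refine ⟨fun _ _ => rfl, fun x hx => ?_, fun _ _ => rfl, fun _ _ => rfl⟩
    have : x ≠ r := by simpa [Cmd.wR] using hx
    simp [State.setR, this]
  | istore a i e s =>
    refine ⟨fun _ _ => rfl, fun _ _ => rfl, fun x hx => ?_, fun _ _ => rfl⟩
    have : x ≠ a := by simpa [Cmd.wIA] using hx
    simp [State.storeI, this]
  | rstore a i e s =>
    refine ⟨fun _ _ => rfl, fun _ _ => rfl, fun _ _ => rfl, fun x hx => ?_⟩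
    have : x ≠ a := by simpa [Cmd.wRA] using hx
    simp [State.storeR, this]
  | seq _ _ h1 h2 =>
    refine Same.trans (h1.weaken ?_ ?_ ?_ ?_) (h2.weaken ?_ ?_ ?_ ?_) <;>
      simp +contextual [Cmd.wI, Cmd.wR, Cmd.wIA, Cmd.wRA]
  | ite_true _ _ h1 =>
    refine h1.weaken ?_ ?_ ?_ ?_ <;> simp +contextual [Cmd.wI, Cmd.wR, Cmd.wIA, Cmd.wRA]
  | ite_false _ _ h1 =>
    refine h1.weaken ?_ ?_ ?_ ?_ <;> simp +contextual [Cmd.wI, Cmd.wR, Cmd.wIA, Cmd.wRA]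
  | loop_false _ => exact Same.refl _ _
  | loop_true _ _ _ h1 h2 =>
    refine Same.trans (h1.weaken ?_ ?_ ?_ ?_) h2 <;>
      simp +contextual [Cmd.wI, Cmd.wR, Cmd.wIA, Cmd.wRA]

/-- Started in `s`, the program `p` halts within `T` steps in a state satisfying `Q`. -/
def Runs (p : Cmd) (s : State) (T : ℕ) (Q : State → Prop) : Prop :=
  ∃ t s', Exec p s t s' ∧ t ≤ T ∧ Q s'

/-- The new postcondition may use the frame relation `Same`; in this way specifications need to
mention only what a program changes. -/
theorem Runs.conseq {p : Cmd} {s : State} {T T' : ℕ} {Q Q' : State → Prop} (h : Runs p s T Q)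
    (hT : T ≤ T') (hQ : ∀ s', Same p s s' → Q s' → Q' s') : Runs p s T' Q' := by
  obtain ⟨t, s', he, ht, hq⟩ := h
  exact ⟨t, s', he, ht.trans hT, hQ s' he.same hq⟩

theorem Runs.le {p : Cmd} {s : State} {T T' : ℕ} {Q : State → Prop} (h : Runs p s T Q)
    (hT : T ≤ T') : Runs p s T' Q :=
  h.conseq hT fun _ _ h => h

theorem Runs.skip {s : State} {Q : State → Prop} (h : Q s) : Runs .skip s 1 Q :=
  ⟨_, _, .skip s, le_rfl, h⟩

theorem Runs.iset {s : State} {r : ℕ} {e : IExp} {Q : State → Prop} (h : Q (s.setI r (e.eval s))) :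
    Runs (.iset r e) s (e.cost + 1) Q :=
  ⟨_, _, .iset r e s, le_rfl, h⟩

theorem Runs.rset {s : State} {r : ℕ} {e : RExp} {Q : State → Prop} (h : Q (s.setR r (e.eval s))) :
    Runs (.rset r e) s (e.cost + 1) Q :=
  ⟨_, _, .rset r e s, le_rfl, h⟩

theorem Runs.istore {s : State} {a : ℕ} {i e : IExp} {Q : State → Prop}
    (h : Q (s.storeI a (i.eval s) (e.eval s))) :
    Runs (.istore a i e) s (i.cost + e.cost + 1) Q :=
  ⟨_, _, .istore a i e s, le_rfl, h⟩

theorem Runs.rstore {s : State} {a : ℕ} {i : IExp} {e : RExp} {Q : State → Prop}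
    (h : Q (s.storeR a (i.eval s) (e.eval s))) :
    Runs (.rstore a i e) s (i.cost + e.cost + 1) Q :=
  ⟨_, _, .rstore a i e s, le_rfl, h⟩

theorem Runs.seq {p q : Cmd} {s : State} {T₁ T₂ : ℕ} {R Q : State → Prop} (h : Runs p s T₁ R)
    (h' : ∀ s₁, Same p s s₁ → R s₁ → Runs q s₁ T₂ Q) : Runs (p ;; q) s (T₁ + T₂) Q := by
  obtain ⟨t, s', he, ht, hq⟩ := h
  obtain ⟨t', s'', he', ht', hq'⟩ := h' s' he.same hq
  exact ⟨_, _, .seq he he', by omega, hq'⟩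

theorem Runs.seq_iset {q : Cmd} {s : State} {r : ℕ} {e : IExp} {T : ℕ} {Q : State → Prop}
    (h : Runs q (s.setI r (e.eval s)) T Q) : Runs (.iset r e ;; q) s (e.cost + 1 + T) Q := by
  obtain ⟨t, s', he, ht, hq⟩ := h
  exact ⟨_, _, .seq (.iset r e s) he, by omega, hq⟩

theorem Runs.seq_rset {q : Cmd} {s : State} {r : ℕ} {e : RExp} {T : ℕ} {Q : State → Prop}
    (h : Runs q (s.setR r (e.eval s)) T Q) : Runs (.rset r e ;; q) s (e.cost + 1 + T) Q := by
  obtain ⟨t, s', he, ht, hq⟩ := h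
  exact ⟨_, _, .seq (.rset r e s) he, by omega, hq⟩

theorem Runs.seq_istore {q : Cmd} {s : State} {a : ℕ} {i e : IExp} {T : ℕ} {Q : State → Prop}
    (h : Runs q (s.storeI a (i.eval s) (e.eval s)) T Q) :
    Runs (.istore a i e ;; q) s (i.cost + e.cost + 1 + T) Q := by
  obtain ⟨t, s', he, ht, hq⟩ := h
  exact ⟨_, _, .seq (.istore a i e s) he, by omega, hq⟩

theorem Runs.seq_rstore {q : Cmd} {s : State} {a : ℕ} {i : IExp} {e : RExp} {T : ℕ}
    {Q : State → Prop} (h : Runs q (s.storeR a (i.eval s) (e.eval s)) T Q) :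
    Runs (.rstore a i e ;; q) s (i.cost + e.cost + 1 + T) Q := by
  obtain ⟨t, s', he, ht, hq⟩ := h
  exact ⟨_, _, .seq (.rstore a i e s) he, by omega, hq⟩

theorem Runs.ite {b : BExp} {p q : Cmd} {s : State} {T₁ T₂ : ℕ} {Q : State → Prop}
    (h₁ : b.Holds s → Runs p s T₁ Q) (h₂ : ¬ b.Holds s → Runs q s T₂ Q) :
    Runs (.ite b p q) s (b.cost + max T₁ T₂ + 1) Q := by
  by_cases hb : b.Holds s
  · obtain ⟨t, s', he, ht, hq⟩ := h₁ hb
    exact ⟨_, _, .ite_true hb he, by omega, hq⟩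
  · obtain ⟨t, s', he, ht, hq⟩ := h₂ hb
    exact ⟨_, _, .ite_false hb he, by omega, hq⟩

/-- A loop whose invariant carries a bound on the number of remaining iterations. -/
theorem Runs.loop {b : BExp} {p : Cmd} {T : ℕ} (Inv : ℕ → State → Prop)
    (hstep : ∀ k s, Inv k s → b.Holds s → 0 < k ∧ Runs p s T (Inv (k - 1))) (k : ℕ) (s : State)
    (h : Inv k s) :
    Runs (.loop b p) s (k * (b.cost + T + 1) + b.cost + 1)
      (fun s' => ¬ b.Holds s' ∧ ∃ k', Inv k' s') := by
  induction k generalizing s with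
  | zero =>
    have hb : ¬ b.Holds s := fun hb => absurd (hstep 0 s h hb).1 (lt_irrefl 0)
    exact ⟨_, _, .loop_false hb, by omega, hb, _, h⟩
  | succ k ih =>
    by_cases hb : b.Holds s
    · obtain ⟨t, s', he, ht, hq⟩ := (hstep _ s h hb).2
      obtain ⟨t', s'', he', ht', hq'⟩ := ih s' hq
      refine ⟨_, _, .loop_true hb he he', ?_, hq'⟩
      have : (k + 1) * (b.cost + T + 1) = k * (b.cost + T + 1) + (b.cost + T + 1) := by ring
      omega
    · exact ⟨_, _, .loop_false hb, by omega, hb, _, h⟩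

/-- `for i < e do p`. -/
def forC (i : ℕ) (e : IExp) (p : Cmd) : Cmd :=
  .iset i (.const 0) ;; .loop (.ilt (.reg i) e) (p ;; .iset i (.add (.reg i) (.const 1)))

theorem Same.setI_of {p : Cmd} {s s' : State} {i v : ℕ} (h : Same p s s') (hi : p.wI i = true) :
    Same p s (s'.setI i v) := by
  refine ⟨fun r hr => ?_, h.r, h.ia, h.ra⟩
  have : r ≠ i := by rintro rfl; simp [hi] at hr
  simp [State.setI, this, h.i r hr]

theorem forC_wI_self (i : ℕ) (e : IExp) (p : Cmd) : (forC i e p).wI i = true := by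
  simp [forC, Cmd.wI]

theorem Same.forC_body {i : ℕ} {e : IExp} {p : Cmd} {s s' : State} (h : Same p s s') :
    Same (forC i e p) s s' :=
  h.weaken (by simp +contextual [forC, Cmd.wI]) (by simp +contextual [forC, Cmd.wR])
    (by simp +contextual [forC, Cmd.wIA]) (by simp +contextual [forC, Cmd.wRA])

/-- A counting loop with the invariant `Inv k` before iteration `k`. -/
theorem Runs.forC {i : ℕ} {e : IExp} {p : Cmd} {s : State} {m T : ℕ} {Q : State → Prop}
    (Inv : ℕ → State → Prop) (hi : p.wI i = false)
    (he : ∀ s₁, Same (forC i e p) s s₁ → e.eval s₁ = m)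
    (h0 : Inv 0 (s.setI i 0))
    (hstep : ∀ k s₁, k < m → Same (forC i e p) s s₁ → s₁.ireg i = k → Inv k s₁ →
      Runs p s₁ T (fun s₂ => Inv (k + 1) (s₂.setI i (k + 1))))
    (hQ : ∀ s₁, Same (forC i e p) s s₁ → s₁.ireg i = m → Inv m s₁ → Q s₁) :
    Runs (forC i e p) s (m * (e.cost + T + 7) + e.cost + 5) Q := by
  -- `Runs.loop` counts the remaining iterations down, while `Inv` counts the completed ones up; the
  -- two counters add up to `m`.
  let J : ℕ → State → Prop := fun k s₁ =>
    ∃ k', k' + k = m ∧ s₁.ireg i = k' ∧ Same (RealRAM.forC i e p) s s₁ ∧ Inv k' s₁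
  have h := Runs.loop (b := .ilt (.reg i) e) (p := p ;; .iset i (.add (.reg i) (.const 1)))
    (T := T + 4) J (fun k s₁ hk hb => ?_) m (s.setI i 0)
    ⟨0, by simp, by simp [State.setI], (Same.refl _ s).setI_of (forC_wI_self i e p), h0⟩
  · refine (Runs.seq_iset (e := .const 0) (h.conseq le_rfl ?_)).le ?_
    · rintro s' - ⟨hb, k, k', hk, hki, hs, hInv⟩
      have : ¬ k' < m := by
        simpa [BExp.Holds, IExp.eval, hki, he _ hs] using hb
      have hkm : k' = m := by omega
      subst hkm
      exact hQ s' hs hki hInv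
    · simp only [IExp.cost, BExp.cost]
      have : m * (1 + e.cost + 1 + (T + 4) + 1) = m * (e.cost + T + 7) := by ring
      omega
  · obtain ⟨k', hkm, hki, hs, hInv⟩ := hk
    have hlt : k' < m := by simpa [BExp.Holds, IExp.eval, hki, he _ hs] using hb
    refine ⟨by omega, ?_⟩
    refine (Runs.seq (hstep k' s₁ hlt hs hki hInv) (T₂ := 4) ?_).le le_rfl
    intro s₂ hs₂ h₂
    have hi2 : s₂.ireg i = k' := by rw [hs₂.i i hi, hki]
    refine (Runs.iset ?_)
    have : (IExp.add (.reg i) (.const 1)).eval s₂ = k' + 1 := by simp [IExp.eval, hi2]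
    rw [this]
    exact ⟨k' + 1, by omega, by simp [State.setI],
      (hs.trans hs₂.forC_body).setI_of (forC_wI_self i e p), h₂⟩

section simps

variable (s : State) (r r' v a i j : ℕ) (x : ℝ)

@[simp] theorem setI_ireg : (s.setI r v).ireg r' = if r' = r then v else s.ireg r' := by
  simp [State.setI, Function.update_apply]
@[simp] theorem setI_rreg : (s.setI r v).rreg = s.rreg := rfl
@[simp] theorem setI_iarr : (s.setI r v).iarr = s.iarr := rfl
@[simp] theorem setI_rarr : (s.setI r v).rarr = s.rarr := rfl
@[simp] theorem setR_rreg : (s.setR r x).rreg r' = if r' = r then x else s.rreg r' := by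
  simp [State.setR, Function.update_apply]
@[simp] theorem setR_ireg : (s.setR r x).ireg = s.ireg := rfl
@[simp] theorem setR_iarr : (s.setR r x).iarr = s.iarr := rfl
@[simp] theorem setR_rarr : (s.setR r x).rarr = s.rarr := rfl
@[simp] theorem storeI_iarr : (s.storeI a i v).iarr r' =
    if r' = a then Function.update (s.iarr a) i v else s.iarr r' := by
  simp [State.storeI, Function.update_apply]
@[simp] theorem storeI_ireg : (s.storeI a i v).ireg = s.ireg := rfl
@[simp] theorem storeI_rreg : (s.storeI a i v).rreg = s.rreg := rfl
@[simp] theorem storeI_rarr : (s.storeI a i v).rarr = s.rarr := rfl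
@[simp] theorem storeR_rarr : (s.storeR a i x).rarr r' =
    if r' = a then Function.update (s.rarr a) i x else s.rarr r' := by
  simp [State.storeR, Function.update_apply]
@[simp] theorem storeR_ireg : (s.storeR a i x).ireg = s.ireg := rfl
@[simp] theorem storeR_rreg : (s.storeR a i x).rreg = s.rreg := rfl
@[simp] theorem storeR_iarr : (s.storeR a i x).iarr = s.iarr := rfl

end simps

attribute [simp] IExp.eval RExp.eval BExp.Holds IExp.cost RExp.cost BExp.cost

end RealRAM

/-! ## Normalised instances and the exhaustive search of a strip -/

namespace ScanStat

open RealRAM Finset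

/-- Points `0, …, n - 1` with normalised weights, as stored by the program. -/
structure Inst where
  n : ℕ
  X : ℕ → ℝ
  Y : ℕ → ℝ
  mu : ℕ → ℝ
  be : ℕ → ℝ
  thr : ℝ
  cc : ℝ

namespace Inst

variable (I : Inst)

/-- Weight of the points in the bounding box with sides through the points `l`, `r`, `b`, `t`. -/
noncomputable def box (f : ℕ → ℝ) (l r b t : ℕ) : ℝ :=
  ∑ i ∈ range I.n,
    if (I.Y b ≤ I.Y i ∧ I.Y i ≤ I.Y t) ∧ I.X l ≤ I.X i ∧ I.X i ≤ I.X r then f i else 0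

/-- The pair of normalised weights of a box. -/
noncomputable def boxPt (l r b t : ℕ) : ℝ × ℝ :=
  (I.box I.mu l r b t, I.box I.be l r b t)

/-- The box has the required support. -/
def Adm (l r b t : ℕ) : Prop :=
  (I.thr ≤ I.box I.mu l r b t ∧ I.box I.mu l r b t ≤ 1 - I.thr) ∧
    I.thr ≤ I.box I.be l r b t ∧ I.box I.be l r b t ≤ 1 - I.thr

/-- The statistic of a box. -/
noncomputable def val (l r b t : ℕ) : ℝ := gaussian I.cc (I.boxPt l r b t)

/-- Weight of the points `i < k` of the strip to the left of `x`. -/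
noncomputable def ltSum (f : ℕ → ℝ) (b t : ℕ) (x : ℝ) (k : ℕ) : ℝ :=
  ∑ i ∈ range k, if (I.Y b ≤ I.Y i ∧ I.Y i ≤ I.Y t) ∧ I.X i < x then f i else 0

/-- Weight of the points `i < k` of the strip not to the right of `x`. -/
noncomputable def leSum (f : ℕ → ℝ) (b t : ℕ) (x : ℝ) (k : ℕ) : ℝ :=
  ∑ i ∈ range k, if (I.Y b ≤ I.Y i ∧ I.Y i ≤ I.Y t) ∧ I.X i ≤ x then f i else 0

/-- Two one-sided sums per abscissa determine all boxes of a strip: after one linear pass for each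
point, every pair of sides is evaluated in constant time. -/
theorem leSum_sub_ltSum {f : ℕ → ℝ} {l r b t : ℕ} (h : I.X l ≤ I.X r) :
    I.leSum f b t (I.X r) I.n - I.ltSum f b t (I.X l) I.n = I.box f l r b t := by
  unfold leSum ltSum box
  rw [← Finset.sum_sub_distrib]
  refine Finset.sum_congr rfl fun i _ => ?_
  by_cases hs : I.Y b ≤ I.Y i ∧ I.Y i ≤ I.Y t
  · simp only [hs, true_and]
    by_cases h1 : I.X i ≤ I.X r <;> by_cases h2 : I.X i < I.X l
    · simp [h1, h2, not_le.2 h2]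
    · simp [h1, h2, not_lt.1 h2]
    · exact absurd (h2.le.trans h) h1
    · simp [h1, h2]
  · simp [hs]

/-- This makes a test of the order of the two sides unnecessary: a reversed pair has nonpositive
weight and fails the comparison with the positive threshold. -/
theorem leSum_sub_ltSum_nonpos {f : ℕ → ℝ} {l r b t : ℕ} (hf : ∀ i < I.n, 0 ≤ f i)
    (h : I.X r < I.X l) :
    I.leSum f b t (I.X r) I.n - I.ltSum f b t (I.X l) I.n ≤ 0 := by
  unfold leSum ltSum
  rw [← Finset.sum_sub_distrib]
  refine Finset.sum_nonpos fun i hi => ?_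
  have := hf i (mem_range.1 hi)
  by_cases hs : I.Y b ≤ I.Y i ∧ I.Y i ≤ I.Y t
  · simp only [hs, true_and]
    by_cases h1 : I.X i ≤ I.X r
    · simp [h1, h1.trans_lt h]
    · by_cases h2 : I.X i < I.X l <;> simp [h1, h2, this]
  · simp [hs]

/-- The memory holds the instance. -/
structure Env (s : State) : Prop where
  n : s.ireg 0 = I.n
  X : s.rarr 4 = I.X
  Y : s.rarr 5 = I.Y
  mu : s.rarr 6 = I.mu
  be : s.rarr 7 = I.be
  thr : s.rreg 8 = I.thr
  thr' : s.rreg 9 = 1 - I.thr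
  cc : s.rreg 7 = I.cc

variable {I}

theorem Env.of_same {p : Cmd} {s s' : State} (h : I.Env s) (hs : Same p s s')
    (hp : (p.wI 0 || p.wRA 4 || p.wRA 5 || p.wRA 6 || p.wRA 7 || p.wR 7 || p.wR 8 || p.wR 9)
      = false) : I.Env s' := by
  simp only [Bool.or_eq_false_iff] at hp
  obtain ⟨⟨⟨⟨⟨⟨⟨h0, h1⟩, h2⟩, h3⟩, h4⟩, h5⟩, h6⟩, h7⟩ := hp
  exact ⟨by rw [hs.i _ h0, h.n], by rw [hs.ra _ h1, h.X], by rw [hs.ra _ h2, h.Y],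
    by rw [hs.ra _ h3, h.mu], by rw [hs.ra _ h4, h.be], by rw [hs.r _ h6, h.thr],
    by rw [hs.r _ h7, h.thr'], by rw [hs.r _ h5, h.cc]⟩

/-- The recorded rectangle and value are correct, or nothing has been recorded. -/
def Recorded (I : Inst) (s : State) : Prop :=
  s.rreg 4 = -1 ∨ ∃ l r b t, l < I.n ∧ r < I.n ∧ b < I.n ∧ t < I.n ∧ I.Adm l r b t ∧
    s.rreg 0 = I.X l ∧ s.rreg 1 = I.Y b ∧ s.rreg 2 = I.X r ∧ s.rreg 3 = I.Y t ∧
    s.rreg 4 = I.val l r b t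

end Inst

/-- Accumulate the weights of point `i` (register 9) relative to the abscissa of point `l`
(register 8), if the point lies in the strip from point 6 to point 7. -/
def accumBody : Cmd :=
  .ite (.and (.not (.rlt (.load 5 (.reg 9)) (.load 5 (.reg 6))))
      (.not (.rlt (.load 5 (.reg 7)) (.load 5 (.reg 9)))))
    (.ite (.rlt (.load 4 (.reg 9)) (.load 4 (.reg 8)))
      (.rset 22 (.add (.reg 22) (.load 6 (.reg 9))) ;;
        .rset 23 (.add (.reg 23) (.load 7 (.reg 9)))) .skip ;;
    .ite (.not (.rlt (.load 4 (.reg 8)) (.load 4 (.reg 9))))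
      (.rset 24 (.add (.reg 24) (.load 6 (.reg 9))) ;;
        .rset 25 (.add (.reg 25) (.load 7 (.reg 9)))) .skip)
    .skip

/-- Arrays 8 to 11 receive, at the index of the point in register 8, the two weights strictly to the
left of its abscissa and then the two weights up to it. -/
def accumRow : Cmd :=
  .rset 22 (.ofNat (.const 0)) ;; .rset 23 (.ofNat (.const 0)) ;;
  .rset 24 (.ofNat (.const 0)) ;; .rset 25 (.ofNat (.const 0)) ;;
  forC 9 (.reg 0) accumBody ;;
  .rstore 8 (.reg 8) (.reg 22) ;; .rstore 9 (.reg 8) (.reg 23) ;;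
  .rstore 10 (.reg 8) (.reg 24) ;; .rstore 11 (.reg 8) (.reg 25)

/-- Test the box between the points `l`, `r` (registers 8, 9) and record it if it is better. -/
def tryBox : Cmd :=
  .rset 26 (.sub (.load 10 (.reg 9)) (.load 8 (.reg 8))) ;;
  .rset 27 (.sub (.load 11 (.reg 9)) (.load 9 (.reg 8))) ;;
  .ite (.and (.and (.not (.rlt (.reg 26) (.reg 8))) (.not (.rlt (.reg 9) (.reg 26))))
      (.and (.not (.rlt (.reg 27) (.reg 8))) (.not (.rlt (.reg 9) (.reg 27)))))
    (.rset 28 (.mul (.reg 7) (.div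
      (.mul (.sub (.reg 26) (.reg 27)) (.sub (.reg 26) (.reg 27)))
      (.mul (.reg 27) (.sub (.ofNat (.const 1)) (.reg 27))))) ;;
    .ite (.rlt (.reg 4) (.reg 28))
      (.rset 4 (.reg 28) ;; .rset 0 (.load 4 (.reg 8)) ;; .rset 1 (.load 5 (.reg 6)) ;;
        .rset 2 (.load 4 (.reg 9)) ;; .rset 3 (.load 5 (.reg 7)))
      .skip)
    .skip

/-- Exhaustive search of the strip between the points in registers 6 and 7. -/
def brute : Cmd :=
  forC 8 (.reg 0) accumRow ;; forC 8 (.reg 0) (forC 9 (.reg 0) tryBox)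

namespace Inst

variable {I : Inst}

theorem accumBody_spec {s : State} (hE : I.Env s) {b t l k : ℕ} (hb : s.ireg 6 = b)
    (ht : s.ireg 7 = t) (hl : s.ireg 8 = l) (hk : s.ireg 9 = k)
    (h22 : s.rreg 22 = I.ltSum I.mu b t (I.X l) k) (h23 : s.rreg 23 = I.ltSum I.be b t (I.X l) k)
    (h24 : s.rreg 24 = I.leSum I.mu b t (I.X l) k)
    (h25 : s.rreg 25 = I.leSum I.be b t (I.X l) k) :
    Runs accumBody s 50 fun s' =>
      s'.rreg 22 = I.ltSum I.mu b t (I.X l) (k + 1) ∧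
      s'.rreg 23 = I.ltSum I.be b t (I.X l) (k + 1) ∧
      s'.rreg 24 = I.leSum I.mu b t (I.X l) (k + 1) ∧
      s'.rreg 25 = I.leSum I.be b t (I.X l) (k + 1) := by
  unfold accumBody
  simp only [ltSum, leSum, Finset.sum_range_succ] at *
  refine Runs.le (Runs.ite (fun h => Runs.seq (R := fun s' =>
      s'.rreg 22 = I.ltSum I.mu b t (I.X l) (k + 1) ∧
      s'.rreg 23 = I.ltSum I.be b t (I.X l) (k + 1) ∧ s'.rreg 24 = s.rreg 24 ∧
      s'.rreg 25 = s.rreg 25) (Runs.ite (fun h' => Runs.seq_rset (Runs.rset ?_))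
      (fun h' => Runs.skip ?_)) (fun s₁ hs₁ h₁ => Runs.ite
      (fun h' => Runs.seq_rset (Runs.rset ?_)) (fun h' => Runs.skip ?_)))
      (fun h => Runs.skip ?_)) ?_
  · simp_all [ltSum, Finset.sum_range_succ, hE.X, hE.Y, hE.mu, hE.be]
  · simp_all [ltSum, Finset.sum_range_succ, hE.X, hE.Y, hE.mu, hE.be]
  · have e8 := hs₁.i 8 rfl
    have e9 := hs₁.i 9 rfl
    have e4 := hs₁.ra 4 rfl
    have e6 := hs₁.ra 6 rfl
    have e7 := hs₁.ra 7 rfl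
    simp_all [ltSum, Finset.sum_range_succ, hE.X, hE.Y, hE.mu, hE.be]
  · have e8 := hs₁.i 8 rfl
    have e9 := hs₁.i 9 rfl
    have e4 := hs₁.ra 4 rfl
    simp_all [ltSum, Finset.sum_range_succ, hE.X, hE.Y, hE.mu, hE.be]
  · simp [hE.Y, hb, ht, hk] at h
    have : ¬ (I.Y b ≤ I.Y k ∧ I.Y k ≤ I.Y t) := fun h' => absurd (h h'.1) (not_lt.2 h'.2)
    simp_all
  · simp

theorem accumRow_spec {s : State} (hE : I.Env s) {b t l : ℕ} (hb : s.ireg 6 = b)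
    (ht : s.ireg 7 = t) (hl : s.ireg 8 = l) :
    Runs accumRow s (60 * I.n + 60) fun s' =>
      s'.rarr 8 = Function.update (s.rarr 8) l (I.ltSum I.mu b t (I.X l) I.n) ∧
      s'.rarr 9 = Function.update (s.rarr 9) l (I.ltSum I.be b t (I.X l) I.n) ∧
      s'.rarr 10 = Function.update (s.rarr 10) l (I.leSum I.mu b t (I.X l) I.n) ∧
      s'.rarr 11 = Function.update (s.rarr 11) l (I.leSum I.be b t (I.X l) I.n) := by
  unfold accumRow
  refine Runs.le (Runs.seq_rset (Runs.seq_rset (Runs.seq_rset (Runs.seq_rset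
    (Runs.seq (R := fun s' => s'.rreg 22 = I.ltSum I.mu b t (I.X l) I.n ∧
      s'.rreg 23 = I.ltSum I.be b t (I.X l) I.n ∧
      s'.rreg 24 = I.leSum I.mu b t (I.X l) I.n ∧
      s'.rreg 25 = I.leSum I.be b t (I.X l) I.n)
    (Runs.forC (m := I.n) (T := 50) (fun k s' => s'.rreg 22 = I.ltSum I.mu b t (I.X l) k ∧
      s'.rreg 23 = I.ltSum I.be b t (I.X l) k ∧
      s'.rreg 24 = I.leSum I.mu b t (I.X l) k ∧
      s'.rreg 25 = I.leSum I.be b t (I.X l) k) rfl ?_ ?_ ?_ ?_)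
    (fun s₁ hs₁ h₁ => Runs.seq_rstore (Runs.seq_rstore
      (Runs.seq_rstore (Runs.rstore ?_))))))))) ?_
  · intro s₁ hs₁
    have := hs₁.i 0 rfl
    simpa [hE.n] using this
  · simp [ltSum, leSum]
  · intro k s₁ hk hs₁ hi h
    have e6 := hs₁.i 6 rfl
    have e7 := hs₁.i 7 rfl
    have e8 := hs₁.i 8 rfl
    simp at e6 e7 e8
    have hE1 : I.Env s₁ := by
      refine Env.of_same ?_ hs₁ rfl
      exact ⟨by simp [hE.n], hE.X, hE.Y, hE.mu, hE.be, by simp [hE.thr], by simp [hE.thr'],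
        by simp [hE.cc]⟩
    refine (accumBody_spec hE1 (e6.trans hb) (e7.trans ht) (e8.trans hl) hi h.1 h.2.1 h.2.2.1
      h.2.2.2).conseq le_rfl ?_
    intro s₂ _ h₂
    simpa using h₂
  · exact fun s₁ _ _ h => h
  · have e8 := hs₁.i 8 rfl
    have a8 := hs₁.ra 8 rfl
    have a9 := hs₁.ra 9 rfl
    have a10 := hs₁.ra 10 rfl
    have a11 := hs₁.ra 11 rfl
    simp at e8 a8 a9 a10 a11
    simp [e8, a8, a9, a10, a11, h₁, hl]
  · simp
    ring_nf
    omega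

theorem gaussian_nonneg {c : ℝ} (hc : 0 ≤ c) {p : ℝ × ℝ} (h0 : 0 ≤ p.2) (h1 : p.2 ≤ 1) :
    0 ≤ gaussian c p := by
  unfold gaussian
  have : 0 ≤ 1 - p.2 := by linarith
  positivity

/-- What a program that only records better boxes guarantees. -/
structure Improves (I : Inst) (s s' : State) : Prop where
  recorded : I.Recorded s'
  mono : s.rreg 4 ≤ s'.rreg 4

theorem tryBox_spec {s : State} (hE : I.Env s) (hthr : 0 < I.thr)
    (hmu : ∀ i < I.n, 0 ≤ I.mu i) {b t l r : ℕ}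
    (hb : s.ireg 6 = b) (ht : s.ireg 7 = t) (hl : s.ireg 8 = l) (hr : s.ireg 9 = r)
    (hbn : b < I.n) (htn : t < I.n) (hln : l < I.n) (hrn : r < I.n)
    (h8 : s.rarr 8 l = I.ltSum I.mu b t (I.X l) I.n)
    (h9 : s.rarr 9 l = I.ltSum I.be b t (I.X l) I.n)
    (h10 : s.rarr 10 r = I.leSum I.mu b t (I.X r) I.n)
    (h11 : s.rarr 11 r = I.leSum I.be b t (I.X r) I.n)
    (hR : I.Recorded s) :
    Runs tryBox s 80 fun s' => I.Improves s s' ∧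
      (I.X l ≤ I.X r → I.Adm l r b t → I.val l r b t ≤ s'.rreg 4) := by
  unfold tryBox
  refine Runs.le (Runs.seq_rset (Runs.seq_rset (Runs.ite (fun h => Runs.seq_rset (Runs.ite
    (fun h' => Runs.seq_rset (Runs.seq_rset (Runs.seq_rset (Runs.seq_rset (Runs.rset ?_)))))
    (fun h' => Runs.skip ?_))) (fun h => Runs.skip ?_)))) (by simp)
  all_goals simp [hl, hr, h8, h9, h10, h11, hE.thr, hE.thr', hE.cc, -tsub_le_iff_right] at h
  · simp [hl, hr, h8, h9, h10, h11, hE.thr, hE.thr', hE.cc] at h'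
    have hlr : I.X l ≤ I.X r := by
      by_contra hlr
      have := I.leSum_sub_ltSum_nonpos (b := b) (t := t) hmu (not_le.1 hlr)
      linarith [h.1.1]
    simp only [I.leSum_sub_ltSum hlr] at h h'
    have hv : I.val l r b t = I.cc * ((I.box I.mu l r b t - I.box I.be l r b t) *
        (I.box I.mu l r b t - I.box I.be l r b t) /
        (I.box I.be l r b t * (1 - I.box I.be l r b t))) := by
      simp [val, gaussian, boxPt, sq]
    rw [← hv] at h'
    refine ⟨⟨Or.inr ⟨l, r, b, t, hln, hrn, hbn, htn, h, ?_⟩, ?_⟩, fun _ _ => ?_⟩ <;>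
      simp [hl, hr, hb, ht, h8, h9, h10, h11, hE.thr, hE.thr', hE.cc, hE.X, hE.Y,
        I.leSum_sub_ltSum hlr, ← hv, h'.le]
  · simp [hl, hr, h8, h9, h10, h11, hE.thr, hE.thr', hE.cc] at h'
    refine ⟨⟨by simpa [Recorded] using hR, by simp⟩, fun hlr _ => ?_⟩
    simp only [I.leSum_sub_ltSum hlr] at h'
    simpa [val, gaussian, boxPt, sq] using h'
  · refine ⟨⟨by simpa [Recorded] using hR, by simp⟩, fun hlr hA => ?_⟩
    simp only [I.leSum_sub_ltSum hlr] at h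
    exact absurd hA.2.2 (not_le.2 (h hA.1.1 hA.1.2 hA.2.1))

theorem Env.setI {s : State} (hE : I.Env s) {r v : ℕ} (hr : r ≠ 0) : I.Env (s.setI r v) :=
  ⟨by simp [hE.n, hr.symm], hE.X, hE.Y, hE.mu, hE.be, hE.thr, hE.thr', hE.cc⟩

/-- The cost is quadratic: `n` linear passes for the one-sided sums, then constant time for each
pair of sides. One such search per linear function stays below the cost of the sweep. -/
theorem brute_spec {s : State} (hE : I.Env s) (hthr : 0 < I.thr)
    (hmu : ∀ i < I.n, 0 ≤ I.mu i) {b t : ℕ}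
    (hb : s.ireg 6 = b) (ht : s.ireg 7 = t) (hbn : b < I.n) (htn : t < I.n)
    (hR : I.Recorded s) :
    Runs brute s (160 * I.n ^ 2 + 100 * I.n + 20) fun s' => I.Improves s s' ∧
      ∀ l < I.n, ∀ r < I.n, I.X l ≤ I.X r → I.Adm l r b t → I.val l r b t ≤ s'.rreg 4 := by
  unfold brute
  refine Runs.le (Runs.seq (R := fun s' => ∀ l < I.n,
      s'.rarr 8 l = I.ltSum I.mu b t (I.X l) I.n ∧ s'.rarr 9 l = I.ltSum I.be b t (I.X l) I.n ∧
      s'.rarr 10 l = I.leSum I.mu b t (I.X l) I.n ∧ s'.rarr 11 l = I.leSum I.be b t (I.X l) I.n)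
    (Runs.forC (m := I.n) (T := 60 * I.n + 60) (fun k s' => ∀ l < k,
      s'.rarr 8 l = I.ltSum I.mu b t (I.X l) I.n ∧ s'.rarr 9 l = I.ltSum I.be b t (I.X l) I.n ∧
      s'.rarr 10 l = I.leSum I.mu b t (I.X l) I.n ∧ s'.rarr 11 l = I.leSum I.be b t (I.X l) I.n)
      rfl (fun s₁ hs₁ => by simpa [hE.n] using hs₁.i 0 rfl) (by simp) ?_ (fun _ _ _ h => h))
    (T₂ := I.n * (1 + (I.n * (1 + 80 + 7) + 1 + 5) + 7) + 1 + 5)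
    (fun s₁ hs₁ h₁ => ?_)) ?_
  · intro k s₁ hk hs₁ hi h
    have hE1 := hE.of_same hs₁ rfl
    refine (accumRow_spec hE1 ((hs₁.i 6 rfl).trans hb) ((hs₁.i 7 rfl).trans ht) hi).conseq le_rfl ?_
    rintro s₂ - ⟨g1, g2, g3, g4⟩ l hl
    simp only [setI_rarr, g1, g2, g3, g4]
    rcases Nat.lt_succ_iff_lt_or_eq.1 hl with hl | rfl
    · simpa [Function.update_of_ne hl.ne] using h l hl
    · simp
  · have hE1 := hE.of_same hs₁ rfl
    have hR1 : I.Recorded s₁ := by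
      simpa [Recorded, hs₁.r 0 rfl, hs₁.r 1 rfl, hs₁.r 2 rfl, hs₁.r 3 rfl, hs₁.r 4 rfl] using hR
    have e4 := hs₁.r 4 rfl
    refine Runs.forC (m := I.n) (fun k s' => I.Improves s s' ∧ ∀ l < k, ∀ r < I.n,
      I.X l ≤ I.X r → I.Adm l r b t → I.val l r b t ≤ s'.rreg 4) rfl
      (fun s₂ hs₂ => by simpa [hE1.n] using hs₂.i 0 rfl)
      ⟨⟨by simpa [Recorded] using hR1, by simp [e4]⟩, by simp⟩ ?_ (fun _ _ _ h => h)
    intro l s₂ hl hs₂ hi h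
    have hE2 := hE1.of_same hs₂ rfl
    refine Runs.forC (m := I.n) (fun k s' => I.Improves s₂ s' ∧ ∀ r < k,
      I.X l ≤ I.X r → I.Adm l r b t → I.val l r b t ≤ s'.rreg 4) rfl
      (fun s₂ hs₂ => by simpa [hE2.n] using hs₂.i 0 rfl)
      ⟨⟨by simpa [Recorded] using h.1.recorded, by simp⟩, by simp⟩ ?_ ?_
    · intro r s₃ hr hs₃ hi' h'
      have hE3 := hE2.of_same hs₃ rfl
      have a8 : s₃.rarr 8 = s₁.rarr 8 := (hs₃.ra 8 rfl).trans (hs₂.ra 8 rfl)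
      have a9 : s₃.rarr 9 = s₁.rarr 9 := (hs₃.ra 9 rfl).trans (hs₂.ra 9 rfl)
      have a10 : s₃.rarr 10 = s₁.rarr 10 := (hs₃.ra 10 rfl).trans (hs₂.ra 10 rfl)
      have a11 : s₃.rarr 11 = s₁.rarr 11 := (hs₃.ra 11 rfl).trans (hs₂.ra 11 rfl)
      have i6 : s₃.ireg 6 = b := by rw [hs₃.i 6 rfl, hs₂.i 6 rfl, hs₁.i 6 rfl, hb]
      have i7 : s₃.ireg 7 = t := by rw [hs₃.i 7 rfl, hs₂.i 7 rfl, hs₁.i 7 rfl, ht]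
      have i8 : s₃.ireg 8 = l := by rw [hs₃.i 8 rfl, hi]
      refine (tryBox_spec hE3 hthr hmu i6 i7 i8 hi' hbn htn hl hr (by rw [a8, (h₁ l hl).1])
        (by rw [a9, (h₁ l hl).2.1]) (by rw [a10, (h₁ r hr).2.2.1])
        (by rw [a11, (h₁ r hr).2.2.2]) h'.1.recorded).conseq le_rfl ?_
      rintro s₄ - ⟨g1, g2⟩
      refine ⟨⟨by simpa [Recorded] using g1.recorded, by simpa using h'.1.mono.trans g1.mono⟩, ?_⟩
      intro r' hr' hx hA
      rcases Nat.lt_succ_iff_lt_or_eq.1 hr' with hr' | rfl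
      · simpa using (h'.2 r' hr' hx hA).trans g1.mono
      · simpa using g2 hx hA
    · rintro s₃ - - ⟨g1, g2⟩
      refine ⟨⟨by simpa [Recorded] using g1.recorded, by simpa using h.1.mono.trans g1.mono⟩, ?_⟩
      intro l' hl' r hr hx hA
      rcases Nat.lt_succ_iff_lt_or_eq.1 hl' with hl' | rfl
      · simpa using (h.2 l' hl' r hr hx hA).trans g1.mono
      · simpa using g2 r hr hx hA
  · simp
    ring_nf
    omega

end Inst
end ScanStat

/-! ## One side of the sweep: window, prefix-maximum tree and their invariants -/

namespace ScanStat

open Finset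

/-- A heap-ordered binary tree with `Z` leaves storing sums `S` and maximal prefix sums `P` of the
leaf values `g`. -/
structure TreeOK (Z : ℕ) (S P g : ℕ → ℝ) : Prop where
  node : ∀ u, 1 ≤ u → u < Z →
    S u = S (u + u) + S (u + u + 1) ∧ P u = max (P (u + u)) (S (u + u) + P (u + u + 1))
  leaf : ∀ i < Z, S (Z + i) = g i ∧ P (Z + i) = max 0 (g i)

/-- Induction on the height `d` of the subtree at `v`, a node at depth `e`, whose leaves are the
nodes `v * 2 ^ d + i`. A prefix of a concatenation is a prefix of the left half, or the whole left
half followed by a prefix of the right half; this is the recursion of `TreeOK`. The empty prefix is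
allowed. -/
theorem TreeOK.subtree {h : ℕ} {S P g : ℕ → ℝ} (hT : TreeOK (2 ^ h) S P g) (d : ℕ) :
    ∀ e v, d + e = h → 2 ^ e ≤ v → v < 2 ^ (e + 1) →
      S v = ∑ i ∈ range (2 ^ d), S (v * 2 ^ d + i) ∧
      (∀ j ≤ 2 ^ d, ∑ i ∈ range j, S (v * 2 ^ d + i) ≤ P v) ∧
      ∃ j ≤ 2 ^ d, P v = ∑ i ∈ range j, S (v * 2 ^ d + i) := by
  induction d with
  | zero =>
    intro e v he h1 h2
    obtain rfl : e = h := by omega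
    have hl := hT.leaf (v - 2 ^ e) (by rw [pow_succ] at h2; omega)
    rw [Nat.add_sub_cancel' h1] at hl
    refine ⟨by simp, fun j hj => ?_, ?_⟩
    · rcases Nat.le_one_iff_eq_zero_or_eq_one.1 (by simpa using hj) with rfl | rfl
      · simp [hl.2]
      · simp [hl.1, hl.2]
    · rcases le_total 0 (g (v - 2 ^ e)) with h0 | h0
      · exact ⟨1, by simp, by simp [hl.1, hl.2, h0]⟩
      · exact ⟨0, by simp, by simp [hl.2, h0]⟩
  | succ d ih =>
    intro e v he h1 h2
    have hv1 : 1 ≤ v := Nat.one_le_two_pow.trans h1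
    have hvZ : v < 2 ^ h := h2.trans_le (Nat.pow_le_pow_right (by norm_num) (by omega))
    obtain ⟨hS, hP⟩ := hT.node v hv1 hvZ
    have p1 : 2 ^ (e + 1) = 2 ^ e + 2 ^ e := by ring
    have p2 : 2 ^ (e + 1 + 1) = 2 ^ (e + 1) + 2 ^ (e + 1) := by ring
    obtain ⟨a1, a2, j1, hj1, a3⟩ := ih (e + 1) (v + v) (by omega) (by omega) (by omega)
    obtain ⟨b1, b2, j2, hj2, b3⟩ := ih (e + 1) (v + v + 1) (by omega) (by omega) (by omega)
    have e1 : ∀ i, (v + v) * 2 ^ d + i = v * 2 ^ (d + 1) + i := fun i => by ring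
    have e2 : ∀ i, (v + v + 1) * 2 ^ d + i = v * 2 ^ (d + 1) + (2 ^ d + i) := fun i => by ring
    simp only [e1] at a1 a2 a3
    simp only [e2] at b1 b2 b3
    have hd : 2 ^ (d + 1) = 2 ^ d + 2 ^ d := by ring
    refine ⟨?_, fun j hj => ?_, ?_⟩
    · rw [hS, a1, b1, hd, Finset.sum_range_add]
    · rw [hP]
      by_cases hj' : j ≤ 2 ^ d
      · exact le_max_of_le_left (a2 j hj')
      · obtain ⟨j', rfl⟩ := Nat.exists_eq_add_of_le (not_le.1 hj').le
        rw [Finset.sum_range_add, ← a1]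
        exact le_max_of_le_right (by linarith [b2 j' (by omega)])
    · rcases le_total (P (v + v)) (S (v + v) + P (v + v + 1)) with hle | hle
      · refine ⟨2 ^ d + j2, by omega, ?_⟩
        rw [hP, max_eq_right hle, Finset.sum_range_add, ← a1, b3]
      · exact ⟨j1, by omega, by rw [hP, max_eq_left hle, a3]⟩

theorem TreeOK.root {h : ℕ} {S P g : ℕ → ℝ} (hT : TreeOK (2 ^ h) S P g) :
    (∀ j ≤ 2 ^ h, ∑ i ∈ range j, g i ≤ P 1) ∧ ∃ j ≤ 2 ^ h, P 1 = ∑ i ∈ range j, g i := by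
  obtain ⟨-, h2, h3⟩ := hT.subtree h 0 1 (by omega) (by simp) (by simp)
  have hc : ∀ j ≤ 2 ^ h, ∑ i ∈ range j, S (1 * 2 ^ h + i) = ∑ i ∈ range j, g i := fun j hj =>
    Finset.sum_congr rfl fun i hi => by
      rw [one_mul]; exact (hT.leaf i ((mem_range.1 hi).trans_le hj)).1
  refine ⟨fun j hj => hc j hj ▸ h2 j hj, ?_⟩
  obtain ⟨j, hj, he⟩ := h3
  exact ⟨j, hj, by rw [he, hc j hj]⟩

/-- The window `W` holds the (at most `k0`) smallest active keys in increasing order, padded with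
`n`; the tree leaves `g` hold the values of the other active keys. -/
structure SideInv (n k0 : ℕ) (δ a₁ a₂ : ℝ) (W : ℕ → ℕ) (fm fb g : ℕ → ℝ) : Prop where
  sorted : ∀ i j, i < j → j < k0 → W i < W j ∨ W j = n
  le : ∀ j < k0, W j ≤ n
  heavy : ∀ j < k0, W j < n → δ ≤ fm (W j) ∧ δ ≤ fb (W j)
  out : ∀ x < n, (∀ j < k0, W j ≠ x) → (fm x = 0 ∧ fb x = 0) ∨ ∀ j < k0, W j < x
  leaf : ∀ x < n, (∃ j < k0, W j = x) → g x = 0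
  leaf' : ∀ x < n, (∀ j < k0, W j ≠ x) → g x = a₁ * fm x + a₂ * fb x
  leaf_top : ∀ x, n ≤ x → g x = 0
  sentinel : fm n = 0 ∧ fb n = 0
  nonneg : ∀ x, 0 ≤ fm x ∧ 0 ≤ fb x
  zero : fm 0 = 0 ∧ fb 0 = 0

/-- The result `W'`, `c` of inserting the key `x` into the window `W`, with `c` the evicted key. -/
structure Bubbled (n k0 : ℕ) (W : ℕ → ℕ) (x : ℕ) (W' : ℕ → ℕ) (c : ℕ) : Prop where
  sorted : ∀ i j, i < j → j < k0 → W' i < W' j ∨ W' j = n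
  le : ∀ j < k0, W' j ≤ W j
  carry_le : c ≤ n
  lt : ∀ j < k0, W' j < c ∨ c = n
  mem : ∀ y < n, ((∃ j < k0, W' j = y) ∨ y = c) ↔ ((∃ j < k0, W j = y) ∨ y = x)

/-- Only the leaf of the evicted key has to change. If the inserted key stays in the window, its
leaf remains zero; if not, it is itself the evicted key and its leaf receives the new value. The
value `c = n` means that nothing was evicted. -/
theorem SideInv.insert {n k0 : ℕ} {δ a₁ a₂ : ℝ} {W W' : ℕ → ℕ} {fm fb g : ℕ → ℝ}
    (h : SideInv n k0 δ a₁ a₂ W fm fb g) {x c : ℕ} (hx : x < n) (hx0 : 0 < x)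
    (hB : Bubbled n k0 W x W' c) {dm db : ℝ} (hδ : 0 ≤ δ) (hdm : δ ≤ dm) (hdb : δ ≤ db) :
    SideInv n k0 δ a₁ a₂ W' (Function.update fm x (fm x + dm)) (Function.update fb x (fb x + db))
      (if c < n then Function.update g c (a₁ * Function.update fm x (fm x + dm) c +
        a₂ * Function.update fb x (fb x + db) c) else g) := by
  have hle : ∀ j < k0, W' j ≤ n := fun j hj => (hB.le j hj).trans (h.le j hj)
  have hcW : ∀ j < k0, c < n → W' j ≠ c := fun j hj hc he => by
    rcases hB.lt j hj with h' | h' <;> omega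
  have hnew : ∀ y < n, y ≠ c → y ≠ x → (∀ j < k0, W' j ≠ y) → ∀ j < k0, W j ≠ y := by
    intro y hy hyc hyx hn j hj he
    rcases (hB.mem y hy).2 (Or.inl ⟨j, hj, he⟩) with ⟨i, hi, hi'⟩ | h'
    · exact hn i hi hi'
    · exact hyc h'
  have hxc : (∀ j < k0, W' j ≠ x) → x = c := fun hn => by
    rcases (hB.mem x hx).2 (Or.inr rfl) with ⟨i, hi, hi'⟩ | h'
    · exact absurd hi' (hn i hi)
    · exact h'
  refine ⟨hB.sorted, hle, ?_, ?_, ?_, ?_, ?_, ?_, ?_, ?_⟩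
  · intro j hj hjn
    by_cases hjx : W' j = x
    · rw [hjx]
      simp only [Function.update_self]
      constructor <;> linarith [(h.nonneg x).1, (h.nonneg x).2]
    · rw [Function.update_of_ne hjx, Function.update_of_ne hjx]
      rcases (hB.mem _ hjn).1 (Or.inl ⟨j, hj, rfl⟩) with ⟨i, hi, hi'⟩ | h'
      · have := h.heavy i hi (by omega)
        rwa [hi'] at this
      · exact absurd h' hjx
  · intro y hy hn
    by_cases hyc : y = c
    · subst hyc
      exact Or.inr fun j hj => (hB.lt j hj).resolve_right hy.ne
    · have hyx : y ≠ x := fun h' => hyc (h'.trans (hxc (h' ▸ hn)))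
      rw [Function.update_of_ne hyx, Function.update_of_ne hyx]
      exact (h.out y hy (hnew y hy hyc hyx hn)).imp_right
        fun h' j hj => (hB.le j hj).trans_lt (h' j hj)
  · rintro y hy ⟨j, hj, rfl⟩
    have hne : c < n → W' j ≠ c := hcW j hj
    -- A key of the new window was in the old window or carried no weight before. It cannot have
    -- been an active key in the tree, since those exceed all old window entries, whereas the new
    -- entries are at most the old ones.
    have key : g (W' j) = 0 := by
      by_cases hin : ∃ i < k0, W i = W' j
      · exact h.leaf _ hy hin
      · have hin' : ∀ i < k0, W i ≠ W' j := fun i hi he => hin ⟨i, hi, he⟩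
        rcases h.out _ hy hin' with h' | h'
        · rw [h.leaf' _ hy hin', h'.1, h'.2]; ring
        · exact absurd (h' j hj) (not_lt.2 (hB.le j hj))
    split_ifs with hc
    · rw [Function.update_of_ne (hne hc), key]
    · exact key
  · intro y hy hn
    by_cases hyc : y = c
    · subst hyc
      simp [hy]
    · have hyx : y ≠ x := fun h' => hyc (h'.trans (hxc (h' ▸ hn)))
      rw [Function.update_of_ne hyx, Function.update_of_ne hyx,
        ← h.leaf' y hy (hnew y hy hyc hyx hn)]
      split_ifs
      · rw [Function.update_of_ne hyc]
      · rfl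
  · intro y hy
    split_ifs with hc
    · rw [Function.update_of_ne (by omega), h.leaf_top y hy]
    · exact h.leaf_top y hy
  · rw [Function.update_of_ne hx.ne', Function.update_of_ne hx.ne']
    exact h.sentinel
  · intro y
    by_cases hyx : y = x
    · subst hyx
      simp only [Function.update_self]
      constructor <;> linarith [(h.nonneg y).1, (h.nonneg y).2]
    · rw [Function.update_of_ne hyx, Function.update_of_ne hyx]
      exact h.nonneg y
  · rw [Function.update_of_ne hx0.ne, Function.update_of_ne hx0.ne]
    exact h.zero

/-- Total weight of the keys up to `r`. -/
def reach (f : ℕ → ℝ) (r : ℕ) : ℝ := ∑ x ∈ range (r + 1), f x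

/-- Total weight of the first `i` window entries. -/
def winSum (W : ℕ → ℕ) (f : ℕ → ℝ) (i : ℕ) : ℝ := ∑ j ∈ range i, f (W j)

theorem reach_linear (a₁ a₂ : ℝ) (f g : ℕ → ℝ) (r : ℕ) :
    reach (fun x => a₁ * f x + a₂ * g x) r = a₁ * reach f r + a₂ * reach g r := by
  simp [reach, Finset.sum_add_distrib, Finset.mul_sum]

theorem winSum_linear (W : ℕ → ℕ) (a₁ a₂ : ℝ) (f g : ℕ → ℝ) (r : ℕ) :
    winSum W (fun x => a₁ * f x + a₂ * g x) r = a₁ * winSum W f r + a₂ * winSum W g r := by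
  simp [winSum, Finset.sum_add_distrib, Finset.mul_sum]

/-! ### Reaches as window prefixes, possibly continued by a prefix of the tree -/

section reach

variable {n k0 : ℕ} {δ a₁ a₂ : ℝ} {W : ℕ → ℕ} {fm fb g : ℕ → ℝ}

open Classical in
-- Only the padding entries `n` can repeat in the window. They are excluded by `r < n`, so each
-- window key up to `r` is counted once.
theorem SideInv.reach_split (h : SideInv n k0 δ a₁ a₂ W fm fb g) (f : ℕ → ℝ) {r : ℕ} (hr : r < n) :
    reach f r = (∑ j ∈ range k0 with W j ≤ r, f (W j)) +
      ∑ x ∈ range (r + 1) with ¬ ∃ j < k0, W j = x, f x := by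
  have hinj : Set.InjOn W ({j ∈ range k0 | W j ≤ r} : Finset ℕ) := by
    intro i hi j hj hij
    simp only [coe_filter, mem_range, Set.mem_ofPred_eq] at hi hj
    rcases lt_trichotomy i j with hlt | rfl | hlt
    · rcases h.sorted i j hlt hj.1 with h' | h' <;> omega
    · rfl
    · rcases h.sorted j i hlt hi.1 with h' | h' <;> omega
  rw [reach, ← Finset.sum_filter_add_sum_filter_not _ (fun x => ∃ j < k0, W j = x),
    ← Finset.sum_image (f := f) hinj]
  congr 2
  ext x
  simp only [mem_filter, mem_range, mem_image, Nat.lt_succ_iff]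
  constructor
  · rintro ⟨hx, j, hj, rfl⟩
    exact ⟨j, ⟨hj, hx⟩, rfl⟩
  · rintro ⟨j, ⟨hj, hx⟩, rfl⟩
    exact ⟨hx, j, hj, rfl⟩

/-- Active keys outside the window exceed all its entries. By `h3` some entry is at least `r`, so no
such key lies within the reach. -/
theorem SideInv.reach_eq_winSum (h : SideInv n k0 δ a₁ a₂ W fm fb g) {r i : ℕ} (hr : r < n)
    (hi : i ≤ k0) (h1 : ∀ j < i, W j ≤ r) (h2 : ∀ j, i ≤ j → j < k0 → r < W j)
    (h3 : ∃ j < k0, r ≤ W j) :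
    reach fm r = winSum W fm i ∧ reach fb r = winSum W fb i := by
  classical
  have hf : ({j ∈ range k0 | W j ≤ r} : Finset ℕ) = range i := by
    ext j
    simp only [mem_filter, mem_range]
    constructor
    · rintro ⟨hj, hjr⟩
      by_contra hij
      exact absurd (h2 j (not_lt.1 hij) hj) (not_lt.2 hjr)
    · exact fun hj => ⟨by omega, h1 j hj⟩
  have hz : ∀ x ∈ ({x ∈ range (r + 1) | ¬ ∃ j < k0, W j = x} : Finset ℕ),
      fm x = 0 ∧ fb x = 0 := by
    intro x hx
    simp only [mem_filter, mem_range, not_exists, not_and] at hx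
    refine (h.out x (by omega) hx.2).resolve_right fun h' => ?_
    obtain ⟨j, hj, hjr⟩ := h3
    have := h' j hj
    omega
  rw [h.reach_split fm hr, h.reach_split fb hr, hf, Finset.sum_eq_zero fun x hx => (hz x hx).1,
    Finset.sum_eq_zero fun x hx => (hz x hx).2]
  simp [winSum]

/-- The converse direction, used for soundness: every window prefix is realised. Padding entries add
the weight of the sentinel `n`, which is zero, so a prefix that runs into the padding repeats an
earlier reach. -/
theorem SideInv.exists_reach (h : SideInv n k0 δ a₁ a₂ W fm fb g) (hn : 0 < n) {i : ℕ}
    (hi : i ≤ k0) : ∃ r < n, reach fm r = winSum W fm i ∧ reach fb r = winSum W fb i := by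
  induction i with
  | zero => exact ⟨0, hn, by simp [reach, winSum, h.zero]⟩
  | succ i ih =>
    rcases (h.le i hi).lt_or_eq with hlt | heq
    · refine ⟨W i, hlt, h.reach_eq_winSum hlt hi ?_ ?_ ⟨i, hi, le_rfl⟩⟩
      · intro j hj
        rcases Nat.lt_succ_iff_lt_or_eq.1 hj with hj | rfl
        · rcases h.sorted j i hj hi with h' | h' <;> omega
        · exact le_rfl
      · intro j hij hj
        rcases h.sorted i j hij hj with h' | h' <;> omega
    · obtain ⟨r, hr, h1, h2⟩ := ih (by omega)
      refine ⟨r, hr, ?_, ?_⟩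
      · rw [h1, winSum, winSum, Finset.sum_range_succ, heq, h.sentinel.1, add_zero]
      · rw [h2, winSum, winSum, Finset.sum_range_succ, heq, h.sentinel.2, add_zero]

/-- Once the reach covers all window entries, the rest of it consists of keys outside the window,
whose values are exactly their leaves; the leaves of window keys are zero and may be included in the
sum. -/
theorem SideInv.reach_full (h : SideInv n k0 δ a₁ a₂ W fm fb g) {r : ℕ} (hr : r < n)
    (hf : ∀ j < k0, W j ≤ r) :
    reach (fun x => a₁ * fm x + a₂ * fb x) r =
      winSum W (fun x => a₁ * fm x + a₂ * fb x) k0 + ∑ x ∈ range (r + 1), g x ∧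
    winSum W fm k0 ≤ reach fm r ∧ winSum W fb k0 ≤ reach fb r := by
  classical
  have hff : ({j ∈ range k0 | W j ≤ r} : Finset ℕ) = range k0 := by
    ext j
    simp only [mem_filter, mem_range]
    exact ⟨fun h => h.1, fun hj => ⟨hj, hf j hj⟩⟩
  rw [h.reach_split _ hr, h.reach_split fm hr, h.reach_split fb hr, hff]
  refine ⟨?_, ?_, ?_⟩
  · rw [winSum, ← Finset.sum_filter_add_sum_filter_not (range (r + 1))
      (fun x => ∃ j < k0, W j = x) g, Finset.sum_eq_zero (s := filter _ _) (f := g), zero_add]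
    · congr 1
      refine Finset.sum_congr rfl fun x hx => ?_
      simp only [mem_filter, mem_range, not_exists, not_and] at hx
      exact (h.leaf' x (by omega) hx.2).symm
    · intro x hx
      simp only [mem_filter, mem_range] at hx
      exact h.leaf x (by omega) hx.2
  · exact le_add_of_nonneg_right (Finset.sum_nonneg fun x _ => (h.nonneg x).1)
  · exact le_add_of_nonneg_right (Finset.sum_nonneg fun x _ => (h.nonneg x).2)

/-- Every reach is a window prefix or extends beyond a full window. -/
theorem SideInv.reach_cases (h : SideInv n k0 δ a₁ a₂ W fm fb g) {p : ℝ}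
    (hp : ∀ j ≤ n, ∑ x ∈ range j, g x ≤ p) {r : ℕ} (hr : r < n) :
    (∃ i ≤ k0, reach fm r = winSum W fm i ∧ reach fb r = winSum W fb i) ∨
    (k0 * δ ≤ winSum W fm k0 ∧ k0 * δ ≤ winSum W fb k0 ∧
      a₁ * reach fm r + a₂ * reach fb r ≤ a₁ * winSum W fm k0 + a₂ * winSum W fb k0 + p) := by
  classical
  by_cases hf : ∀ j < k0, W j ≤ r
  · right
    obtain ⟨h1, -, -⟩ := h.reach_full hr hf
    rw [reach_linear, winSum_linear] at h1
    -- Entries that are at most `r < n` are not padding. The window is therefore full and each of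
    -- its `k0` keys weighs at least `δ`.
    have hδ : ∀ j ∈ range k0, δ ≤ fm (W j) ∧ δ ≤ fb (W j) := fun j hj =>
      h.heavy j (mem_range.1 hj) ((hf j (mem_range.1 hj)).trans_lt hr)
    refine ⟨?_, ?_, by linarith [hp (r + 1) hr]⟩
    · simpa [winSum] using Finset.card_nsmul_le_sum (range k0) _ δ fun j hj => (hδ j hj).1
    · simpa [winSum] using Finset.card_nsmul_le_sum (range k0) _ δ fun j hj => (hδ j hj).2
  · left
    have hex : ∃ j, j < k0 ∧ r < W j := by
      push Not at hf
      exact hf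
    obtain ⟨hi, hri⟩ := Nat.find_spec hex
    -- The prefix ends just before the first window entry beyond `r`.
    refine ⟨Nat.find hex, hi.le, h.reach_eq_winSum hr hi.le ?_ ?_ ⟨_, hi, hri.le⟩⟩
    · intro j hj
      have := Nat.find_min hex hj
      push Not at this
      exact this (hj.trans hi)
    · intro j hij hj
      rcases hij.lt_or_eq with hlt | heq
      · rcases h.sorted _ j hlt hj with h' | h' <;> omega
      · rwa [← heq]

/-- The value read off the tree is attained by a reach that contains the whole window. -/
theorem SideInv.exists_reach_beyond (h : SideInv n k0 δ a₁ a₂ W fm fb g) (hn : 0 < n) {j : ℕ}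
    {p : ℝ} (hp : p = ∑ x ∈ range j, g x) :
    ∃ r < n, winSum W fm k0 ≤ reach fm r ∧ winSum W fb k0 ≤ reach fb r ∧
      a₁ * reach fm r + a₂ * reach fb r = a₁ * winSum W fm k0 + a₂ * winSum W fb k0 + p := by
  classical
  -- If the leaves of the prefix vanish, the reach of the window alone attains the value. Otherwise
  -- some leaf is nonzero; its key is active and exceeds all window entries, so the prefix covers
  -- the window.
  by_cases hz : ∀ x < j, g x = 0
  · obtain ⟨r, hr, h1, h2⟩ := h.exists_reach hn le_rfl
    refine ⟨r, hr, h1.ge, h2.ge, ?_⟩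
    rw [hp, Finset.sum_eq_zero fun x hx => hz x (mem_range.1 hx), h1, h2, add_zero]
  · push Not at hz
    obtain ⟨x, hxj, hx⟩ := hz
    have hxn : x < n := by
      by_contra hxn
      exact hx (h.leaf_top x (not_lt.1 hxn))
    have hxW : ∀ i < k0, W i ≠ x := fun i hi he => hx (h.leaf x hxn ⟨i, hi, he⟩)
    have hbig : ∀ i < k0, W i < x := by
      refine (h.out x hxn hxW).resolve_left fun h0 => hx ?_
      rw [h.leaf' x hxn hxW, h0.1, h0.2]; ring
    -- A reach `r` comprises `r + 1` keys, and the leaves from `n` on are zero, so a prefix of `j`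
    -- leaves corresponds to the reach `min j n - 1`.
    have hr : min j n - 1 < n := by omega
    obtain ⟨h1, h2, h3⟩ := h.reach_full hr fun i hi => by have := hbig i hi; omega
    refine ⟨_, hr, h2, h3, ?_⟩
    rw [reach_linear, winSum_linear] at h1
    rw [h1, hp, Nat.sub_add_cancel (by omega)]
    congr 1
    refine Finset.sum_subset (fun y hy => ?_) fun y hy hy' => h.leaf_top y ?_
    · simp only [mem_range] at hy ⊢; omega
    · simp only [mem_range] at hy hy'; omega

end reach

end ScanStat

/-! ## Programs for one side of the sweep -/

namespace ScanStat

open RealRAM Finset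

/-- First array of a side: `false` is the right side, `true` the left side. -/
def bs (σ : Bool) : ℕ := cond σ 30 20

/-- First output register of a side. -/
def rb (σ : Bool) : ℕ := cond σ 50 40

/-- Insert the key in register 13 into the window; the evicted key ends in register 14. -/
def bubble (k0 : ℕ) (σ : Bool) : Cmd :=
  .iset 14 (.reg 13) ;;
  forC 15 (.const k0)
    (.ite (.ilt (.reg 14) (.load (bs σ) (.reg 15)))
      (.iset 16 (.load (bs σ) (.reg 15)) ;; .istore (bs σ) (.reg 15) (.reg 14) ;;
        .iset 14 (.reg 16))
      (.ite (.ilt (.load (bs σ) (.reg 15)) (.reg 14)) .skip (.iset 14 (.reg 0))))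

/-- State of the insertion before the window entry `k` is inspected. -/
structure Bubbling (n k0 : ℕ) (W : ℕ → ℕ) (x k : ℕ) (W' : ℕ → ℕ) (c : ℕ) : Prop where
  sorted : ∀ i j, i < j → j < k0 → W' i < W' j ∨ W' j = n
  le : ∀ j < k0, W' j ≤ W j
  same : ∀ j, k ≤ j → W' j = W j
  carry_le : c ≤ n
  lt : ∀ j < k, W' j < c ∨ c = n
  mem : ∀ y < n, ((∃ j < k0, W' j = y) ∨ y = c) ↔ ((∃ j < k0, W j = y) ∨ y = x)

/-- One step of insertion into a sorted list: the carried key is smaller than entry `k`, takes its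
place, and the displaced entry is carried on. -/
theorem Bubbling.swap {n k0 : ℕ} {W : ℕ → ℕ} {x k : ℕ} {W' : ℕ → ℕ} {c : ℕ}
    (h : Bubbling n k0 W x k W' c) (hW : ∀ j < k0, W j ≤ n) (hk : k < k0) (hc : c < W' k) :
    Bubbling n k0 W x (k + 1) (Function.update W' k c) (W' k) := by
  have hWk : W' k ≤ n := (h.le k hk).trans (hW k hk)
  refine ⟨?_, ?_, ?_, hWk, ?_, ?_⟩
  · intro i j hij hj
    rcases eq_or_ne i k with hi | hi <;> rcases eq_or_ne j k with hj' | hj'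
    · omega
    · rw [hi, Function.update_self, Function.update_of_ne hj']
      rcases h.sorted k j (by omega) hj with h' | h' <;> omega
    · rw [hj', Function.update_self, Function.update_of_ne hi]
      rcases h.lt i (by omega) with h' | h' <;> omega
    · rw [Function.update_of_ne hi, Function.update_of_ne hj']
      exact h.sorted i j hij hj
  · intro j hj
    rcases eq_or_ne j k with rfl | hj'
    · rw [Function.update_self]; exact hc.le.trans (h.le j hj)
    · rw [Function.update_of_ne hj']; exact h.le j hj
  · intro j hj
    rw [Function.update_of_ne (by omega)]
    exact h.same j (by omega)
  · intro j hj
    rcases eq_or_ne j k with rfl | hj'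
    · rw [Function.update_self]; exact Or.inl hc
    · rw [Function.update_of_ne hj']
      rcases h.lt j (by omega) with h' | h' <;> omega
  · intro y hy
    rw [← h.mem y hy]
    constructor
    · rintro (⟨j, hj, rfl⟩ | rfl)
      · rcases eq_or_ne j k with rfl | hj'
        · rw [Function.update_self]; exact Or.inr rfl
        · rw [Function.update_of_ne hj']; exact Or.inl ⟨j, hj, rfl⟩
      · exact Or.inl ⟨k, hk, rfl⟩
    · rintro (⟨j, hj, rfl⟩ | rfl)
      · rcases eq_or_ne j k with rfl | hj'
        · exact Or.inr rfl
        · exact Or.inl ⟨j, hj, Function.update_of_ne hj' _ _⟩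
      · exact Or.inl ⟨k, hk, Function.update_self _ _ _⟩

theorem Bubbling.pass {n k0 : ℕ} {W : ℕ → ℕ} {x k : ℕ} {W' : ℕ → ℕ} {c : ℕ}
    (h : Bubbling n k0 W x k W' c) (hc : W' k < c) : Bubbling n k0 W x (k + 1) W' c :=
  ⟨h.sorted, h.le, fun j hj => h.same j (by omega), h.carry_le, fun j hj => by
    rcases Nat.lt_succ_iff_lt_or_eq.1 hj with hj | rfl
    · exact h.lt j hj
    · exact Or.inl hc, h.mem⟩

/-- The carried key is already present, which happens when several points share an abscissa. Nothing
is evicted, and the carry becomes the neutral value `n`. -/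
theorem Bubbling.drop {n k0 : ℕ} {W : ℕ → ℕ} {x k : ℕ} {W' : ℕ → ℕ} {c : ℕ}
    (h : Bubbling n k0 W x k W' c) (hk : k < k0) (hc : W' k = c) :
    Bubbling n k0 W x (k + 1) W' n := by
  refine ⟨h.sorted, h.le, fun j hj => h.same j (by omega), le_rfl, fun j hj => Or.inr rfl, ?_⟩
  intro y hy
  rw [← h.mem y hy]
  constructor
  · rintro (h' | rfl)
    · exact Or.inl h'
    · omega
  · rintro (h' | rfl)
    · exact Or.inl h'
    · exact Or.inl ⟨k, hk, hc⟩

theorem bubble_spec {k0 n x : ℕ} {σ : Bool} {s : State} {W : ℕ → ℕ} (hn : s.ireg 0 = n)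
    (hx : s.ireg 13 = x) (hxn : x < n) (hWe : s.iarr (bs σ) = W)
    (hs : ∀ i j, i < j → j < k0 → W i < W j ∨ W j = n) (hW : ∀ j < k0, W j ≤ n) :
    Runs (bubble k0 σ) s (40 * k0 + 20) fun s' =>
      Bubbled n k0 W x (s'.iarr (bs σ)) (s'.ireg 14) := by
  unfold bubble
  refine Runs.le (Runs.seq_iset (Runs.forC (m := k0) (T := 30) (fun k s' =>
    Bubbling n k0 W x k (s'.iarr (bs σ)) (s'.ireg 14)) rfl (fun _ _ => rfl)
    ?_ ?_ (fun s₁ _ _ h => ⟨h.sorted, h.le, h.carry_le, ?_, h.mem⟩))) ?_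
  · refine ⟨by simpa [hWe] using hs, by simp [hWe], by simp [hWe], by simp [hx, hxn.le], by simp, ?_⟩
    simp [hWe, hx]
  · intro k s₁ hk hs₁ hi h
    have h0 : s₁.ireg 0 = n := by rw [hs₁.i 0 rfl]; simpa using hn
    refine (Runs.ite (fun hb => Runs.seq_iset (Runs.seq_istore (Runs.iset ?_)))
      (fun hb => Runs.ite (fun hb' => Runs.skip ?_) (fun hb' => Runs.iset ?_))).le (by simp)
    · simp [hi] at hb
      simpa [hi] using h.swap hW hk hb
    · simp [hi] at hb'
      simpa using h.pass hb'
    · simp [hi] at hb hb'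
      simpa [h0] using h.drop hk (le_antisymm hb hb')
  · exact h.lt
  · simp
    ring_nf
    omega

/-- Set the leaf of the key in register 14 to its current value and update its ancestors. -/
def treeSet (σ : Bool) : Cmd :=
  .iset 17 (.add (.reg 1) (.reg 14)) ;;
  .rset 44 (.add (.mul (.reg 10) (.load (bs σ) (.reg 14)))
    (.mul (.reg 11) (.load (bs σ + 1) (.reg 14)))) ;;
  .rstore (bs σ + 2) (.reg 17) (.reg 44) ;;
  .ite (.rlt (.ofNat (.const 0)) (.reg 44))
    (.rstore (bs σ + 3) (.reg 17) (.reg 44)) (.rstore (bs σ + 3) (.reg 17) (.ofNat (.const 0))) ;;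
  .loop (.ilt (.const 1) (.reg 17))
    (.iset 17 (.load 2 (.reg 17)) ;;
    .rstore (bs σ + 2) (.reg 17) (.add (.load (bs σ + 2) (.add (.reg 17) (.reg 17)))
      (.load (bs σ + 2) (.add (.add (.reg 17) (.reg 17)) (.const 1)))) ;;
    .rset 44 (.add (.load (bs σ + 2) (.add (.reg 17) (.reg 17)))
      (.load (bs σ + 3) (.add (.add (.reg 17) (.reg 17)) (.const 1)))) ;;
    .ite (.rlt (.load (bs σ + 3) (.add (.reg 17) (.reg 17))) (.reg 44))
      (.rstore (bs σ + 3) (.reg 17) (.reg 44))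
      (.rstore (bs σ + 3) (.reg 17) (.load (bs σ + 3) (.add (.reg 17) (.reg 17)))))

/-- The tree is correct except possibly at the proper ancestors of `v`. -/
structure TreeFix (Z v : ℕ) (S P g : ℕ → ℝ) : Prop where
  node : ∀ u, 1 ≤ u → u < Z → (∀ i, 1 ≤ i → u ≠ v / 2 ^ i) →
    S u = S (u + u) + S (u + u + 1) ∧ P u = max (P (u + u)) (S (u + u) + P (u + u + 1))
  leaf : ∀ i < Z, S (Z + i) = g i ∧ P (Z + i) = max 0 (g i)

theorem TreeOK.set_leaf {Z c : ℕ} {S P g : ℕ → ℝ} (h : TreeOK Z S P g) (x : ℝ) :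
    TreeFix Z (Z + c) (Function.update S (Z + c) x) (Function.update P (Z + c) (max 0 x))
      (Function.update g c x) := by
  refine ⟨fun u hu huZ hne => ?_, fun i hi => ?_⟩
  · have h1 := hne 1 le_rfl
    rw [pow_one] at h1
    rw [Function.update_of_ne (by omega), Function.update_of_ne (by omega),
      Function.update_of_ne (by omega), Function.update_of_ne (by omega),
      Function.update_of_ne (by omega), Function.update_of_ne (by omega)]
    exact h.node u hu huZ
  · rcases eq_or_ne i c with rfl | hic
    · simp
    · have hne : Z + i ≠ Z + c := by omega
      rw [Function.update_of_ne hne, Function.update_of_ne hne, Function.update_of_ne hic]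
      exact h.leaf i hi

/-- Recomputing the parent of `v` repairs it, because both children are correct. The nodes still in
doubt are the proper ancestors of `v / 2`, which are the ancestors of `v` with the first one
removed. -/
theorem TreeFix.step {Z v : ℕ} {S P g : ℕ → ℝ} (h : TreeFix Z v S P g)
    (hvZ : v < Z + Z) :
    TreeFix Z (v / 2) (Function.update S (v / 2) (S (v / 2 + v / 2) + S (v / 2 + v / 2 + 1)))
      (Function.update P (v / 2) (max (P (v / 2 + v / 2))
        (S (v / 2 + v / 2) + P (v / 2 + v / 2 + 1)))) g := by
  refine ⟨fun u hu huZ hne => ?_, fun i hi => ?_⟩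
  · rcases eq_or_ne u (v / 2) with rfl | huv
    · rw [Function.update_self, Function.update_self, Function.update_of_ne (by omega),
        Function.update_of_ne (by omega), Function.update_of_ne (by omega),
        Function.update_of_ne (by omega)]
      exact ⟨rfl, rfl⟩
    · have h1 := hne 1 le_rfl
      rw [pow_one] at h1
      rw [Function.update_of_ne huv, Function.update_of_ne huv, Function.update_of_ne (by omega),
        Function.update_of_ne (by omega), Function.update_of_ne (by omega),
        Function.update_of_ne (by omega)]
      refine h.node u hu huZ fun i hi => ?_
      rcases hi.lt_or_eq with hi' | rfl
      · have := hne (i - 1) (by omega)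
        rwa [Nat.div_div_eq_div_mul, ← pow_succ', Nat.sub_add_cancel hi] at this
      · rwa [pow_one]
  · rw [Function.update_of_ne (by omega), Function.update_of_ne (by omega)]
    exact h.leaf i hi

theorem TreeFix.ok {Z v : ℕ} {S P g : ℕ → ℝ} (h : TreeFix Z v S P g) (hv : v ≤ 1) :
    TreeOK Z S P g := by
  refine ⟨fun u hu huZ => h.node u hu huZ fun i hi => ?_, h.leaf⟩
  have : v / 2 ^ i = 0 := Nat.div_eq_of_lt
    (hv.trans_lt (Nat.one_lt_two_pow (by omega)))
  omega

/-- The program climbs from the leaf to the root. Its position stays below `2 ^ (k + 1)`, where `k`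
bounds the number of remaining steps, so `h` repairs suffice. Parents are read from a table, because
the machine has no division of naturals. -/
theorem treeSet_spec {h c : ℕ} {σ : Bool} {s : State} {g : ℕ → ℝ} {x : ℝ}
    (hZ : s.ireg 1 = 2 ^ h) (hpar : ∀ v < 2 ^ h + 2 ^ h, s.iarr 2 v = v / 2)
    (hc : s.ireg 14 = c) (hcZ : c < 2 ^ h)
    (hT : TreeOK (2 ^ h) (s.rarr (bs σ + 2)) (s.rarr (bs σ + 3)) g)
    (hx : s.rreg 10 * s.rarr (bs σ) c + s.rreg 11 * s.rarr (bs σ + 1) c = x) :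
    Runs (treeSet σ) s (50 * h + 40) fun s' =>
      TreeOK (2 ^ h) (s'.rarr (bs σ + 2)) (s'.rarr (bs σ + 3)) (Function.update g c x) := by
  unfold treeSet
  refine Runs.le (Runs.seq_iset (Runs.seq_rset (Runs.seq_rstore (Runs.seq (R := fun s' =>
    TreeFix (2 ^ h) (2 ^ h + c) (s'.rarr (bs σ + 2)) (s'.rarr (bs σ + 3)) (Function.update g c x))
    (Runs.ite (fun hb => Runs.rstore ?_) (fun hb => Runs.rstore ?_)) (fun s₁ hs₁ h₁ =>
      (Runs.loop (T := 45) (fun k s' => 1 ≤ s'.ireg 17 ∧ s'.ireg 17 < 2 ^ (k + 1) ∧ k ≤ h ∧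
        (∀ v < 2 ^ h + 2 ^ h, s'.iarr 2 v = v / 2) ∧
        TreeFix (2 ^ h) (s'.ireg 17) (s'.rarr (bs σ + 2)) (s'.rarr (bs σ + 3))
          (Function.update g c x)) ?_ h s₁ ?_).conseq le_rfl ?_))))) ?_
  · simp [hZ, hc, hx] at hb ⊢
    have := hT.set_leaf (c := c) x
    rwa [max_eq_right hb.le] at this
  · simp [hZ, hc, hx] at hb ⊢
    have := hT.set_leaf (c := c) x
    rwa [max_eq_left hb] at this
  · rintro k s₂ ⟨g1, g2, g3, g4, g5⟩ hb
    simp at hb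
    have hk : 0 < k := by
      rcases Nat.eq_zero_or_pos k with rfl | hk
      · simp at g2; omega
      · exact hk
    have hvZ : s₂.ireg 17 < 2 ^ h + 2 ^ h := by
      refine g2.trans_le ((Nat.pow_le_pow_right (by norm_num) (by omega :
        k + 1 ≤ h + 1)).trans (by rw [pow_succ]; omega))
    have hpow : 2 ^ (k + 1) = 2 ^ (k - 1 + 1) + 2 ^ (k - 1 + 1) := by
      rw [Nat.sub_add_cancel hk, pow_succ]; ring
    have hst := g5.step hvZ
    refine ⟨hk, (Runs.seq_iset (Runs.seq_rstore (Runs.seq_rset (Runs.ite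
      (fun hb' => Runs.rstore ?_) (fun hb' => Runs.rstore ?_))))).le (by simp)⟩
    all_goals
      have hne : s₂.ireg 17 / 2 + s₂.ireg 17 / 2 ≠ s₂.ireg 17 / 2 := by omega
      have hne' : s₂.ireg 17 / 2 + s₂.ireg 17 / 2 + 1 ≠ s₂.ireg 17 / 2 := by omega
      simp [g4 _ hvZ, Function.update_of_ne hne, Function.update_of_ne hne'] at hb' ⊢
      refine ⟨by omega, by omega, by omega, g4, ?_⟩
    · rwa [max_eq_right hb'.le] at hst
    · rwa [max_eq_left hb'] at hst
  · have e17 := hs₁.i 17 rfl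
    have e2 := hs₁.ia 2 rfl
    simp [hZ, hc] at e17 e2
    refine ⟨?_, ?_, le_rfl, ?_, ?_⟩
    · have := Nat.one_le_two_pow (n := h); omega
    · rw [e17, pow_succ]; omega
    · rwa [e2]
    · rwa [e17]
  · rintro s₂ - ⟨hb, k, -, -, -, -, hf⟩
    exact hf.ok (by simpa using hb)
  · simp
    ring_nf
    omega

end ScanStat

/-! ### The memory of one side: reset, insertion and optimum -/

namespace ScanStat

open RealRAM Finset

/-- The memory holds the instance, the tables and the coefficients of a linear function. -/
structure Aux (I : Inst) (h : ℕ) (xr : ℕ → ℕ) (a₁ a₂ a₃ : ℝ) (s : State) : Prop where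
  env : I.Env s
  Z : s.ireg 1 = 2 ^ h
  par : ∀ v < 2 ^ h + 2 ^ h, s.iarr 2 v = v / 2
  xr : s.iarr 0 = xr
  a₁ : s.rreg 10 = a₁
  a₂ : s.rreg 11 = a₂
  a₃ : s.rreg 12 = a₃

theorem Aux.of_same {I : Inst} {h : ℕ} {xr : ℕ → ℕ} {a₁ a₂ a₃ : ℝ} {p : Cmd} {s s' : State}
    (hA : Aux I h xr a₁ a₂ a₃ s) (hs : Same p s s')
    (hp : (p.wI 0 || p.wRA 4 || p.wRA 5 || p.wRA 6 || p.wRA 7 || p.wR 7 || p.wR 8 || p.wR 9)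
      = false)
    (hp' : (p.wI 1 || p.wIA 0 || p.wIA 2 || p.wR 10 || p.wR 11 || p.wR 12) = false) :
    Aux I h xr a₁ a₂ a₃ s' := by
  simp only [Bool.or_eq_false_iff] at hp'
  obtain ⟨⟨⟨⟨⟨h1, h2⟩, h3⟩, h4⟩, h5⟩, h6⟩ := hp'
  exact ⟨hA.env.of_same hs hp, by rw [hs.i _ h1, hA.Z], by rw [hs.ia _ h3]; exact hA.par,
    by rw [hs.ia _ h2, hA.xr], by rw [hs.r _ h4, hA.a₁], by rw [hs.r _ h5, hA.a₂],
    by rw [hs.r _ h6, hA.a₃]⟩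

/-- The memory of the side `σ` represents the key weights `fm` and `fb`. -/
structure SideSt (n h k0 : ℕ) (δ a₁ a₂ : ℝ) (σ : Bool) (fm fb : ℕ → ℝ) (s : State) : Prop where
  lm : ∀ x ≤ n, s.rarr (bs σ) x = fm x
  lb : ∀ x ≤ n, s.rarr (bs σ + 1) x = fb x
  inv : ∃ g, TreeOK (2 ^ h) (s.rarr (bs σ + 2)) (s.rarr (bs σ + 3)) g ∧
    SideInv n k0 δ a₁ a₂ (s.iarr (bs σ)) fm fb g

theorem SideSt.of_same {n h k0 : ℕ} {δ a₁ a₂ : ℝ} {σ : Bool} {fm fb : ℕ → ℝ} {p : Cmd}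
    {s s' : State} (hS : SideSt n h k0 δ a₁ a₂ σ fm fb s) (hs : Same p s s')
    (hp : (p.wRA (bs σ) || p.wRA (bs σ + 1) || p.wRA (bs σ + 2) || p.wRA (bs σ + 3) ||
      p.wIA (bs σ)) = false) : SideSt n h k0 δ a₁ a₂ σ fm fb s' := by
  simp only [Bool.or_eq_false_iff] at hp
  obtain ⟨⟨⟨⟨h1, h2⟩, h3⟩, h4⟩, h5⟩ := hp
  refine ⟨?_, ?_, ?_⟩
  · rw [hs.ra _ h1]; exact hS.lm
  · rw [hs.ra _ h2]; exact hS.lb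
  · rw [hs.ra _ h3, hs.ra _ h4, hs.ia _ h5]; exact hS.inv

/-- Make a side empty. -/
def resetSide (k0 : ℕ) (σ : Bool) : Cmd :=
  forC 18 (.add (.reg 1) (.reg 1))
    (.rstore (bs σ) (.reg 18) (.ofNat (.const 0)) ;;
      .rstore (bs σ + 1) (.reg 18) (.ofNat (.const 0)) ;;
      .rstore (bs σ + 2) (.reg 18) (.ofNat (.const 0)) ;;
      .rstore (bs σ + 3) (.reg 18) (.ofNat (.const 0))) ;;
  forC 18 (.const k0) (.istore (bs σ) (.reg 18) (.reg 0))

theorem resetSide_spec {n h k0 : ℕ} {δ a₁ a₂ : ℝ} {σ : Bool} {s : State}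
    (hn : s.ireg 0 = n) (hZ : s.ireg 1 = 2 ^ h) (hnZ : n ≤ 2 ^ h) :
    Runs (resetSide k0 σ) s (80 * 2 ^ h + 20 * k0 + 20) fun s' =>
      SideSt n h k0 δ a₁ a₂ σ (fun _ => 0) (fun _ => 0) s' := by
  unfold resetSide
  refine Runs.le (Runs.seq (R := fun s' => ∀ x < 2 ^ h + 2 ^ h, s'.rarr (bs σ) x = 0 ∧
      s'.rarr (bs σ + 1) x = 0 ∧ s'.rarr (bs σ + 2) x = 0 ∧ s'.rarr (bs σ + 3) x = 0)
    (Runs.forC (m := 2 ^ h + 2 ^ h) (T := 16) (fun k s' => ∀ x < k, s'.rarr (bs σ) x = 0 ∧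
      s'.rarr (bs σ + 1) x = 0 ∧ s'.rarr (bs σ + 2) x = 0 ∧ s'.rarr (bs σ + 3) x = 0) rfl
      (fun s₁ hs₁ => ?_) (by simp) (fun k s₁ hk hs₁ hi h' => ?_) (fun _ _ _ h => h))
    (fun s₁ hs₁ h₁ => Runs.forC (m := k0) (T := 3) (fun k s' => ∀ x < k, s'.iarr (bs σ) x = n) rfl
      (fun _ _ => rfl) (by simp) (fun k s₂ hk hs₂ hi h' => ?_) (fun s₂ hs₂ _ h₂ => ?_))) ?_
  · simp [hs₁.i 1 rfl, hZ]
  · refine (Runs.seq_rstore (Runs.seq_rstore (Runs.seq_rstore (Runs.rstore ?_)))).le (by simp)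
    intro x hx
    rcases Nat.lt_succ_iff_lt_or_eq.1 hx with hx | rfl
    · simpa [hi, Function.update_of_ne hx.ne] using h' x hx
    · simp [hi]
  · refine (Runs.istore ?_).le (by simp)
    have e0 : s₂.ireg 0 = n := by rw [hs₂.i 0 rfl, hs₁.i 0 rfl, hn]
    intro x hx
    rcases Nat.lt_succ_iff_lt_or_eq.1 hx with hx | rfl
    · simpa [hi, Function.update_of_ne hx.ne] using h' x hx
    · simp [hi, e0]
  · rw [← hs₂.ra (bs σ) rfl, ← hs₂.ra (bs σ + 1) rfl, ← hs₂.ra (bs σ + 2) rfl,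
      ← hs₂.ra (bs σ + 3) rfl] at h₁
    have hpos := Nat.one_le_two_pow (n := h)
    refine ⟨fun x hx => (h₁ x (by omega)).1, fun x hx => (h₁ x (by omega)).2.1, fun _ => 0, ?_, ?_⟩
    · refine ⟨fun u hu huZ => ?_, fun i hi => ?_⟩
      · simp [(h₁ u (by omega)).2.2, (h₁ (u + u) (by omega)).2.2, (h₁ (u + u + 1) (by omega)).2.2]
      · simp [(h₁ (2 ^ h + i) (by omega)).2.2]
    · exact ⟨fun i j hij hj => Or.inr (h₂ j hj), fun j hj => (h₂ j hj).le,
        fun j hj hj' => absurd (h₂ j hj) hj'.ne, fun _ _ _ => Or.inl ⟨rfl, rfl⟩, fun _ _ _ => rfl,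
        fun _ _ _ => by simp, fun _ _ => rfl, ⟨rfl, rfl⟩, fun _ => ⟨le_rfl, le_rfl⟩, ⟨rfl, rfl⟩⟩
  · simp
    ring_nf
    omega

/-- Add the weights in registers 34 and 35 to the key in register 13. -/
def sideInsert (k0 : ℕ) (σ : Bool) : Cmd :=
  .rstore (bs σ) (.reg 13) (.add (.load (bs σ) (.reg 13)) (.reg 34)) ;;
  .rstore (bs σ + 1) (.reg 13) (.add (.load (bs σ + 1) (.reg 13)) (.reg 35)) ;;
  bubble k0 σ ;;
  .ite (.ilt (.reg 14) (.reg 0)) (treeSet σ) .skip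

/-- The weights are increased before the window is changed, since the evicted key, whose leaf is
then written, may be the inserted one. The cost is linear in `k0` for the window and in `h` for the
tree. -/
theorem sideInsert_spec {I : Inst} {h k0 : ℕ} {xr : ℕ → ℕ} {δ a₁ a₂ a₃ : ℝ} {σ : Bool}
    {fm fb : ℕ → ℝ} {s : State} (hA : Aux I h xr a₁ a₂ a₃ s) (hnZ : I.n ≤ 2 ^ h)
    (hS : SideSt I.n h k0 δ a₁ a₂ σ fm fb s) {x : ℕ} {dm db : ℝ} (hx : s.ireg 13 = x) (hx0 : 0 < x)
    (hxn : x < I.n) (hdm : s.rreg 34 = dm) (hdb : s.rreg 35 = db) (hδ : 0 ≤ δ) (hδm : δ ≤ dm)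
    (hδb : δ ≤ db) :
    Runs (sideInsert k0 σ) s (40 * k0 + 50 * h + 100) fun s' =>
      SideSt I.n h k0 δ a₁ a₂ σ (Function.update fm x (fm x + dm))
        (Function.update fb x (fb x + db)) s' := by
  obtain ⟨g, hT, hI⟩ := hS.inv
  unfold sideInsert
  refine Runs.le (Runs.seq_rstore (Runs.seq_rstore (Runs.seq (R := fun s' =>
    Bubbled I.n k0 (s.iarr (bs σ)) x (s'.iarr (bs σ)) (s'.ireg 14)) (bubble_spec
      (n := I.n) (x := x) ?_ ?_ hxn ?_ hI.sorted hI.le) (fun s₁ hs₁ h₁ =>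
        Runs.ite (T₁ := 50 * h + 40) (fun hb => ?_) (fun hb => Runs.skip ?_))))) ?_
  · simp [hA.env.n]
  · simp [hx]
  · simp
  all_goals try
    have e0 : s₁.ireg 0 = I.n := by
      rw [hs₁.i 0 (by cases σ <;> rfl)]; simp [hA.env.n]
    have e1 : s₁.ireg 1 = 2 ^ h := by
      rw [hs₁.i 1 (by cases σ <;> rfl)]; simp [hA.Z]
    have b0 := hs₁.ra (bs σ) (by cases σ <;> rfl)
    have b1 := hs₁.ra (bs σ + 1) (by cases σ <;> rfl)
    have b2 := hs₁.ra (bs σ + 2) (by cases σ <;> rfl)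
    have b3 := hs₁.ra (bs σ + 3) (by cases σ <;> rfl)
    have hi2 := hs₁.ia 2 (by cases σ <;> rfl)
    have r10 := hs₁.r 10 (by cases σ <;> rfl)
    have r11 := hs₁.r 11 (by cases σ <;> rfl)
    simp [hx, hdm, hdb, hS.lm x hxn.le, hS.lb x hxn.le, hA.a₁, hA.a₂] at b0 b1 b2 b3 hi2 r10 r11
    have hupd : ∀ (f : ℕ → ℝ) (u : ℕ → ℝ) (v : ℝ), (∀ y ≤ I.n, u y = f y) →
        ∀ y ≤ I.n, Function.update u x v y = Function.update f x v y := by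
      intro f u v hf y hy
      rcases eq_or_ne y x with rfl | hyx
      · simp
      · rw [Function.update_of_ne hyx, Function.update_of_ne hyx, hf y hy]
    have hins := hI.insert hxn hx0 h₁ hδ hδm hδb
    simp [e0] at hb
  · refine (treeSet_spec (c := s₁.ireg 14) e1 (by rw [hi2]; exact hA.par) rfl (by omega)
      (by rw [b2, b3]; exact hT) rfl).conseq le_rfl fun s₂ hs₂ h₂ => ?_
    refine ⟨?_, ?_, _, h₂, ?_⟩
    · rw [hs₂.ra (bs σ) (by cases σ <;> rfl), b0]
      exact hupd fm _ _ hS.lm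
    · rw [hs₂.ra (bs σ + 1) (by cases σ <;> rfl), b1]
      exact hupd fb _ _ hS.lb
    · rw [hs₂.ia (bs σ) (by cases σ <;> rfl), b0, b1, r10, r11, hupd fm _ _ hS.lm _ hb.le,
        hupd fb _ _ hS.lb _ hb.le]
      rwa [if_pos hb] at hins
  · refine ⟨?_, ?_, g, ?_, ?_⟩
    · rw [b0]; exact hupd fm _ _ hS.lm
    · rw [b1]; exact hupd fb _ _ hS.lb
    · rw [b2, b3]; exact hT
    · rwa [if_neg (not_lt.2 hb)] at hins
  · simp
    omega

/-- What is known about the best value `B` of a side, its best value `E` beyond the window, and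
the window weights `wm` and `wb`. -/
structure SideOut (n k0 : ℕ) (δ a₁ a₂ : ℝ) (W : ℕ → ℕ) (fm fb : ℕ → ℝ) (B E wm wb : ℝ) :
    Prop where
  up : ∀ r < n, a₁ * reach fm r + a₂ * reach fb r ≤ B
  attained : ∃ r < n, B = a₁ * reach fm r + a₂ * reach fb r
  beyond : ∃ r < n, wm ≤ reach fm r ∧ wb ≤ reach fb r ∧ E = a₁ * reach fm r + a₂ * reach fb r
  cases : ∀ r < n, (∃ i ≤ k0, reach fm r = winSum W fm i ∧ reach fb r = winSum W fb i) ∨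
    (k0 * δ ≤ wm ∧ k0 * δ ≤ wb ∧ a₁ * reach fm r + a₂ * reach fb r ≤ E)

/-- Compute the best value of a side and its window weights. -/
def sideBest (k0 : ℕ) (σ : Bool) : Cmd :=
  .rset (rb σ) (.ofNat (.const 0)) ;; .rset (rb σ + 1) (.ofNat (.const 0)) ;;
  .rset (rb σ + 2) (.ofNat (.const 0)) ;; .rset (rb σ + 3) (.ofNat (.const 0)) ;;
  forC 15 (.const k0)
    (.rset (rb σ + 2) (.add (.reg (rb σ + 2)) (.load (bs σ) (.load (bs σ) (.reg 15)))) ;;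
    .rset (rb σ + 3) (.add (.reg (rb σ + 3)) (.load (bs σ + 1) (.load (bs σ) (.reg 15)))) ;;
    .rset (rb σ + 1) (.add (.mul (.reg 10) (.reg (rb σ + 2))) (.mul (.reg 11) (.reg (rb σ + 3)))) ;;
    .ite (.rlt (.reg (rb σ)) (.reg (rb σ + 1))) (.rset (rb σ) (.reg (rb σ + 1))) .skip) ;;
  .rset (rb σ + 1) (.add (.reg (rb σ + 1)) (.load (bs σ + 3) (.const 1))) ;;
  .ite (.rlt (.reg (rb σ)) (.reg (rb σ + 1))) (.rset (rb σ) (.reg (rb σ + 1))) .skip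

/-- The first output register is the maximum over all window prefixes and over the full window plus
the prefix maximum at the root. The second one is the latter value alone. It is meaningful even if
the window contains padding, but its support is guaranteed only through the two window weights. -/
theorem sideBest_spec {I : Inst} {h k0 : ℕ} {xr : ℕ → ℕ} {δ a₁ a₂ a₃ : ℝ} {σ : Bool}
    {fm fb : ℕ → ℝ} {s : State} (hA : Aux I h xr a₁ a₂ a₃ s) (hn : 0 < I.n) (hnZ : I.n ≤ 2 ^ h)
    (hS : SideSt I.n h k0 δ a₁ a₂ σ fm fb s) :
    Runs (sideBest k0 σ) s (60 * k0 + 60) fun s' =>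
      SideOut I.n k0 δ a₁ a₂ (s.iarr (bs σ)) fm fb (s'.rreg (rb σ)) (s'.rreg (rb σ + 1))
        (s'.rreg (rb σ + 2)) (s'.rreg (rb σ + 3)) := by
  obtain ⟨g, hT, hI⟩ := hS.inv
  obtain ⟨hp1, j, hj, hp2⟩ := hT.root
  set W := s.iarr (bs σ) with hW
  unfold sideBest
  let V : ℕ → ℝ := fun i => a₁ * winSum W fm i + a₂ * winSum W fb i
  have hrb : rb σ ≠ 10 ∧ rb σ ≠ 11 ∧ rb σ + 1 ≠ 10 ∧ rb σ + 1 ≠ 11 ∧ rb σ + 2 ≠ 10 ∧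
      rb σ + 2 ≠ 11 ∧ rb σ + 3 ≠ 10 ∧ rb σ + 3 ≠ 11 := by
    cases σ <;> simp [rb]
  obtain ⟨n1, n2, n3, n4, n5, n6, n7, n8⟩ := hrb
  refine Runs.le (Runs.seq_rset (Runs.seq_rset (Runs.seq_rset (Runs.seq_rset (Runs.seq
    (R := fun s' => s'.rreg (rb σ + 2) = winSum W fm k0 ∧ s'.rreg (rb σ + 3) = winSum W fb k0 ∧
      s'.rreg (rb σ + 1) = V k0 ∧ (∀ i ≤ k0, V i ≤ s'.rreg (rb σ)) ∧
      ∃ i ≤ k0, s'.rreg (rb σ) = V i)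
    (Runs.forC (m := k0) (T := 40) (fun k s' => s'.rreg (rb σ + 2) = winSum W fm k ∧
      s'.rreg (rb σ + 3) = winSum W fb k ∧
      s'.rreg (rb σ + 1) = V k ∧ (∀ i ≤ k, V i ≤ s'.rreg (rb σ)) ∧
      ∃ i ≤ k, s'.rreg (rb σ) = V i) ?_ (fun _ _ => rfl) ?_ (fun k s₁ hk hs₁ hi h' => ?_)
      (fun _ _ _ h => h))
    (fun s₁ hs₁ h₁ => Runs.seq_rset (Runs.ite (fun hb => Runs.rset ?_)
      (fun hb => Runs.skip ?_)))))))) ?_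
  · cases σ <;> rfl
  · simp [winSum, V]
  · have hWk : W k ≤ I.n := hI.le k hk
    have c0 : s₁.rarr (bs σ) (W k) = fm (W k) := by
      rw [hs₁.ra (bs σ) (by cases σ <;> rfl)]; exact hS.lm _ hWk
    have c1 : s₁.rarr (bs σ + 1) (W k) = fb (W k) := by
      rw [hs₁.ra (bs σ + 1) (by cases σ <;> rfl)]; exact hS.lb _ hWk
    have cW : s₁.iarr (bs σ) = W := hs₁.ia (bs σ) (by cases σ <;> rfl)
    have r10 : s₁.rreg 10 = a₁ := by
      rw [hs₁.r 10 (by cases σ <;> rfl)]; simp [hA.a₁, n1.symm, n3.symm, n5.symm, n7.symm]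
    have r11 : s₁.rreg 11 = a₂ := by
      rw [hs₁.r 11 (by cases σ <;> rfl)]; simp [hA.a₂, n2.symm, n4.symm, n6.symm, n8.symm]
    obtain ⟨g1, g2, g3, g4, i0, hi0, g5⟩ := h'
    have w1 : winSum W fm (k + 1) = winSum W fm k + fm (W k) := Finset.sum_range_succ _ _
    have w2 : winSum W fb (k + 1) = winSum W fb k + fb (W k) := Finset.sum_range_succ _ _
    have hV : V (k + 1) = a₁ * (winSum W fm k + fm (W k)) + a₂ * (winSum W fb k + fb (W k)) := by
      simp only [V, w1, w2]
    refine (Runs.seq_rset (Runs.seq_rset (Runs.seq_rset (Runs.ite (fun hb => Runs.rset ?_)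
      (fun hb => Runs.skip ?_))))).le (by simp)
    · simp [hi, cW, c0, c1, r10, r11, g1, g2, n5.symm, n6.symm, n7.symm, n8.symm, ← hV] at hb ⊢
      refine ⟨w1.symm, w2.symm, fun i hi' => ?_, k + 1, le_rfl, rfl⟩
      rcases Nat.le_succ_iff.1 hi' with hi' | rfl
      · exact (g4 i hi').trans hb.le
      · exact le_rfl
    · simp [hi, cW, c0, c1, r10, r11, g1, g2, n5.symm, n6.symm, n7.symm, n8.symm, ← hV] at hb ⊢
      refine ⟨w1.symm, w2.symm, fun i hi' => ?_, i0, hi0.trans (Nat.le_succ _), g5⟩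
      rcases Nat.le_succ_iff.1 hi' with hi' | rfl
      · exact g4 i hi'
      · exact hb
  all_goals try
    obtain ⟨g1, g2, g3, g4, i0, hi0, g5⟩ := h₁
    have cP : s₁.rarr (bs σ + 3) 1 = s.rarr (bs σ + 3) 1 := by
      rw [hs₁.ra (bs σ + 3) (by cases σ <;> rfl)]; rfl
    simp [g1, g2, g3, cP] at hb ⊢
    have hbey := hI.exists_reach_beyond hn hp2
    have hcases : ∀ r < I.n, _ := fun r hr => hI.reach_cases (fun j hj => hp1 j (hj.trans hnZ)) hr
  · refine ⟨fun r hr => ?_, ?_, ?_, hcases⟩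
    · rcases hcases r hr with ⟨i, hi, e1, e2⟩ | ⟨-, -, e3⟩
      · rw [e1, e2]; exact (g4 i hi).trans hb.le
      · exact e3
    · obtain ⟨r, hr, -, -, e⟩ := hbey
      exact ⟨r, hr, e.symm⟩
    · obtain ⟨r, hr, e1, e2, e⟩ := hbey
      exact ⟨r, hr, e1, e2, e.symm⟩
  · refine ⟨fun r hr => ?_, ?_, ?_, hcases⟩
    · rcases hcases r hr with ⟨i, hi, e1, e2⟩ | ⟨-, -, e3⟩
      · rw [e1, e2]; exact g4 i hi
      · exact e3.trans hb
    · obtain ⟨r, hr, e1, e2⟩ := hI.exists_reach hn hi0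
      exact ⟨r, hr, by rw [g5, e1, e2]⟩
    · obtain ⟨r, hr, e1, e2, e⟩ := hbey
      exact ⟨r, hr, e1, e2, e.symm⟩
  · simp
    ring_nf
    omega

end ScanStat

/-! ## Boxes described by ranks relative to a bottom point -/

namespace ScanStat

open RealRAM Finset

/-- The instance is sorted by ordinate, its weights are at least `δ` and sum to one, and `xr` ranks
the abscissas. -/
structure Good (I : Inst) (k0 : ℕ) (δ : ℝ) (xr : ℕ → ℕ) : Prop where
  pos : 0 < I.n
  mono : ∀ i j, i ≤ j → j < I.n → I.Y i ≤ I.Y j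
  δ_pos : 0 < δ
  mu_ge : ∀ i < I.n, δ ≤ I.mu i
  be_ge : ∀ i < I.n, δ ≤ I.be i
  mu_sum : ∑ i ∈ range I.n, I.mu i = 1
  be_sum : ∑ i ∈ range I.n, I.be i = 1
  thr_pos : 0 < I.thr
  thr_le : I.thr ≤ k0 * δ
  xr_lt : ∀ i < I.n, xr i < I.n
  xr_le : ∀ i < I.n, ∀ j < I.n, I.X i ≤ I.X j ↔ xr i ≤ xr j

namespace Inst

variable (I : Inst) (xr : ℕ → ℕ)

/-- Weight of the inserted points at rank distance `x` to the right of `p`. -/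
noncomputable def sR (f : ℕ → ℝ) (p k x : ℕ) : ℝ :=
  ∑ i ∈ range k, if I.Y p ≤ I.Y i ∧ 0 < x ∧ xr i = xr p + x then f i else 0

/-- Weight of the inserted points at rank distance `x` to the left of `p`. -/
noncomputable def sL (f : ℕ → ℝ) (p k x : ℕ) : ℝ :=
  ∑ i ∈ range k, if I.Y p ≤ I.Y i ∧ 0 < x ∧ xr i + x = xr p then f i else 0

/-- Weight of the inserted points with the abscissa of `p`. -/
noncomputable def sC (f : ℕ → ℝ) (p k : ℕ) : ℝ :=
  ∑ i ∈ range k, if I.Y p ≤ I.Y i ∧ xr i = xr p then f i else 0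

/-- Weight of the inserted points. -/
noncomputable def sT (f : ℕ → ℝ) (p k : ℕ) : ℝ :=
  ∑ i ∈ range k, if I.Y p ≤ I.Y i then f i else 0

/-- Weight of the points of the strip from `p` to `k` with ranks from `xr p - l` to `xr p + r`. -/
noncomputable def rankBox (f : ℕ → ℝ) (p k l r : ℕ) : ℝ :=
  ∑ i ∈ range I.n,
    if (I.Y p ≤ I.Y i ∧ I.Y i ≤ I.Y k) ∧ xr p ≤ xr i + l ∧ xr i ≤ xr p + r then f i else 0

/-- Weight of the strip from `p` to `k`. -/
noncomputable def strip (f : ℕ → ℝ) (p k : ℕ) : ℝ :=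
  ∑ i ∈ range I.n, if I.Y p ≤ I.Y i ∧ I.Y i ≤ I.Y k then f i else 0

/-- The point `k` is the last one with its ordinate. -/
def Last (k : ℕ) : Prop := k + 1 = I.n ∨ k + 1 < I.n ∧ I.Y k < I.Y (k + 1)

variable {I xr}

theorem Last.lt {k : ℕ} (h : I.Last k) : k < I.n := by rcases h with h | h <;> omega

/-- Because of the sorting, cutting at the last index of an ordinate turns a condition on ordinates
into an index range. For this reason strips are evaluated only at such indices. -/
theorem le_Y_iff {k0 : ℕ} {δ : ℝ} (hG : Good I k0 δ xr) {k i : ℕ} (hk : I.Last k) (hi : i < I.n) :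
    I.Y i ≤ I.Y k ↔ i < k + 1 := by
  constructor
  · intro h
    by_contra hik
    rcases hk with hk | ⟨hk, hlt⟩
    · omega
    · exact absurd (hG.mono (k + 1) i (by omega) hi) (not_le.2 (h.trans_lt hlt))
  · intro h
    exact hG.mono i k (by omega) hk.lt

theorem sum_range_eq {k0 : ℕ} {δ : ℝ} (hG : Good I k0 δ xr) {k : ℕ} (hk : I.Last k) (g : ℕ → ℝ) :
    ∑ i ∈ range (k + 1), g i = ∑ i ∈ range I.n, if I.Y i ≤ I.Y k then g i else 0 := by
  rw [← Finset.sum_filter]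
  refine Finset.sum_congr ?_ fun _ _ => rfl
  ext i
  simp only [mem_range, mem_filter]
  have := hk.lt
  constructor
  · intro h; exact ⟨by omega, (le_Y_iff hG hk (by omega)).2 h⟩
  · rintro ⟨h, h'⟩; exact (le_Y_iff hG hk h).1 h'

theorem sT_eq {k0 : ℕ} {δ : ℝ} (hG : Good I k0 δ xr) {k : ℕ} (hk : I.Last k) (f : ℕ → ℝ) (p : ℕ) :
    I.sT f p (k + 1) = I.strip f p k := by
  rw [sT, strip, sum_range_eq hG hk]
  refine Finset.sum_congr rfl fun i _ => ?_
  by_cases h1 : I.Y i ≤ I.Y k <;> simp [h1]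

/-- Exchange of summation: a point `i` contributes under exactly one key `x ≤ r` if `d i` holds, and
under none otherwise. -/
theorem reach_sum (c : ℕ → ℕ → Prop) [∀ i x, Decidable (c i x)] (f : ℕ → ℝ) (k r : ℕ)
    (d : ℕ → Prop) [DecidablePred d]
    (h : ∀ i < k, (d i → ∃ x ≤ r, c i x) ∧ ∀ x ≤ r, c i x → d i ∧ ∀ y ≤ r, c i y → y = x) :
    reach (fun x => ∑ i ∈ range k, if c i x then f i else 0) r =
      ∑ i ∈ range k, if d i then f i else 0 := by
  rw [reach, Finset.sum_comm]
  refine Finset.sum_congr rfl fun i hi => ?_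
  obtain ⟨h1, h2⟩ := h i (mem_range.1 hi)
  by_cases hd : d i
  · obtain ⟨x, hx, hc⟩ := h1 hd
    rw [if_pos hd, Finset.sum_eq_single x]
    · simp [hc]
    · intro y hy hyx
      rw [if_neg fun hc' => hyx ((h2 x hx hc).2 y (Nat.lt_succ_iff.1 (mem_range.1 hy)) hc')]
    · intro hn
      exact absurd (mem_range.2 (Nat.lt_succ_iff.2 hx)) hn
  · rw [if_neg hd]
    refine Finset.sum_eq_zero fun x hx => if_neg fun hc => hd ?_
    exact (h2 x (Nat.lt_succ_iff.1 (mem_range.1 hx)) hc).1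

/-- Trichotomy of the rank of a point against the rank of `p`. The two reaches appear in separate
summands, so for a linear function each side can be maximised independently of the other. -/
theorem sides_eq_rankBox {k0 : ℕ} {δ : ℝ} (hG : Good I k0 δ xr) {k : ℕ} (hk : I.Last k)
    (f : ℕ → ℝ) (p l r : ℕ) :
    I.sC xr f p (k + 1) + reach (I.sL xr f p (k + 1)) l + reach (I.sR xr f p (k + 1)) r =
      I.rankBox xr f p k l r := by
  have hR : reach (I.sR xr f p (k + 1)) r = ∑ i ∈ range (k + 1),
      if I.Y p ≤ I.Y i ∧ xr p < xr i ∧ xr i ≤ xr p + r then f i else 0 := by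
    refine reach_sum (fun i x => I.Y p ≤ I.Y i ∧ 0 < x ∧ xr i = xr p + x) f (k + 1) r _
      fun i _ => ⟨?_, ?_⟩
    · rintro ⟨h1, h2, h3⟩
      exact ⟨xr i - xr p, by omega, h1, by omega, by omega⟩
    · rintro x hx ⟨h1, h2, h3⟩
      exact ⟨⟨h1, by omega, by omega⟩, fun y _ ⟨_, _, h⟩ => by omega⟩
  have hL : reach (I.sL xr f p (k + 1)) l = ∑ i ∈ range (k + 1),
      if I.Y p ≤ I.Y i ∧ xr i < xr p ∧ xr p ≤ xr i + l then f i else 0 := by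
    refine reach_sum (fun i x => I.Y p ≤ I.Y i ∧ 0 < x ∧ xr i + x = xr p) f (k + 1) l _
      fun i _ => ⟨?_, ?_⟩
    · rintro ⟨h1, h2, h3⟩
      exact ⟨xr p - xr i, by omega, h1, by omega, by omega⟩
    · rintro x hx ⟨h1, h2, h3⟩
      exact ⟨⟨h1, by omega, by omega⟩, fun y _ ⟨_, _, h⟩ => by omega⟩
  rw [hR, hL, sC, ← Finset.sum_add_distrib, ← Finset.sum_add_distrib, sum_range_eq hG hk, rankBox]
  refine Finset.sum_congr rfl fun i _ => ?_
  by_cases h1 : I.Y i ≤ I.Y k <;> by_cases h2 : I.Y p ≤ I.Y i <;> simp only [h1, h2, true_and,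
    false_and, and_false, and_true, if_true, if_false, add_zero]
  rcases lt_trichotomy (xr i) (xr p) with h | h | h
  · have e1 : ¬ xr i = xr p := h.ne
    have e2 : ¬ xr p < xr i := h.asymm
    have e3 : xr i ≤ xr p + r := by omega
    simp [e1, e2, e3, h]
  · simp [h]
  · have e1 : ¬ xr i = xr p := h.ne'
    have e2 : ¬ xr i < xr p := h.asymm
    have e3 : xr p ≤ xr i + l := by omega
    simp [e1, e2, e3, h]

/-- A rank box is the bounding box of some of its points. -/
theorem exists_box_eq_rankBox {k0 : ℕ} {δ : ℝ} (hG : Good I k0 δ xr) {p k l r : ℕ} (hp : p < I.n)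
    (hpk : I.Y p ≤ I.Y k) :
    ∃ a < I.n, ∃ b < I.n, I.X a ≤ I.X b ∧ ∀ f, I.rankBox xr f p k l r = I.box f a b p k := by
  classical
  -- The set contains `p`, so it has a leftmost and a rightmost point; these two points give the
  -- vertical sides.
  let A : Finset ℕ := {i ∈ range I.n |
    (I.Y p ≤ I.Y i ∧ I.Y i ≤ I.Y k) ∧ xr p ≤ xr i + l ∧ xr i ≤ xr p + r}
  have hpA : p ∈ A := by
    simp only [A, mem_filter, mem_range]
    exact ⟨hp, ⟨le_rfl, hpk⟩, by omega, by omega⟩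
  obtain ⟨a, ha, ha'⟩ := A.exists_min_image I.X ⟨p, hpA⟩
  obtain ⟨b, hb, hb'⟩ := A.exists_max_image I.X ⟨p, hpA⟩
  have ha2 := ha
  have hb2 := hb
  simp only [A, mem_filter, mem_range] at ha2 hb2
  refine ⟨a, ha2.1, b, hb2.1, (ha' p hpA).trans (hb' p hpA), fun f => ?_⟩
  refine Finset.sum_congr rfl fun i hi => ?_
  have hin := mem_range.1 hi
  refine if_congr ⟨fun h => ⟨h.1, ?_, ?_⟩, fun h => ⟨h.1, ?_, ?_⟩⟩ rfl rfl
  · exact ha' i (by simp only [A, mem_filter]; exact ⟨hi, h⟩)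
  · exact hb' i (by simp only [A, mem_filter]; exact ⟨hi, h⟩)
  · have := (hG.xr_le a ha2.1 i hin).1 h.2.1
    omega
  · have := (hG.xr_le i hin b hb2.1).1 h.2.2
    omega

/-- Every box with a point is a rank box. -/
theorem exists_rankBox_eq_box {k0 : ℕ} {δ : ℝ} (hG : Good I k0 δ xr) {l r b t : ℕ} {i₀ : ℕ}
    (hi₀ : i₀ < I.n)
    (h₀ : (I.Y b ≤ I.Y i₀ ∧ I.Y i₀ ≤ I.Y t) ∧ I.X l ≤ I.X i₀ ∧ I.X i₀ ≤ I.X r) :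
    ∃ p < I.n, ∃ k, I.Last k ∧ I.Y p ≤ I.Y k ∧ ∃ u < I.n, ∃ v < I.n,
      ∀ f, I.box f l r b t = I.rankBox xr f p k u v := by
  classical
  let A : Finset ℕ := {i ∈ range I.n |
    (I.Y b ≤ I.Y i ∧ I.Y i ≤ I.Y t) ∧ I.X l ≤ I.X i ∧ I.X i ≤ I.X r}
  have hmA : ∀ i, i ∈ A ↔ i < I.n ∧
      (I.Y b ≤ I.Y i ∧ I.Y i ≤ I.Y t) ∧ I.X l ≤ I.X i ∧ I.X i ≤ I.X r := fun i => by
    simp [A]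
  have hne : A.Nonempty := ⟨i₀, (hmA i₀).2 ⟨hi₀, h₀⟩⟩
  obtain ⟨p, hpA, hp⟩ := A.exists_min_image I.Y hne
  obtain ⟨q, hqA, hq⟩ := A.exists_max_image I.Y hne
  obtain ⟨c, hcA, hc⟩ := A.exists_min_image xr hne
  obtain ⟨d, hdA, hd⟩ := A.exists_max_image xr hne
  let B : Finset ℕ := {i ∈ range I.n | I.Y i ≤ I.Y q}
  have hqn := ((hmA q).1 hqA).1
  -- `q` is a highest point of the box. It is replaced by the last index `k` with the same ordinate,
  -- so that the strip ends at a position where it is evaluated.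
  obtain ⟨k, hkB, hk⟩ := B.exists_max_image id ⟨q, by simp [B, hqn]⟩
  have hkB' : k < I.n ∧ I.Y k ≤ I.Y q := by simpa [B] using hkB
  have hqk : q ≤ k := hk q (by simp [B, hqn])
  have hYk : I.Y k = I.Y q := le_antisymm hkB'.2 (hG.mono q k hqk hkB'.1)
  have hlast : I.Last k := by
    rcases (Nat.succ_le_of_lt hkB'.1).lt_or_eq with h | h
    · refine Or.inr ⟨h, ?_⟩
      by_contra hle
      have := hk (k + 1) (by simp only [B, mem_filter, mem_range]; exact ⟨h, by rw [← hYk]; exact not_lt.1 hle⟩)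
      simp at this
    · exact Or.inl h
  have hpn := ((hmA p).1 hpA).1
  have hcn := hG.xr_lt c ((hmA c).1 hcA).1
  have hdn := hG.xr_lt d ((hmA d).1 hdA).1
  have hxp := hG.xr_lt p hpn
  -- The reaches are the rank distances from the lowest point `p` to the leftmost point `c` and to
  -- the rightmost point `d` of the box.
  refine ⟨p, hpn, k, hlast, by rw [hYk]; exact hp q hqA, xr p - xr c, by omega, xr d - xr p,
    by omega, fun f => ?_⟩
  have hcp := hc p hpA
  have hpd := hd p hpA
  refine Finset.sum_congr rfl fun i hi => ?_
  have hin := mem_range.1 hi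
  refine if_congr ⟨fun h => ?_, fun h => ?_⟩ rfl rfl
  · have hiA := (hmA i).2 ⟨hin, h⟩
    have h1 := hc i hiA
    have h2 := hd i hiA
    exact ⟨⟨hp i hiA, by rw [hYk]; exact hq i hiA⟩, by omega, by omega⟩
  · have hpA' := (hmA p).1 hpA
    have hqA' := (hmA q).1 hqA
    have hcA' := (hmA c).1 hcA
    have hdA' := (hmA d).1 hdA
    refine ⟨⟨hpA'.2.1.1.trans h.1.1, (h.1.2.trans hYk.le).trans hqA'.2.1.2⟩, ?_, ?_⟩
    · exact hcA'.2.2.1.trans ((hG.xr_le c hcA'.1 i hin).2 (by omega))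
    · exact ((hG.xr_le i hin d hdA'.1).2 (by omega)).trans hdA'.2.2.2

theorem rankBox_le_strip {p k l r : ℕ} {f : ℕ → ℝ} (hf : ∀ i < I.n, 0 ≤ f i) :
    I.rankBox xr f p k l r ≤ I.strip f p k := by
  refine Finset.sum_le_sum fun i hi => ?_
  have := hf i (mem_range.1 hi)
  split_ifs with h1 h2 h2
  · exact le_rfl
  · exact absurd h1.1 h2
  · exact this
  · exact le_rfl

/-- A strip that misses less than the threshold is bounded by one of the `k0` lowest and one of
the `k0` highest points. -/
theorem exists_extreme_strip {k0 : ℕ} {δ : ℝ} (hG : Good I k0 δ xr) {p k : ℕ} (hp : p < I.n)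
    (hk : I.Last k) {f : ℕ → ℝ} (hf : ∀ i < I.n, δ ≤ f i)
    (hf1 : ∑ i ∈ range I.n, f i = 1) (hs : 1 - I.thr < I.strip f p k) :
    ∃ c < k0, ∃ e < k0, c < I.n ∧ e < I.n ∧ I.Y c = I.Y p ∧ I.n - 1 - e = k := by
  classical
  have hkn := hk.lt
  let O : Finset ℕ := {i ∈ range I.n | ¬ (I.Y p ≤ I.Y i ∧ I.Y i ≤ I.Y k)}
  -- The points outside the strip weigh less than the threshold, which is at most `k0 * δ`, while
  -- each of them weighs at least `δ`.
  have hO : O.card < k0 := by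
    have h1 : (O.card : ℝ) * δ ≤ ∑ i ∈ O, f i := by
      have := Finset.card_nsmul_le_sum O f δ fun i hi => hf i (by
        simp only [O, mem_filter, mem_range] at hi; exact hi.1)
      simpa using this
    have h2 : I.strip f p k + ∑ i ∈ O, f i = 1 := by
      rw [strip, ← Finset.sum_filter, Finset.sum_filter_add_sum_filter_not, hf1]
    have h3 : (O.card : ℝ) * δ < k0 * δ := by linarith [hG.thr_le]
    exact_mod_cast lt_of_mul_lt_mul_right h3 hG.δ_pos.le
  let E : Finset ℕ := {i ∈ range I.n | I.Y p ≤ I.Y i}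
  -- `c` is the first index with the ordinate of `p`. All indices before `c` and all indices after
  -- `k` are outside the strip, so there are fewer than `k0` of either kind.
  obtain ⟨c, hcE, hc⟩ := E.exists_min_image id ⟨p, by simp [E, hp]⟩
  have hcE' : c < I.n ∧ I.Y p ≤ I.Y c := by simpa [E] using hcE
  have hcp : c ≤ p := hc p (by simp [E, hp])
  have hYc : I.Y c = I.Y p := le_antisymm (hG.mono c p hcp hp) hcE'.2
  have h1 : range c ⊆ O := by
    intro i hi
    have hic := mem_range.1 hi
    simp only [O, mem_filter, mem_range]
    refine ⟨by omega, fun h => ?_⟩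
    have := hc i (by simp only [E, mem_filter, mem_range]; exact ⟨by omega, h.1⟩)
    simp only [id] at this
    omega
  have h2 : Finset.Ico (k + 1) I.n ⊆ O := by
    intro i hi
    rw [Finset.mem_Ico] at hi
    simp only [O, mem_filter, mem_range]
    refine ⟨hi.2, fun h => ?_⟩
    have := (le_Y_iff hG hk hi.2).1 h.2
    omega
  have c1 := Finset.card_le_card h1
  have c2 := Finset.card_le_card h2
  simp only [card_range, Nat.card_Ico] at c1 c2
  exact ⟨c, by omega, I.n - 1 - k, by omega, hcE'.1, by omega, hYc, by omega⟩

theorem sR_succ_of_eq {f : ℕ → ℝ} {p k x : ℕ} (hY : I.Y p ≤ I.Y k) (hx : 0 < x)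
    (h : xr k = xr p + x) :
    I.sR xr f p (k + 1) = Function.update (I.sR xr f p k) x (I.sR xr f p k x + f k) := by
  funext y
  rcases eq_or_ne y x with rfl | hy
  · rw [Function.update_self, sR, Finset.sum_range_succ, if_pos ⟨hY, hx, h⟩]; rfl
  · rw [Function.update_of_ne hy, sR, Finset.sum_range_succ, if_neg (by omega), add_zero]; rfl

theorem sL_succ_of_eq {f : ℕ → ℝ} {p k x : ℕ} (hY : I.Y p ≤ I.Y k) (hx : 0 < x)
    (h : xr k + x = xr p) :
    I.sL xr f p (k + 1) = Function.update (I.sL xr f p k) x (I.sL xr f p k x + f k) := by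
  funext y
  rcases eq_or_ne y x with rfl | hy
  · rw [Function.update_self, sL, Finset.sum_range_succ, if_pos ⟨hY, hx, h⟩]; rfl
  · rw [Function.update_of_ne hy, sL, Finset.sum_range_succ, if_neg (by omega), add_zero]; rfl

theorem sR_succ_of_not {f : ℕ → ℝ} {p k : ℕ} (h : ¬ (I.Y p ≤ I.Y k ∧ xr p < xr k)) :
    I.sR xr f p (k + 1) = I.sR xr f p k := by
  funext y
  rw [sR, Finset.sum_range_succ, if_neg (fun h' => h ⟨h'.1, by omega⟩), add_zero]; rfl

theorem sL_succ_of_not {f : ℕ → ℝ} {p k : ℕ} (h : ¬ (I.Y p ≤ I.Y k ∧ xr k < xr p)) :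
    I.sL xr f p (k + 1) = I.sL xr f p k := by
  funext y
  rw [sL, Finset.sum_range_succ, if_neg (fun h' => h ⟨h'.1, by omega⟩), add_zero]; rfl

theorem sC_succ {f : ℕ → ℝ} {p k : ℕ} : I.sC xr f p (k + 1) =
    I.sC xr f p k + if I.Y p ≤ I.Y k ∧ xr k = xr p then f k else 0 := Finset.sum_range_succ _ _

theorem sT_succ {f : ℕ → ℝ} {p k : ℕ} : I.sT f p (k + 1) =
    I.sT f p k + if I.Y p ≤ I.Y k then f k else 0 := Finset.sum_range_succ _ _

end Inst

end ScanStat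

/-! ## Evaluating a strip -/

namespace ScanStat

open RealRAM Finset

/-- Record the candidate in register 29 if it is better. -/
def upd : Cmd :=
  .ite (.rlt (.reg 13) (.reg 29))
    (.rset 13 (.reg 29) ;; .iset 4 (.reg 10) ;; .iset 5 (.reg 11)) .skip

/-- From `s` to `s'` the best value was only replaced by larger values with the property `A`,
together with the strip `(p, k)`. -/
structure Better (p k : ℕ) (A : ℝ → Prop) (s s' : State) : Prop where
  mono : s.rreg 13 ≤ s'.rreg 13
  sound : (s'.rreg 13 = s.rreg 13 ∧ s'.ireg 4 = s.ireg 4 ∧ s'.ireg 5 = s.ireg 5) ∨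
    (A (s'.rreg 13) ∧ s'.ireg 4 = p ∧ s'.ireg 5 = k)

theorem Better.refl_of {p k : ℕ} {A : ℝ → Prop} {s s' : State} (h1 : s'.rreg 13 = s.rreg 13)
    (h2 : s'.ireg 4 = s.ireg 4) (h3 : s'.ireg 5 = s.ireg 5) : Better p k A s s' :=
  ⟨h1.ge, Or.inl ⟨h1, h2, h3⟩⟩

theorem Better.trans {p k : ℕ} {A : ℝ → Prop} {s s' s'' : State} (h : Better p k A s s')
    (h' : Better p k A s' s'') : Better p k A s s'' := by
  refine ⟨h.mono.trans h'.mono, ?_⟩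
  rcases h'.sound with ⟨e1, e2, e3⟩ | h''
  · rw [e1, e2, e3]; exact h.sound
  · exact Or.inr h''

theorem upd_spec {p k : ℕ} {A : ℝ → Prop} {s : State} (hp : s.ireg 10 = p) (hk : s.ireg 11 = k)
    (hA : A (s.rreg 29)) :
    Runs upd s 15 fun s' => Better p k A s s' ∧ s.rreg 29 ≤ s'.rreg 13 := by
  unfold upd
  refine Runs.le (Runs.ite (fun hb => Runs.seq_rset (Runs.seq_iset (Runs.iset ?_)))
    (fun hb => Runs.skip ?_)) (by simp)
  · simp at hb
    exact ⟨⟨by simpa using hb.le, Or.inr (by simpa [hp, hk] using hA)⟩, by simp⟩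
  · simp at hb
    exact ⟨Better.refl_of rfl rfl rfl, hb⟩

/-- Try all combinations of window prefixes. -/
def smallC (k0 : ℕ) : Cmd :=
  .rset 36 (.ofNat (.const 0)) ;; .rset 37 (.ofNat (.const 0)) ;;
  forC 19 (.const (k0 + 1))
    (.rset 38 (.ofNat (.const 0)) ;; .rset 39 (.ofNat (.const 0)) ;;
    forC 20 (.const (k0 + 1))
      (.rset 26 (.add (.add (.reg 30) (.reg 36)) (.reg 38)) ;;
      .rset 27 (.add (.add (.reg 31) (.reg 37)) (.reg 39)) ;;
      .ite (.and (.not (.rlt (.reg 26) (.reg 8))) (.not (.rlt (.reg 27) (.reg 8))))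
        (.rset 29 (.add (.reg 12) (.add (.mul (.reg 10) (.reg 26)) (.mul (.reg 11) (.reg 27)))) ;;
          upd) .skip ;;
      .rset 38 (.add (.reg 38) (.load (bs false) (.load (bs false) (.reg 20)))) ;;
      .rset 39 (.add (.reg 39) (.load (bs false + 1) (.load (bs false) (.reg 20))))) ;;
    .rset 36 (.add (.reg 36) (.load (bs true) (.load (bs true) (.reg 19)))) ;;
    .rset 37 (.add (.reg 37) (.load (bs true + 1) (.load (bs true) (.reg 19)))))

/-- Try the best combinations that extend beyond a window. -/
def largeC (k0 : ℕ) : Cmd :=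
  sideBest k0 false ;; sideBest k0 true ;;
  .rset 45 (.add (.reg 12) (.add (.mul (.reg 10) (.reg 30)) (.mul (.reg 11) (.reg 31)))) ;;
  .ite (.and (.not (.rlt (.reg 42) (.reg 8))) (.not (.rlt (.reg 43) (.reg 8))))
    (.rset 29 (.add (.reg 45) (.add (.reg 50) (.reg 41))) ;; upd) .skip ;;
  .ite (.and (.not (.rlt (.reg 52) (.reg 8))) (.not (.rlt (.reg 53) (.reg 8))))
    (.rset 29 (.add (.reg 45) (.add (.reg 40) (.reg 51))) ;; upd) .skip

/-- Improve the best value by the boxes with bottom point `p` in the current strip. -/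
def evalC (k0 : ℕ) : Cmd := largeC k0 ;; smallC k0

section eval

variable (n : ℕ) (thr a₁ a₂ a₃ cm cb : ℝ) (Rm Rb Lm Lb : ℕ → ℝ)

/-- `v` is the value of a box that reaches over `l` and `r` ranks to the left and right. -/
def Cand (v : ℝ) : Prop :=
  ∃ l < n, ∃ r < n, thr ≤ cm + reach Lm l + reach Rm r ∧ thr ≤ cb + reach Lb l + reach Rb r ∧
    v = a₃ + (a₁ * (cm + reach Lm l + reach Rm r) + a₂ * (cb + reach Lb l + reach Rb r))

variable {n thr a₁ a₂ a₃ cm cb Rm Rb Lm Lb}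
variable {I : Inst} {h k0 p k : ℕ} {xr : ℕ → ℕ} {δ : ℝ} {s : State}

/-- If one side reaches beyond its full window, the weights of this window already meet the
threshold, and the other side may take its overall best value. Conversely, the program tests the
window weights before it uses such a sum, so only boxes with sufficient support are recorded. -/
theorem largeC_spec (hA : Aux I h xr a₁ a₂ a₃ s) (hn : 0 < I.n) (hnZ : I.n ≤ 2 ^ h)
    (hR : SideSt I.n h k0 δ a₁ a₂ false Rm Rb s) (hL : SideSt I.n h k0 δ a₁ a₂ true Lm Lb s)
    (hp : s.ireg 10 = p) (hk : s.ireg 11 = k) (hcm : s.rreg 30 = cm) (hcb : s.rreg 31 = cb)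
    (hcm0 : 0 ≤ cm) (hcb0 : 0 ≤ cb) (hthr : I.thr ≤ k0 * δ) :
    Runs (largeC k0) s (120 * k0 + 250) fun s' =>
      Better p k (Cand I.n I.thr a₁ a₂ a₃ cm cb Rm Rb Lm Lb) s s' ∧
      ∀ l < I.n, ∀ r < I.n,
        ((∃ i ≤ k0, reach Lm l = winSum (s.iarr (bs true)) Lm i ∧
            reach Lb l = winSum (s.iarr (bs true)) Lb i) ∧
          ∃ j ≤ k0, reach Rm r = winSum (s.iarr (bs false)) Rm j ∧
            reach Rb r = winSum (s.iarr (bs false)) Rb j) ∨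
        a₃ + (a₁ * (cm + reach Lm l + reach Rm r) + a₂ * (cb + reach Lb l + reach Rb r)) ≤
          s'.rreg 13 := by
  obtain ⟨gR, -, hIR⟩ := hR.inv
  obtain ⟨gL, -, hIL⟩ := hL.inv
  have hn0 : ∀ {W : ℕ → ℕ} {fm fb g : ℕ → ℝ}, SideInv I.n k0 δ a₁ a₂ W fm fb g → ∀ r,
      0 ≤ reach fm r ∧ 0 ≤ reach fb r := fun hI r =>
    ⟨Finset.sum_nonneg fun x _ => (hI.nonneg x).1, Finset.sum_nonneg fun x _ => (hI.nonneg x).2⟩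
  unfold largeC
  set A := Cand I.n I.thr a₁ a₂ a₃ cm cb Rm Rb Lm Lb with hAdef
  refine Runs.le (Runs.seq (sideBest_spec hA hn hnZ hR) (fun s₁ hs₁ o₁ => Runs.seq
    (sideBest_spec (hA.of_same hs₁ rfl rfl) hn hnZ (hL.of_same hs₁ rfl)) (fun s₂ hs₂ o₂ =>
    Runs.seq_rset (Runs.seq (R := fun s' => Better p k A s s' ∧ (I.thr ≤ s₂.rreg 42 →
      I.thr ≤ s₂.rreg 43 → a₃ + (a₁ * cm + a₂ * cb) + (s₂.rreg 50 + s₂.rreg 41) ≤ s'.rreg 13))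
      (Runs.ite (T₁ := 21) (fun hb => Runs.seq_rset
        ((upd_spec (p := p) (k := k) (A := A) ?_ ?_ ?_).conseq le_rfl ?_)) (fun hb => Runs.skip ?_))
      (fun s₃ hs₃ h₃ => Runs.ite (T₁ := 21) (fun hb => Runs.seq_rset
        ((upd_spec (p := p) (k := k) (A := A) ?_ ?_ ?_).conseq le_rfl ?_))
        (fun hb => Runs.skip ?_)))))) ?_
  all_goals try
    have hA2 := (hA.of_same hs₁ rfl rfl).of_same hs₂ rfl rfl
    have p2 : s₂.ireg 10 = p := by rw [hs₂.i 10 rfl, hs₁.i 10 rfl, hp]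
    have k2 : s₂.ireg 11 = k := by rw [hs₂.i 11 rfl, hs₁.i 11 rfl, hk]
    have cm2 : s₂.rreg 30 = cm := by rw [hs₂.r 30 rfl, hs₁.r 30 rfl, hcm]
    have cb2 : s₂.rreg 31 = cb := by rw [hs₂.r 31 rfl, hs₁.r 31 rfl, hcb]
    have l2 : s₂.rreg 13 = s.rreg 13 := by rw [hs₂.r 13 rfl, hs₁.r 13 rfl]
    have i4 : s₂.ireg 4 = s.ireg 4 := by rw [hs₂.i 4 rfl, hs₁.i 4 rfl]
    have i5 : s₂.ireg 5 = s.ireg 5 := by rw [hs₂.i 5 rfl, hs₁.i 5 rfl]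
    have W1 : s₁.iarr (bs true) = s.iarr (bs true) := hs₁.ia _ rfl
    have o1 : SideOut I.n k0 δ a₁ a₂ (s.iarr (bs false)) Rm Rb (s₂.rreg 40) (s₂.rreg 41)
        (s₂.rreg 42) (s₂.rreg 43) := by
      rw [hs₂.r 40 rfl, hs₂.r 41 rfl, hs₂.r 42 rfl, hs₂.r 43 rfl]; exact o₁
    have o2 : SideOut I.n k0 δ a₁ a₂ (s.iarr (bs true)) Lm Lb (s₂.rreg 50) (s₂.rreg 51)
        (s₂.rreg 52) (s₂.rreg 53) := by
      rw [← W1]; exact o₂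
    clear o₁ o₂
  · simpa using p2
  · simpa using k2
  · simp [hA2.env.thr, hA2.a₁, hA2.a₂, hA2.a₃, cm2, cb2] at hb ⊢
    obtain ⟨l, hl, e1⟩ := o2.attained
    obtain ⟨r, hr, e2, e3, e4⟩ := o1.beyond
    have := hn0 hIL l
    refine ⟨l, hl, r, hr, by linarith [hb.1], by linarith [hb.2], ?_⟩
    rw [e1, e4]; ring
  · rintro s₃ - ⟨b1, b2⟩
    refine ⟨⟨?_, ?_⟩, fun _ _ => ?_⟩
    · simpa [l2] using b1.mono
    · simpa [l2, i4, i5] using b1.sound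
    · simpa [hA2.a₁, hA2.a₂, hA2.a₃, cm2, cb2] using b2
  · simp [hA2.env.thr] at hb
    refine ⟨Better.refl_of (by simpa using l2) i4 i5, fun e1 e2 => absurd e2 (not_le.2 (hb e1))⟩
  all_goals try
    have r3 : ∀ r, r ≠ 13 → r ≠ 29 → s₃.rreg r = (s₂.setR 45
      (a₃ + (a₁ * cm + a₂ * cb))).rreg r := by
      intro r h1 h2
      rw [hs₃.r r (by simp [Cmd.wR, upd, h1, h2])]
      simp [hA2.a₁, hA2.a₂, hA2.a₃, cm2, cb2]
    have p3 : s₃.ireg 10 = p := by rw [hs₃.i 10 rfl]; exact p2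
    have k3 : s₃.ireg 11 = k := by rw [hs₃.i 11 rfl]; exact k2
    have key : ∀ v, s₃.rreg 13 ≤ v → (I.thr ≤ s₂.rreg 52 → I.thr ≤ s₂.rreg 53 →
        a₃ + (a₁ * cm + a₂ * cb) + (s₂.rreg 40 + s₂.rreg 51) ≤ v) → ∀ l < I.n, ∀ r < I.n,
        ((∃ i ≤ k0, reach Lm l = winSum (s.iarr (bs true)) Lm i ∧
            reach Lb l = winSum (s.iarr (bs true)) Lb i) ∧
          ∃ j ≤ k0, reach Rm r = winSum (s.iarr (bs false)) Rm j ∧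
            reach Rb r = winSum (s.iarr (bs false)) Rb j) ∨
        a₃ + (a₁ * (cm + reach Lm l + reach Rm r) + a₂ * (cb + reach Lb l + reach Rb r)) ≤ v := by
      intro v hv hv2 l hl r hr
      rcases o2.cases l hl with hl' | ⟨f1, f2, f3⟩
      · rcases o1.cases r hr with hr' | ⟨f1, f2, f3⟩
        · exact Or.inl ⟨hl', hr'⟩
        · right
          have := h₃.2 (hthr.trans f1) (hthr.trans f2)
          have := o2.up l hl
          linarith
      · right
        have := hv2 (hthr.trans f1) (hthr.trans f2)
        have := o1.up r hr
        linarith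
  · simpa using p3
  · simpa using k3
  · simp [r3, hA2.env.thr] at hb ⊢
    obtain ⟨r, hr, e1⟩ := o1.attained
    obtain ⟨l, hl, e2, e3, e4⟩ := o2.beyond
    have := hn0 hIR r
    refine ⟨l, hl, r, hr, by linarith [hb.1], by linarith [hb.2], ?_⟩
    rw [e1, e4]; ring
  · rintro s₄ - ⟨b1, b2⟩
    refine ⟨h₃.1.trans ⟨by simpa using b1.mono, by simpa using b1.sound⟩,
      key _ (by simpa using b1.mono) fun _ _ => ?_⟩
    simpa [r3] using b2
  · simp [r3, hA2.env.thr] at hb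
    exact ⟨h₃.1, key _ le_rfl fun e1 e2 => absurd e2 (not_le.2 (hb e1))⟩
  · simp
    ring_nf
    omega

/-- Here the thresholds are tested for each pair of prefixes. The last pass of each loop adds an
entry from outside the window to the running sums; therefore the invariants describe these sums only
for indices up to `k0`. -/
theorem smallC_spec (hA : Aux I h xr a₁ a₂ a₃ s) (hn : 0 < I.n)
    (hR : SideSt I.n h k0 δ a₁ a₂ false Rm Rb s) (hL : SideSt I.n h k0 δ a₁ a₂ true Lm Lb s)
    (hp : s.ireg 10 = p) (hk : s.ireg 11 = k) (hcm : s.rreg 30 = cm) (hcb : s.rreg 31 = cb) :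
    Runs (smallC k0) s (100 * (k0 + 1) ^ 2 + 60 * (k0 + 1) + 20) fun s' =>
      Better p k (Cand I.n I.thr a₁ a₂ a₃ cm cb Rm Rb Lm Lb) s s' ∧
      ∀ i ≤ k0, ∀ j ≤ k0,
        I.thr ≤ cm + winSum (s.iarr (bs true)) Lm i + winSum (s.iarr (bs false)) Rm j →
        I.thr ≤ cb + winSum (s.iarr (bs true)) Lb i + winSum (s.iarr (bs false)) Rb j →
        a₃ + (a₁ * (cm + winSum (s.iarr (bs true)) Lm i + winSum (s.iarr (bs false)) Rm j) +
          a₂ * (cb + winSum (s.iarr (bs true)) Lb i + winSum (s.iarr (bs false)) Rb j)) ≤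
          s'.rreg 13 := by
  obtain ⟨gR, -, hIR⟩ := hR.inv
  obtain ⟨gL, -, hIL⟩ := hL.inv
  set A := Cand I.n I.thr a₁ a₂ a₃ cm cb Rm Rb Lm Lb with hAdef
  set WL := s.iarr (bs true) with hWL
  set WR := s.iarr (bs false) with hWR
  let Goal : ℕ → ℕ → ℝ → Prop := fun i j v =>
    I.thr ≤ cm + winSum WL Lm i + winSum WR Rm j → I.thr ≤ cb + winSum WL Lb i + winSum WR Rb j →
      a₃ + (a₁ * (cm + winSum WL Lm i + winSum WR Rm j) +
        a₂ * (cb + winSum WL Lb i + winSum WR Rb j)) ≤ v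
  have hsucc : ∀ {W : ℕ → ℕ} {fm fb g : ℕ → ℝ} {u w : ℕ → ℝ},
      SideInv I.n k0 δ a₁ a₂ W fm fb g → (∀ x ≤ I.n, u x = fm x) → (∀ x ≤ I.n, w x = fb x) →
      ∀ i, i + 1 ≤ k0 → winSum W fm i + u (W i) = winSum W fm (i + 1) ∧
        winSum W fb i + w (W i) = winSum W fb (i + 1) := by
    intro W fm fb g u w hI hu hw i hi
    rw [hu _ (hI.le i hi), hw _ (hI.le i hi), winSum, winSum, winSum, winSum,
      Finset.sum_range_succ, Finset.sum_range_succ]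
    exact ⟨rfl, rfl⟩
  unfold smallC
  refine Runs.le (Runs.seq_rset (Runs.seq_rset (Runs.forC (m := k0 + 1)
    (T := (k0 + 1) * 70 + 40) (fun i s' => (i ≤ k0 → s'.rreg 36 = winSum WL Lm i ∧
      s'.rreg 37 = winSum WL Lb i) ∧ Better p k A s s' ∧ ∀ i' < i, ∀ j ≤ k0, Goal i' j (s'.rreg 13))
    rfl (fun _ _ => rfl) ?_ (fun i s₁ hi hs₁ hi19 h₁ => ?_) (fun s₁ _ _ h₁ =>
      ⟨h₁.2.1, fun i hi j hj => h₁.2.2 i (Nat.lt_succ_of_le hi) j hj⟩)))) ?_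
  · exact ⟨fun _ => by simp [winSum], Better.refl_of (by simp) (by simp) (by simp), by simp⟩
  · have hA1 : Aux I h xr a₁ a₂ a₃ s₁ := by
      refine Aux.of_same (p := smallC k0) (s := s) hA ?_ rfl rfl
      refine ⟨fun r hr => ?_, fun r hr => ?_, fun r hr => ?_, fun r hr => ?_⟩
      · exact hs₁.i r hr
      · have h36 : r ≠ 36 := by rintro rfl; simp [smallC, Cmd.wR] at hr
        have h37 : r ≠ 37 := by rintro rfl; simp [smallC, Cmd.wR] at hr
        rw [hs₁.r r (by simpa [smallC, Cmd.wR, h36.symm, h37.symm, h36, h37] using hr)]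
        simp [h36, h37]
      · exact hs₁.ia r hr
      · exact hs₁.ra r hr
    obtain ⟨w1, w2, w3⟩ := h₁
    obtain ⟨w1a, w1b⟩ := w1 (by omega)
    refine (Runs.seq_rset (Runs.seq_rset (Runs.seq (R := fun s' =>
      Better p k A s s' ∧ (∀ i' < i, ∀ j ≤ k0, Goal i' j (s'.rreg 13)) ∧
        ∀ j < k0 + 1, Goal i j (s'.rreg 13))
      (Runs.forC (m := k0 + 1) (T := 60) (fun j s' => (j ≤ k0 → s'.rreg 38 = winSum WR Rm j ∧
        s'.rreg 39 = winSum WR Rb j) ∧ Better p k A s s' ∧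
        (∀ i' < i, ∀ j ≤ k0, Goal i' j (s'.rreg 13)) ∧ ∀ j' < j, Goal i j' (s'.rreg 13))
        rfl (fun _ _ => rfl) ?_ (fun j s₂ hj hs₂ hj20 h₂ => ?_) (fun s₂ _ _ h₂ => h₂.2))
      (fun s₂ hs₂ h₂ => Runs.seq_rset (Runs.rset ?_))))).le (by simp; ring_nf; omega)
    · refine ⟨fun _ => by simp [winSum], ?_, by simpa using w3, by simp⟩
      exact w2.trans (Better.refl_of (by simp) (by simp) (by simp))
    · have q : ∀ r, r ≠ 13 → r ≠ 26 → r ≠ 27 → r ≠ 29 → r ≠ 38 → r ≠ 39 →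
          s₂.rreg r = s₁.rreg r := by
        intro r h1 h2 h3 h4 h5 h6
        rw [hs₂.r r (by simp [forC, Cmd.wR, upd, h1, h2, h3, h4, h5, h6])]
        simp [h5, h6]
      have hA2 : ∀ r, r = 8 ∨ r = 10 ∨ r = 11 ∨ r = 12 ∨ r = 30 ∨ r = 31 ∨ r = 36 ∨ r = 37 →
          s₂.rreg r = s₁.rreg r := by
        intro r hr
        apply q <;> omega
      have c30 : s₂.rreg 30 = cm := by
        rw [hA2 30 (by simp), hs₁.r 30 rfl]; simpa using hcm
      have c31 : s₂.rreg 31 = cb := by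
        rw [hA2 31 (by simp), hs₁.r 31 rfl]; simpa using hcb
      have c8 : s₂.rreg 8 = I.thr := by rw [hA2 8 (by simp), hA1.env.thr]
      have c10 : s₂.rreg 10 = a₁ := by rw [hA2 10 (by simp), hA1.a₁]
      have c11 : s₂.rreg 11 = a₂ := by rw [hA2 11 (by simp), hA1.a₂]
      have c12 : s₂.rreg 12 = a₃ := by rw [hA2 12 (by simp), hA1.a₃]
      have c36 : s₂.rreg 36 = winSum WL Lm i := by rw [hA2 36 (by simp), w1a]
      have c37 : s₂.rreg 37 = winSum WL Lb i := by rw [hA2 37 (by simp), w1b]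
      have i10 : s₂.ireg 10 = p := by rw [hs₂.i 10 rfl]; simpa [hp] using hs₁.i 10 rfl
      have i11 : s₂.ireg 11 = k := by rw [hs₂.i 11 rfl]; simpa [hk] using hs₁.i 11 rfl
      obtain ⟨v1, v2, v3, v4⟩ := h₂
      obtain ⟨v1a, v1b⟩ := v1 (by omega)
      refine (Runs.seq_rset (Runs.seq_rset (Runs.seq (R := fun s' => Better p k A s s' ∧
        (∀ i' < i, ∀ j ≤ k0, Goal i' j (s'.rreg 13)) ∧ ∀ j' < j + 1, Goal i j' (s'.rreg 13))
        (Runs.ite (T₁ := 25) (fun hb => Runs.seq_rset ((upd_spec (p := p) (k := k) (A := A)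
          ?_ ?_ ?_).conseq le_rfl ?_)) (fun hb => Runs.skip ?_))
        (fun s₃ hs₃ h₃ => Runs.seq_rset (Runs.rset ?_))))).le (by simp)
      · simpa using i10
      · simpa using i11
      · simp [c8, c10, c11, c12, c30, c31, c36, c37, v1a, v1b] at hb ⊢
        obtain ⟨l, hl, e1, e2⟩ := hIL.exists_reach hn (by omega : i ≤ k0)
        obtain ⟨r, hr, e3, e4⟩ := hIR.exists_reach hn (by omega : j ≤ k0)
        exact ⟨l, hl, r, hr, by rw [e1, e3]; exact hb.1, by rw [e2, e4]; exact hb.2,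
          by rw [e1, e2, e3, e4]⟩
      · rintro s₃ - ⟨b1, b2⟩
        have hm : s₂.rreg 13 ≤ s₃.rreg 13 := by simpa using b1.mono
        refine ⟨v2.trans ⟨hm, by simpa using b1.sound⟩, fun i' hi' j' hj' g1 g2 =>
          (v3 i' hi' j' hj' g1 g2).trans hm, fun j' hj' => ?_⟩
        rcases Nat.lt_succ_iff_lt_or_eq.1 hj' with hj' | rfl
        · exact fun g1 g2 => (v4 j' hj' g1 g2).trans hm
        · intro _ _
          simpa [c8, c10, c11, c12, c30, c31, c36, c37, v1a, v1b] using b2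
      · simp [c8, c10, c11, c12, c30, c31, c36, c37, v1a, v1b] at hb
        refine ⟨v2.trans (Better.refl_of (by simp) (by simp) (by simp)), by simpa using v3, ?_⟩
        intro j' hj'
        rcases Nat.lt_succ_iff_lt_or_eq.1 hj' with hj' | rfl
        · simpa using v4 j' hj'
        · exact fun g1 g2 => absurd g2 (not_le.2 (hb g1))
      · refine ⟨fun hj' => ?_, h₃.1.trans (Better.refl_of (by simp) (by simp) (by simp)),
          by simpa using h₃.2.1, by simpa using h₃.2.2⟩
        have d38 := hs₃.r 38 rfl
        have d39 := hs₃.r 39 rfl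
        have d20 := hs₃.i 20 rfl
        have dW : s₃.iarr (bs false) = WR := by
          rw [hs₃.ia (bs false) rfl]; simp only [setR_iarr]
          rw [hs₂.ia (bs false) rfl]; simp only [setR_iarr]
          exact hs₁.ia (bs false) rfl
        have dm : s₃.rarr (bs false) = s.rarr (bs false) := by
          rw [hs₃.ra (bs false) rfl]; simp only [setR_rarr]
          rw [hs₂.ra (bs false) rfl]; simp only [setR_rarr]
          exact hs₁.ra (bs false) rfl
        have db : s₃.rarr (bs false + 1) = s.rarr (bs false + 1) := by
          rw [hs₃.ra (bs false + 1) rfl]; simp only [setR_rarr]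
          rw [hs₂.ra (bs false + 1) rfl]; simp only [setR_rarr]
          exact hs₁.ra (bs false + 1) rfl
        simp [v1a, v1b, hj20] at d38 d39 d20
        simpa [d38, d39, d20, dW, dm, db] using hsucc hIR hR.lm hR.lb j hj'
    · refine ⟨fun hi' => ?_, h₂.1.trans (Better.refl_of (by simp) (by simp) (by simp)), ?_⟩
      · have d36 := hs₂.r 36 rfl
        have d37 := hs₂.r 37 rfl
        have d19 := hs₂.i 19 rfl
        have dW : s₂.iarr (bs true) = WL := by
          rw [hs₂.ia (bs true) rfl]; simp only [setR_iarr]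
          exact hs₁.ia (bs true) rfl
        have dm : s₂.rarr (bs true) = s.rarr (bs true) := by
          rw [hs₂.ra (bs true) rfl]; simp only [setR_rarr]
          exact hs₁.ra (bs true) rfl
        have db : s₂.rarr (bs true + 1) = s.rarr (bs true + 1) := by
          rw [hs₂.ra (bs true + 1) rfl]; simp only [setR_rarr]
          exact hs₁.ra (bs true + 1) rfl
        simp [w1a, w1b, hi19] at d36 d37 d19
        simpa [d36, d37, d19, dW, dm, db] using hsucc hIL hL.lm hL.lb i hi'
      · intro i' hi' j hj
        rcases Nat.lt_succ_iff_lt_or_eq.1 hi' with hi' | rfl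
        · simpa using h₂.2.1 i' hi' j hj
        · simpa using h₂.2.2 j (Nat.lt_succ_of_le hj)
  · simp
    ring_nf
    omega

/-- By `largeC_spec` every pair of reaches is either already bounded by the best value or consists
of two window prefixes, and these pairs are treated by `smallC_spec`. -/
theorem evalC_spec (hA : Aux I h xr a₁ a₂ a₃ s) (hn : 0 < I.n) (hnZ : I.n ≤ 2 ^ h)
    (hR : SideSt I.n h k0 δ a₁ a₂ false Rm Rb s) (hL : SideSt I.n h k0 δ a₁ a₂ true Lm Lb s)
    (hp : s.ireg 10 = p) (hk : s.ireg 11 = k) (hcm : s.rreg 30 = cm) (hcb : s.rreg 31 = cb)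
    (hcm0 : 0 ≤ cm) (hcb0 : 0 ≤ cb) (hthr : I.thr ≤ k0 * δ) :
    Runs (evalC k0) s (500 * (k0 + 1) ^ 2) fun s' =>
      Better p k (Cand I.n I.thr a₁ a₂ a₃ cm cb Rm Rb Lm Lb) s s' ∧
      ∀ v, Cand I.n I.thr a₁ a₂ a₃ cm cb Rm Rb Lm Lb v → v ≤ s'.rreg 13 := by
  unfold evalC
  refine Runs.le (Runs.seq (largeC_spec hA hn hnZ hR hL hp hk hcm hcb hcm0 hcb0 hthr)
    (fun s₁ hs₁ h₁ => (smallC_spec (hA.of_same hs₁ rfl rfl) hn (hR.of_same hs₁ rfl)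
      (hL.of_same hs₁ rfl) ((hs₁.i 10 rfl).trans hp) ((hs₁.i 11 rfl).trans hk)
      ((hs₁.r 30 rfl).trans hcm) ((hs₁.r 31 rfl).trans hcb)).conseq le_rfl ?_)) ?_
  · rintro s₂ - h₂
    rw [hs₁.ia (bs true) rfl, hs₁.ia (bs false) rfl] at h₂
    refine ⟨h₁.1.trans h₂.1, ?_⟩
    rintro v ⟨l, hl, r, hr, e1, e2, rfl⟩
    rcases h₁.2 l hl r hr with ⟨⟨i, hi, f1, f2⟩, j, hj, f3, f4⟩ | hle
    · have := h₂.2 i hi j hj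
      rw [f1, f3] at e1
      rw [f2, f4] at e2
      rw [f1, f2, f3, f4]
      exact this e1 e2
    · exact hle.trans h₂.1.mono
  · ring_nf
    omega

end eval

end ScanStat

/-! ## Maximising one linear function -/

namespace ScanStat

open RealRAM Finset

/-- Insert the point in register 11, of weights 34 and 35, into its side. -/
def insertC (k0 : ℕ) : Cmd :=
  .ite (.ilt (.reg 12) (.load 0 (.reg 11)))
    (.iset 13 (.sub (.load 0 (.reg 11)) (.reg 12)) ;; sideInsert k0 false)
    (.ite (.ilt (.load 0 (.reg 11)) (.reg 12))
      (.iset 13 (.sub (.reg 12) (.load 0 (.reg 11))) ;; sideInsert k0 true)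
      (.rset 30 (.add (.reg 30) (.reg 34)) ;; .rset 31 (.add (.reg 31) (.reg 35))))

/-- Process the point in register 11 in the sweep with bottom point in register 10. -/
def stepC (k0 : ℕ) : Cmd :=
  .ite (.rlt (.load 5 (.reg 11)) (.load 5 (.reg 10))) .skip
    (.rset 34 (.load 6 (.reg 11)) ;; .rset 35 (.load 7 (.reg 11)) ;;
    .rset 32 (.add (.reg 32) (.reg 34)) ;; .rset 33 (.add (.reg 33) (.reg 35)) ;;
    insertC k0 ;;
    .ite (.and (.not (.and (.ilt (.add (.reg 11) (.const 1)) (.reg 0))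
        (.not (.rlt (.load 5 (.reg 11)) (.load 5 (.add (.reg 11) (.const 1)))))))
        (.and (.not (.rlt (.reg 9) (.reg 32))) (.not (.rlt (.reg 9) (.reg 33)))))
      (evalC k0) .skip)

/-- The sweep with bottom point in register 10. -/
def sweepC (k0 : ℕ) : Cmd :=
  resetSide k0 false ;; resetSide k0 true ;; .iset 12 (.load 0 (.reg 10)) ;;
  .rset 30 (.ofNat (.const 0)) ;; .rset 31 (.ofNat (.const 0)) ;;
  .rset 32 (.ofNat (.const 0)) ;; .rset 33 (.ofNat (.const 0)) ;;
  forC 11 (.reg 0) (stepC k0)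

/-- Maximise the linear function with coefficients in registers 10, 11, 12 and search the strip
of the best box. -/
def roundC (k0 : ℕ) : Cmd :=
  .rset 13 (.sub (.ofNat (.const 0)) (.ofNat (.const 1))) ;; .iset 4 (.const 0) ;;
  .iset 5 (.const 0) ;; forC 10 (.reg 0) (sweepC k0) ;;
  .iset 6 (.reg 4) ;; .iset 7 (.reg 5) ;; brute

/-- `v` is the value of a box with sufficient support in the strip from `p` to `k`. -/
structure RankCand (I : Inst) (xr : ℕ → ℕ) (a₁ a₂ a₃ : ℝ) (p k : ℕ) (v : ℝ) : Prop where
  last : I.Last k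
  le : I.Y p ≤ I.Y k
  mu : I.strip I.mu p k ≤ 1 - I.thr
  be : I.strip I.be p k ≤ 1 - I.thr
  box : ∃ l < I.n, ∃ r < I.n, I.thr ≤ I.rankBox xr I.mu p k l r ∧
    I.thr ≤ I.rankBox xr I.be p k l r ∧
    v = a₃ + (a₁ * I.rankBox xr I.mu p k l r + a₂ * I.rankBox xr I.be p k l r)

/-- The memory represents the points before `k` that are not below `p`. -/
structure SweepSt (I : Inst) (h k0 : ℕ) (xr : ℕ → ℕ) (δ a₁ a₂ : ℝ) (p k : ℕ) (s : State) :
    Prop where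
  right : SideSt I.n h k0 δ a₁ a₂ false (I.sR xr I.mu p k) (I.sR xr I.be p k) s
  left : SideSt I.n h k0 δ a₁ a₂ true (I.sL xr I.mu p k) (I.sL xr I.be p k) s
  cm : s.rreg 30 = I.sC xr I.mu p k
  cb : s.rreg 31 = I.sC xr I.be p k
  tm : s.rreg 32 = I.sT I.mu p k
  tb : s.rreg 33 = I.sT I.be p k

section

variable {I : Inst} {h k0 p k : ℕ} {xr : ℕ → ℕ} {δ a₁ a₂ a₃ : ℝ} {s : State}

theorem SweepSt.of_same {c : Cmd} {s' : State} (hS : SweepSt I h k0 xr δ a₁ a₂ p k s)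
    (hs : Same c s s')
    (h1 : (c.wRA (bs false) || c.wRA (bs false + 1) || c.wRA (bs false + 2) ||
      c.wRA (bs false + 3) || c.wIA (bs false)) = false)
    (h2 : (c.wRA (bs true) || c.wRA (bs true + 1) || c.wRA (bs true + 2) ||
      c.wRA (bs true + 3) || c.wIA (bs true)) = false)
    (h3 : c.wR 30 = false) (h4 : c.wR 31 = false) (h5 : c.wR 32 = false) (h6 : c.wR 33 = false) :
    SweepSt I h k0 xr δ a₁ a₂ p k s' :=
  ⟨hS.right.of_same hs h1, hS.left.of_same hs h2, by rw [hs.r _ h3, hS.cm], by rw [hs.r _ h4, hS.cb],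
    by rw [hs.r _ h5, hS.tm], by rw [hs.r _ h6, hS.tb]⟩

theorem insertC_spec (hG : Good I k0 δ xr) (hA : Aux I h xr a₁ a₂ a₃ s) (hnZ : I.n ≤ 2 ^ h)
    (hk : s.ireg 11 = k) (hz : s.ireg 12 = xr p) (hpn : p < I.n)
    (hkn : k < I.n) (hY : I.Y p ≤ I.Y k)
    (hR : SideSt I.n h k0 δ a₁ a₂ false (I.sR xr I.mu p k) (I.sR xr I.be p k) s)
    (hL : SideSt I.n h k0 δ a₁ a₂ true (I.sL xr I.mu p k) (I.sL xr I.be p k) s)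
    (h30 : s.rreg 30 = I.sC xr I.mu p k) (h31 : s.rreg 31 = I.sC xr I.be p k)
    (h32 : s.rreg 32 = I.sT I.mu p (k + 1)) (h33 : s.rreg 33 = I.sT I.be p (k + 1))
    (h34 : s.rreg 34 = I.mu k) (h35 : s.rreg 35 = I.be k) :
    Runs (insertC k0) s (40 * k0 + 50 * h + 130) fun s' =>
      SweepSt I h k0 xr δ a₁ a₂ p (k + 1) s' := by
  have hxk := hG.xr_lt k hkn
  have hxp := hG.xr_lt p hpn
  unfold insertC
  refine Runs.le (Runs.ite (fun hb => Runs.seq_iset ((sideInsert_spec (I := I) (h := h) (xr := xr)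
      (δ := δ) (a₁ := a₁) (a₂ := a₂) (a₃ := a₃) (x := xr k - xr p)
      (fm := I.sR xr I.mu p k) (fb := I.sR xr I.be p k) ?_ hnZ ?_ ?_ ?_ ?_ rfl rfl hG.δ_pos.le
      ?_ ?_).conseq le_rfl ?_))
    (fun hb => Runs.ite (fun hb' => Runs.seq_iset ((sideInsert_spec (I := I) (h := h) (xr := xr)
      (δ := δ) (a₁ := a₁) (a₂ := a₂) (a₃ := a₃) (x := xr p - xr k)
      (fm := I.sL xr I.mu p k) (fb := I.sL xr I.be p k) ?_ hnZ ?_ ?_ ?_ ?_ rfl rfl hG.δ_pos.le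
      ?_ ?_).conseq le_rfl ?_))
      (fun hb' => Runs.seq_rset (Runs.rset ?_)))) ?_
  all_goals try simp [hA.xr, hk, hz] at hb
  all_goals try simp [hA.xr, hk, hz] at hb'
  · exact ⟨hA.env.setI (by norm_num), by simp [hA.Z], hA.par, hA.xr, hA.a₁, hA.a₂, hA.a₃⟩
  · exact ⟨hR.lm, hR.lb, hR.inv⟩
  · simp [hA.xr, hk, hz]
  · omega
  · omega
  · simpa [h34] using hG.mu_ge k hkn
  · simpa [h35] using hG.be_ge k hkn
  · intro s' hs' h'
    have e : xr k = xr p + (xr k - xr p) := by omega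
    have e1 := Inst.sR_succ_of_eq (f := I.mu) hY (by omega : 0 < xr k - xr p) e
    have e2 := Inst.sR_succ_of_eq (f := I.be) hY (by omega : 0 < xr k - xr p) e
    refine ⟨?_, ?_, ?_, ?_, ?_, ?_⟩
    · rw [e1, e2]
      simpa [h34, h35] using h'
    · rw [Inst.sL_succ_of_not (by omega), Inst.sL_succ_of_not (by omega)]
      exact SideSt.of_same (s := s.setI 13 _) ⟨hL.lm, hL.lb, hL.inv⟩ hs' rfl
    · rw [hs'.r 30 rfl, Inst.sC_succ, if_neg (by omega), add_zero]; exact h30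
    · rw [hs'.r 31 rfl, Inst.sC_succ, if_neg (by omega), add_zero]; exact h31
    · rw [hs'.r 32 rfl]; exact h32
    · rw [hs'.r 33 rfl]; exact h33
  · exact ⟨hA.env.setI (by norm_num), by simp [hA.Z], hA.par, hA.xr, hA.a₁, hA.a₂, hA.a₃⟩
  · exact ⟨hL.lm, hL.lb, hL.inv⟩
  · simp [hA.xr, hk, hz]
  · omega
  · omega
  · simpa [h34] using hG.mu_ge k hkn
  · simpa [h35] using hG.be_ge k hkn
  · intro s' hs' h'
    have e : xr k + (xr p - xr k) = xr p := by omega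
    have e1 := Inst.sL_succ_of_eq (f := I.mu) hY (by omega : 0 < xr p - xr k) e
    have e2 := Inst.sL_succ_of_eq (f := I.be) hY (by omega : 0 < xr p - xr k) e
    refine ⟨?_, ?_, ?_, ?_, ?_, ?_⟩
    · rw [Inst.sR_succ_of_not (by omega), Inst.sR_succ_of_not (by omega)]
      exact SideSt.of_same (s := s.setI 13 _) ⟨hR.lm, hR.lb, hR.inv⟩ hs' rfl
    · rw [e1, e2]
      simpa [h34, h35] using h'
    · rw [hs'.r 30 rfl, Inst.sC_succ, if_neg (by omega), add_zero]; exact h30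
    · rw [hs'.r 31 rfl, Inst.sC_succ, if_neg (by omega), add_zero]; exact h31
    · rw [hs'.r 32 rfl]; exact h32
    · rw [hs'.r 33 rfl]; exact h33
  · have e : xr k = xr p := by omega
    refine ⟨?_, ?_, ?_, ?_, ?_, ?_⟩
    · rw [Inst.sR_succ_of_not (by omega), Inst.sR_succ_of_not (by omega)]
      exact ⟨hR.lm, hR.lb, hR.inv⟩
    · rw [Inst.sL_succ_of_not (by omega), Inst.sL_succ_of_not (by omega)]
      exact ⟨hL.lm, hL.lb, hL.inv⟩
    · simp [h30, h34, Inst.sC_succ, hY, e]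
    · simp [h31, h35, Inst.sC_succ, hY, e]
    · simpa using h32
    · simpa using h33
  · simp
    omega

/-- The strip is evaluated only if it ends at the last index of an ordinate and has weights at most
`1 - I.thr`. The second condition gives the upper support bound for all its boxes at once, so the
evaluation has to watch only the lower bound. -/
theorem stepC_spec (hG : Good I k0 δ xr) (hA : Aux I h xr a₁ a₂ a₃ s) (hnZ : I.n ≤ 2 ^ h)
    (hp : s.ireg 10 = p) (hk : s.ireg 11 = k) (hz : s.ireg 12 = xr p) (hpn : p < I.n)
    (hkn : k < I.n) (hS : SweepSt I h k0 xr δ a₁ a₂ p k s) :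
    Runs (stepC k0) s (600 * (k0 + 1) ^ 2 + 50 * h + 250) fun s' =>
      SweepSt I h k0 xr δ a₁ a₂ p (k + 1) s' ∧
      Better p k (RankCand I xr a₁ a₂ a₃ p k) s s' ∧
      ∀ v, RankCand I xr a₁ a₂ a₃ p k v → v ≤ s'.rreg 13 := by
  have hmu0 : ∀ i < I.n, 0 ≤ I.mu i := fun i hi => hG.δ_pos.le.trans (hG.mu_ge i hi)
  have hbe0 : ∀ i < I.n, 0 ≤ I.be i := fun i hi => hG.δ_pos.le.trans (hG.be_ge i hi)
  unfold stepC
  refine Runs.le (Runs.ite (fun hb => Runs.skip ?_) (fun hb => Runs.seq_rset (Runs.seq_rset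
    (Runs.seq_rset (Runs.seq_rset (Runs.seq (R := fun s' => SweepSt I h k0 xr δ a₁ a₂ p (k + 1) s')
      (insertC_spec (s := _) hG (a₃ := a₃) ?_ hnZ ?_ ?_ hpn hkn ?_ ?_ ?_ ?_ ?_ ?_ ?_ ?_ ?_)
      (fun s₁ hs₁ h₁ => Runs.ite (T₁ := 500 * (k0 + 1) ^ 2) (fun hb' => ?_)
        (fun hb' => Runs.skip ?_)))))))) ?_
  all_goals try simp [hA.env.Y, hk, hp] at hb
  · refine ⟨⟨?_, ?_, ?_, ?_, ?_, ?_⟩, Better.refl_of rfl rfl rfl,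
      fun v hv => absurd hv.le (not_le.2 hb)⟩
    · rw [Inst.sR_succ_of_not (fun h' => absurd h'.1 (not_le.2 hb)),
        Inst.sR_succ_of_not (fun h' => absurd h'.1 (not_le.2 hb))]
      exact hS.right
    · rw [Inst.sL_succ_of_not (fun h' => absurd h'.1 (not_le.2 hb)),
        Inst.sL_succ_of_not (fun h' => absurd h'.1 (not_le.2 hb))]
      exact hS.left
    · rw [Inst.sC_succ, if_neg (fun h' => absurd h'.1 (not_le.2 hb)), add_zero, hS.cm]
    · rw [Inst.sC_succ, if_neg (fun h' => absurd h'.1 (not_le.2 hb)), add_zero, hS.cb]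
    · rw [Inst.sT_succ, if_neg (fun h' => absurd h' (not_le.2 hb)), add_zero, hS.tm]
    · rw [Inst.sT_succ, if_neg (fun h' => absurd h' (not_le.2 hb)), add_zero, hS.tb]
  · exact ⟨⟨hA.env.n, hA.env.X, hA.env.Y, hA.env.mu, hA.env.be, by simp [hA.env.thr],
      by simp [hA.env.thr'], by simp [hA.env.cc]⟩, hA.Z, hA.par, hA.xr, by simp [hA.a₁],
      by simp [hA.a₂], by simp [hA.a₃]⟩
  · simpa using hk
  · simpa using hz
  · exact hb
  · exact ⟨hS.right.lm, hS.right.lb, hS.right.inv⟩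
  · exact ⟨hS.left.lm, hS.left.lb, hS.left.inv⟩
  · simpa using hS.cm
  · simpa using hS.cb
  · simp [hS.tm, hA.env.mu, hk, Inst.sT_succ, hb]
  · simp [hS.tb, hA.env.be, hk, Inst.sT_succ, hb]
  · simp [hA.env.mu, hk]
  · simp [hA.env.be, hk]
  all_goals try
    have p1 : s₁.ireg 10 = p := (hs₁.i 10 rfl).trans hp
    have k1 : s₁.ireg 11 = k := (hs₁.i 11 rfl).trans hk
    have n1 : s₁.ireg 0 = I.n := (hs₁.i 0 rfl).trans hA.env.n
    have Y1 : s₁.rarr 5 = I.Y := (hs₁.ra 5 rfl).trans hA.env.Y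
    have t1 : s₁.rreg 9 = 1 - I.thr := by
      rw [hs₁.r 9 rfl]; simp [hA.env.thr']
    have e13 : s₁.rreg 13 = s.rreg 13 := by
      rw [hs₁.r 13 rfl]; simp
    have e4 : s₁.ireg 4 = s.ireg 4 := hs₁.i 4 rfl
    have e5 : s₁.ireg 5 = s.ireg 5 := hs₁.i 5 rfl
    have hcond : (BExp.and (.not (.and (.ilt (.add (.reg 11) (.const 1)) (.reg 0))
        (.not (.rlt (.load 5 (.reg 11)) (.load 5 (.add (.reg 11) (.const 1)))))))
        (.and (.not (.rlt (.reg 9) (.reg 32))) (.not (.rlt (.reg 9) (.reg 33))))).Holds s₁ ↔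
        I.Last k ∧ I.sT I.mu p (k + 1) ≤ 1 - I.thr ∧ I.sT I.be p (k + 1) ≤ 1 - I.thr := by
      simp only [BExp.Holds, IExp.eval, RExp.eval, p1, k1, n1, Y1, t1, h₁.tm, h₁.tb, not_lt,
        not_and, not_not, Inst.Last]
      refine and_congr_left fun _ => ⟨fun h' => ?_, fun h' => ?_⟩
      · rcases (Nat.succ_le_of_lt hkn).lt_or_eq with h'' | h''
        · exact Or.inr ⟨h'', not_le.1 (h' h'')⟩
        · exact Or.inl h''
      · rcases h' with h' | h'
        · intro h''; omega
        · exact fun _ => not_le.2 h'.2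
    rw [hcond] at hb'
  · have hc0 : ∀ f : ℕ → ℝ, (∀ i < I.n, 0 ≤ f i) → 0 ≤ I.sC xr f p (k + 1) := fun f hf =>
      Finset.sum_nonneg fun i hi => by
        have := hf i (by have := mem_range.1 hi; omega)
        split_ifs
        · exact this
        · exact le_rfl
    have hA1 : Aux I h xr a₁ a₂ a₃ s₁ := by
      refine Aux.of_same (p := insertC k0) ?_ hs₁ rfl rfl
      exact ⟨⟨hA.env.n, hA.env.X, hA.env.Y, hA.env.mu, hA.env.be, by simp [hA.env.thr],
      by simp [hA.env.thr'], by simp [hA.env.cc]⟩, hA.Z, hA.par, hA.xr, by simp [hA.a₁],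
      by simp [hA.a₂], by simp [hA.a₃]⟩
    -- Under the tested conditions the candidates expressed by reaches are exactly the supported
    -- rank boxes of this strip.
    have hiff : ∀ v, Cand I.n I.thr a₁ a₂ a₃ (I.sC xr I.mu p (k + 1)) (I.sC xr I.be p (k + 1))
        (I.sR xr I.mu p (k + 1)) (I.sR xr I.be p (k + 1)) (I.sL xr I.mu p (k + 1))
        (I.sL xr I.be p (k + 1)) v ↔ RankCand I xr a₁ a₂ a₃ p k v := by
      intro v
      simp only [Cand, Inst.sides_eq_rankBox hG hb'.1]
      rw [Inst.sT_eq hG hb'.1, Inst.sT_eq hG hb'.1] at hb'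
      exact ⟨fun h' => ⟨hb'.1, hb, hb'.2.1, hb'.2.2, h'⟩, fun h' => h'.box⟩
    refine (evalC_spec hA1 hG.pos hnZ h₁.right h₁.left p1 k1 h₁.cm h₁.cb (hc0 _ hmu0) (hc0 _ hbe0)
      hG.thr_le).conseq le_rfl fun s₂ hs₂ h₂ => ⟨h₁.of_same hs₂ rfl rfl rfl rfl rfl rfl, ?_,
        fun v hv => h₂.2 v ((hiff v).2 hv)⟩
    refine ⟨e13 ▸ h₂.1.mono, ?_⟩
    rw [← e13, ← e4, ← e5, ← hiff]
    exact h₂.1.sound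
  · refine ⟨h₁, Better.refl_of e13 e4 e5, fun v hv => absurd ?_ hb'⟩
    rw [Inst.sT_eq hG hv.last, Inst.sT_eq hG hv.last]
    exact ⟨hv.last, hv.mu, hv.be⟩
  · simp
    ring_nf
    omega

/-- The best value belongs to a box of the recorded strip. -/
def BestOK (I : Inst) (xr : ℕ → ℕ) (a₁ a₂ a₃ : ℝ) (s : State) : Prop :=
  (s.rreg 13 = -1 ∨ RankCand I xr a₁ a₂ a₃ (s.ireg 4) (s.ireg 5) (s.rreg 13)) ∧
    s.ireg 4 < I.n ∧ s.ireg 5 < I.n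

theorem Better.bestOK {s' : State} (hB : Better p k (RankCand I xr a₁ a₂ a₃ p k) s s')
    (hpn : p < I.n) (hkn : k < I.n) (hs : BestOK I xr a₁ a₂ a₃ s) : BestOK I xr a₁ a₂ a₃ s' := by
  rcases hB.sound with ⟨h1, h2, h3⟩ | ⟨h1, h2, h3⟩
  · unfold BestOK; rw [h1, h2, h3]; exact hs
  · unfold BestOK; rw [h2, h3]; exact ⟨Or.inr h1, hpn, hkn⟩

theorem sweepC_spec (hG : Good I k0 δ xr) (hA : Aux I h xr a₁ a₂ a₃ s) (hnZ : I.n ≤ 2 ^ h)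
    (hp : s.ireg 10 = p) (hpn : p < I.n) (hB : BestOK I xr a₁ a₂ a₃ s) :
    Runs (sweepC k0) s
      (I.n * (600 * (k0 + 1) ^ 2 + 50 * h + 260) + 160 * 2 ^ h + 40 * k0 + 70) fun s' =>
      BestOK I xr a₁ a₂ a₃ s' ∧ s.rreg 13 ≤ s'.rreg 13 ∧
      ∀ k v, RankCand I xr a₁ a₂ a₃ p k v → v ≤ s'.rreg 13 := by
  unfold sweepC
  refine Runs.le (Runs.seq (resetSide_spec (δ := δ) (a₁ := a₁) (a₂ := a₂) hA.env.n hA.Z hnZ)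
    (fun s₁ hs₁ h₁ => Runs.seq (resetSide_spec (δ := δ) (a₁ := a₁) (a₂ := a₂)
      (hA.of_same hs₁ rfl rfl).env.n (hA.of_same hs₁ rfl rfl).Z hnZ) (fun s₂ hs₂ h₂ =>
      Runs.seq_iset (Runs.seq_rset (Runs.seq_rset (Runs.seq_rset (Runs.seq_rset
      (Runs.forC (m := I.n) (T := 600 * (k0 + 1) ^ 2 + 50 * h + 250) (fun k s' =>
        SweepSt I h k0 xr δ a₁ a₂ p k s' ∧ BestOK I xr a₁ a₂ a₃ s' ∧ s.rreg 13 ≤ s'.rreg 13 ∧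
        ∀ k' < k, ∀ v, RankCand I xr a₁ a₂ a₃ p k' v → v ≤ s'.rreg 13) rfl
        (fun s₃ hs₃ => ?_) ?_ (fun k s₃ hk hs₃ hi h₃ => ?_) ?_))))))))
      ?_
  · rw [IExp.eval, hs₃.i 0 rfl]
    simpa using (hA.env.of_same hs₁ rfl).of_same hs₂ rfl |>.n
  · have h₁' := h₁.of_same hs₂ rfl
    refine ⟨⟨?_, ?_, ?_, ?_, ?_, ?_⟩, ?_, ?_, by simp⟩
    · have : ∀ f, I.sR xr f p 0 = fun _ => 0 := fun f => by funext; simp [Inst.sR]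
      rw [this, this]
      exact ⟨h₁'.lm, h₁'.lb, h₁'.inv⟩
    · have : ∀ f, I.sL xr f p 0 = fun _ => 0 := fun f => by funext; simp [Inst.sL]
      rw [this, this]
      exact ⟨h₂.lm, h₂.lb, h₂.inv⟩
    · simp [Inst.sC]
    · simp [Inst.sC]
    · simp [Inst.sT]
    · simp [Inst.sT]
    · have e4 : s₂.ireg 4 = s.ireg 4 := (hs₂.i 4 rfl).trans (hs₁.i 4 rfl)
      have e5 : s₂.ireg 5 = s.ireg 5 := (hs₂.i 5 rfl).trans (hs₁.i 5 rfl)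
      have e13 : s₂.rreg 13 = s.rreg 13 := (hs₂.r 13 rfl).trans (hs₁.r 13 rfl)
      simpa [BestOK, e4, e5, e13] using hB
    · simp [(hs₂.r 13 rfl).trans (hs₁.r 13 rfl)]
  · have hA2 := (hA.of_same hs₁ rfl rfl).of_same hs₂ rfl rfl
    have hA3 : Aux I h xr a₁ a₂ a₃ s₃ := by
      refine Aux.of_same ?_ hs₃ rfl rfl
      exact ⟨⟨by simp [hA2.env.n], hA2.env.X, hA2.env.Y, hA2.env.mu, hA2.env.be,
        by simp [hA2.env.thr], by simp [hA2.env.thr'], by simp [hA2.env.cc]⟩, by simp [hA2.Z],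
        hA2.par, hA2.xr, by simp [hA2.a₁], by simp [hA2.a₂], by simp [hA2.a₃]⟩
    have p2 : s₂.ireg 10 = p := by rw [hs₂.i 10 rfl, hs₁.i 10 rfl, hp]
    have p3 : s₃.ireg 10 = p := by rw [hs₃.i 10 rfl]; simpa using p2
    have z3 : s₃.ireg 12 = xr p := by rw [hs₃.i 12 rfl]; simp [hA2.xr, p2]
    refine (stepC_spec hG hA3 hnZ p3 hi z3 hpn hk h₃.1).conseq le_rfl ?_
    rintro s₄ - ⟨g1, g2, g3⟩
    refine ⟨⟨⟨g1.right.lm, g1.right.lb, g1.right.inv⟩, ⟨g1.left.lm, g1.left.lb, g1.left.inv⟩,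
      g1.cm, g1.cb, g1.tm, g1.tb⟩, ?_, ?_, ?_⟩
    · simpa [BestOK] using g2.bestOK hpn hk h₃.2.1
    · exact h₃.2.2.1.trans g2.mono
    · intro k' hk' v hv
      rcases Nat.lt_succ_iff_lt_or_eq.1 hk' with hk' | rfl
      · exact (h₃.2.2.2 k' hk' v hv).trans g2.mono
      · exact g3 v hv
  · exact fun s₃ _ _ h₃ => ⟨h₃.2.1, h₃.2.2.1, fun k v hv => h₃.2.2.2 k hv.last.lt v hv⟩
  · simp
    ring_nf
    omega

/-- What one round guarantees: all boxes in strips with sufficient complement have value at most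
the best value, and this is the value of a box whose statistic has been taken into account. -/
structure RoundPost (I : Inst) (xr : ℕ → ℕ) (a₁ a₂ a₃ : ℝ) (s s' : State) : Prop where
  improves : I.Improves s s'
  ge : -1 ≤ s'.rreg 13
  up : ∀ p < I.n, ∀ k v, RankCand I xr a₁ a₂ a₃ p k v → v ≤ s'.rreg 13
  attained : s'.rreg 13 = -1 ∨ ∃ l r b t, I.Adm l r b t ∧
    s'.rreg 13 = a₃ + (a₁ * I.box I.mu l r b t + a₂ * I.box I.be l r b t) ∧
    (∃ p < I.n, ∃ k, RankCand I xr a₁ a₂ a₃ p k (s'.rreg 13)) ∧ I.val l r b t ≤ s'.rreg 4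

/-- The trees give maximal values but not the boxes that attain them. It is enough to remember the
strip: the final exhaustive search takes all its admissible boxes into account, including a
maximising one. The initial value -1 marks that no candidate was found; indices 0 keep the final
search meaningful in that case. -/
theorem roundC_spec (hG : Good I k0 δ xr) (hA : Aux I h xr a₁ a₂ a₃ s) (hnZ : I.n ≤ 2 ^ h)
    (hR : I.Recorded s) :
    Runs (roundC k0) s (I.n * (I.n * (600 * (k0 + 1) ^ 2 + 50 * h + 260) + 160 * 2 ^ h + 40 * k0 +
      80) + 160 * I.n ^ 2 + 100 * I.n + 60) fun s' => RoundPost I xr a₁ a₂ a₃ s s' := by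
  have hmu0 : ∀ i < I.n, 0 ≤ I.mu i := fun i hi => hG.δ_pos.le.trans (hG.mu_ge i hi)
  have hbe0 : ∀ i < I.n, 0 ≤ I.be i := fun i hi => hG.δ_pos.le.trans (hG.be_ge i hi)
  unfold roundC
  refine Runs.le (Runs.seq_rset (Runs.seq_iset (Runs.seq_iset (Runs.seq (R := fun s' =>
    BestOK I xr a₁ a₂ a₃ s' ∧ -1 ≤ s'.rreg 13 ∧
      ∀ p < I.n, ∀ k v, RankCand I xr a₁ a₂ a₃ p k v → v ≤ s'.rreg 13)
    (Runs.forC (m := I.n)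
      (T := I.n * (600 * (k0 + 1) ^ 2 + 50 * h + 260) + 160 * 2 ^ h + 40 * k0 + 70) (fun p s' =>
      BestOK I xr a₁ a₂ a₃ s' ∧ -1 ≤ s'.rreg 13 ∧
      ∀ p' < p, ∀ k v, RankCand I xr a₁ a₂ a₃ p' k v → v ≤ s'.rreg 13) rfl
      (fun s₁ hs₁ => ?_) ?_ (fun p s₁ hp hs₁ hi h₁ => ?_) (fun _ _ _ h => h))
    (fun s₁ hs₁ h₁ => Runs.seq_iset (Runs.seq_iset ((Inst.brute_spec (I := I) (b := s₁.ireg 4)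
      (t := s₁.ireg 5) ?_ hG.thr_pos hmu0 ?_ ?_ h₁.1.2.1 h₁.1.2.2 ?_).conseq le_rfl ?_))))))) ?_
  · rw [IExp.eval, hs₁.i 0 rfl]; simpa using hA.env.n
  · exact ⟨⟨Or.inl (by simp), by simp [hG.pos], by simp [hG.pos]⟩, by simp, by simp⟩
  · have hA1 : Aux I h xr a₁ a₂ a₃ s₁ := by
      refine Aux.of_same ?_ hs₁ rfl rfl
      exact ⟨⟨by simp [hA.env.n], hA.env.X, hA.env.Y, hA.env.mu, hA.env.be,
        by simp [hA.env.thr], by simp [hA.env.thr'], by simp [hA.env.cc]⟩, by simp [hA.Z],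
        hA.par, hA.xr, by simp [hA.a₁], by simp [hA.a₂], by simp [hA.a₃]⟩
    refine (sweepC_spec hG hA1 hnZ hi hp h₁.1).conseq le_rfl ?_
    rintro s₂ - ⟨g1, g2, g3⟩
    refine ⟨by simpa [BestOK] using g1, h₁.2.1.trans g2, fun p' hp' => ?_⟩
    rcases Nat.lt_succ_iff_lt_or_eq.1 hp' with hp' | rfl
    · exact fun k v hv => (h₁.2.2 p' hp' k v hv).trans g2
    · exact g3
  · refine Inst.Env.setI (Inst.Env.setI ?_ (by norm_num)) (by norm_num)
    refine Inst.Env.of_same ?_ hs₁ rfl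
    exact ⟨by simp [hA.env.n], hA.env.X, hA.env.Y, hA.env.mu, hA.env.be,
        by simp [hA.env.thr], by simp [hA.env.thr'], by simp [hA.env.cc]⟩
  · simp
  · simp
  · simpa [Inst.Recorded, hs₁.r 0 rfl, hs₁.r 1 rfl, hs₁.r 2 rfl, hs₁.r 3 rfl, hs₁.r 4 rfl] using hR
  · intro s₂ hs₂ h₂
    have e13 : s₂.rreg 13 = s₁.rreg 13 := hs₂.r 13 rfl
    have e4 : s₁.rreg 4 = s.rreg 4 := by rw [hs₁.r 4 rfl]; simp
    have m4 := h₂.1.mono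
    simp only [setI_rreg, e4] at m4
    refine ⟨⟨h₂.1.recorded, m4⟩, e13 ▸ h₁.2.1, e13 ▸ h₁.2.2, ?_⟩
    rw [e13]
    refine h₁.1.1.imp_right fun hc => ?_
    obtain ⟨l, hl, r, hr, c1, c2, c3⟩ := hc.box
    obtain ⟨a, ha, b, hb, hab, hbox⟩ := Inst.exists_box_eq_rankBox (l := l) (r := r) hG h₁.1.2.1 hc.le
    -- The lower bounds belong to the candidate, and the upper bounds are inherited from the strip.
    have hadm : I.Adm a b (s₁.ireg 4) (s₁.ireg 5) := by
      refine ⟨⟨?_, ?_⟩, ?_, ?_⟩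
      · rw [← hbox]; exact c1
      · rw [← hbox]; exact (Inst.rankBox_le_strip hmu0).trans hc.mu
      · rw [← hbox]; exact c2
      · rw [← hbox]; exact (Inst.rankBox_le_strip hbe0).trans hc.be
    refine ⟨a, b, s₁.ireg 4, s₁.ireg 5, hadm, ?_, ⟨_, h₁.1.2.1, _, hc⟩, h₂.2 a ha b hb hab hadm⟩
    rw [← hbox, ← hbox]; exact c3
  · simp
    ring_nf
    omega

end

end ScanStat

/-! ## The family of linear functions -/

namespace ScanStat

/-- The statistic without its constant factor. -/
noncomputable def stat (x y : ℝ) : ℝ := (x - y) ^ 2 / (y * (1 - y))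

/-- The linear lower bound with slope parameter `t` and base point `z`. -/
noncomputable def fam (t z x y : ℝ) : ℝ :=
  -(t ^ 2 * z ^ 2) + (2 * t * x + (-(2 * t) - t ^ 2 * (1 - 2 * z)) * y)

theorem stat_eq {x y t : ℝ} (hy : 0 < y) (hy1 : y < 1) (ht : t = (x - y) / (y * (1 - y))) :
    stat x y = t ^ 2 * (y * (1 - y)) := by
  have : 0 < y * (1 - y) := mul_pos hy (by linarith)
  rw [ht, stat]
  field_simp

/-- With h = y(1-y) one has th = x-y. Completing the square, t²h = 2t₀(x-y) - t₀²h + h(t-t₀)². The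
remaining nonlinear term -t₀²h = -t₀²y + t₀²y² is convex in y, and replacing y² by its tangent 2zy -
z² at z costs t₀²(y-z)². -/
theorem stat_sub_fam {x y t : ℝ} (hy : 0 < y) (hy1 : y < 1) (ht : t = (x - y) / (y * (1 - y)))
    (t₀ z : ℝ) :
    stat x y - fam t₀ z x y = y * (1 - y) * (t - t₀) ^ 2 + t₀ ^ 2 * (y - z) ^ 2 := by
  have h : 0 < y * (1 - y) := mul_pos hy (by linarith)
  have hx : x = y + t * (y * (1 - y)) := by
    rw [ht, div_mul_cancel₀ _ h.ne']; ring
  rw [stat_eq hy hy1 ht, fam, hx]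
  ring

theorem fam_le_stat {x y : ℝ} (hy : 0 < y) (hy1 : y < 1) (t₀ z : ℝ) :
    fam t₀ z x y ≤ stat x y := by
  have h := stat_sub_fam (x := x) hy hy1 rfl t₀ z
  have : 0 < y * (1 - y) := mul_pos hy (by linarith)
  have : 0 ≤ stat x y - fam t₀ z x y := by rw [h]; positivity
  linarith

/-- Grid points in the unit interval that are dense near its ends. -/
noncomputable def gridPt (N j : ℕ) : ℝ := (j : ℝ) ^ 2 / ((j : ℝ) ^ 2 + ((N - j : ℕ) : ℝ) ^ 2)

/-- Applied with {A, B} = {√y, √(1-y)} and a:b close to A:B. The error factors as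
(Ab-Ba)(Ab+Ba)/(a²+b²). The first factor is at most d(A+B), and (A+B)(Ab+Ba) ≤ 3AB because a is
rounded down and A ≤ B; together with a²+b² ≥ 1/2 the error is at most 6dAB. These rational grid
points avoid square roots, which the machine cannot compute exactly. -/
theorem grid_aux {A B a b d : ℝ} (hA : 0 < A) (hAB : A ≤ B) (h1 : A ^ 2 + B ^ 2 = 1) (ha : 0 ≤ a)
    (hb : 0 ≤ b) (hab : a + b = 1) (h2 : a * (A + B) ≤ A) (h3 : A - a * (A + B) ≤ d * (A + B)) :
    (A ^ 2 - a ^ 2 / (a ^ 2 + b ^ 2)) ^ 2 ≤ 36 * d ^ 2 * (A ^ 2 * B ^ 2) := by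
  have hB : 0 < B := hA.trans_le hAB
  have hD : 1 / 2 ≤ a ^ 2 + b ^ 2 := by nlinarith [sq_nonneg (a - b)]
  have hd : 0 ≤ d := by
    by_contra hd
    nlinarith [mul_pos (neg_pos.2 (not_le.1 hd)) (add_pos hA hB)]
  have hE : 0 ≤ A * b - B * a := by
    have : b = 1 - a := by linarith
    subst this; nlinarith
  have hE' : A * b - B * a ≤ d * (A + B) := by
    have : b = 1 - a := by linarith
    subst this; nlinarith
  have hF : 0 ≤ A * b + B * a := by positivity
  have key : (A * b - B * a) * (A * b + B * a) ≤ 3 * d * (A * B) := by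
    have h4 : (A + B) * (A * b + B * a) ≤ 3 * (A * B) := by
      have : b ≤ 1 := by linarith
      nlinarith [mul_nonneg hA.le (sub_nonneg.2 hAB), mul_le_mul_of_nonneg_left h2 hB.le,
        mul_le_mul_of_nonneg_left this (mul_pos (add_pos hA hB) hA).le]
    calc (A * b - B * a) * (A * b + B * a) ≤ d * (A + B) * (A * b + B * a) :=
          mul_le_mul_of_nonneg_right hE' hF
      _ = d * ((A + B) * (A * b + B * a)) := by ring
      _ ≤ d * (3 * (A * B)) := mul_le_mul_of_nonneg_left h4 hd
      _ = _ := by ring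
  have hDpos : 0 < a ^ 2 + b ^ 2 := by linarith
  have heq : A ^ 2 - a ^ 2 / (a ^ 2 + b ^ 2) =
      (A * b - B * a) * (A * b + B * a) / (a ^ 2 + b ^ 2) := by
    rw [eq_div_iff hDpos.ne', sub_mul, div_mul_cancel₀ _ hDpos.ne']
    nlinarith [h1]
  have h0 : 0 ≤ (A * b - B * a) * (A * b + B * a) / (a ^ 2 + b ^ 2) := by positivity
  have h6 : (A * b - B * a) * (A * b + B * a) / (a ^ 2 + b ^ 2) ≤ 6 * d * (A * B) := by
    rw [div_le_iff₀ hDpos]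
    have : 0 ≤ d * (A * B) := by positivity
    nlinarith
  rw [heq]
  calc _ ≤ (6 * d * (A * B)) ^ 2 := pow_le_pow_left₀ h0 h6 2
    _ = _ := by ring

theorem exists_gridPt {N : ℕ} (hN : 0 < N) {y : ℝ} (hy : 0 < y) (hy1 : y < 1) :
    ∃ j ≤ N, (y - gridPt N j) ^ 2 ≤ 36 * (1 / (N : ℝ)) ^ 2 * (y * (1 - y)) := by
  have hN' : (0 : ℝ) < N := by exact_mod_cast hN
  set A := √y with hAdef
  set B := √(1 - y) with hBdef
  have hA : 0 < A := Real.sqrt_pos.2 hy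
  have hB : 0 < B := Real.sqrt_pos.2 (by linarith)
  have hA2 : A ^ 2 = y := Real.sq_sqrt hy.le
  have hB2 : B ^ 2 = 1 - y := Real.sq_sqrt (by linarith)
  have hS : 0 < A + B := add_pos hA hB
  have h1 : A ^ 2 + B ^ 2 = 1 := by rw [hA2, hB2]; ring
  have hg : ∀ j ≤ N, gridPt N j =
      (j / N : ℝ) ^ 2 / ((j / N : ℝ) ^ 2 + (1 - j / N : ℝ) ^ 2) := by
    intro j hj
    rw [gridPt, Nat.cast_sub hj]
    have e : (1 - j / N : ℝ) = (N - j) / N := by field_simp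
    rw [e, div_pow, div_pow, ← add_div, div_div_div_cancel_right₀ (by positivity)]
  have hle : A / (A + B) ≤ 1 := (div_le_one hS).2 (by linarith)
  -- The smaller of the two proportions has to be rounded down. For A ≤ B this is j/N, and j is a
  -- floor; for B ≤ A it is 1 - j/N, and j is a ceiling.
  rcases le_total A B with hAB | hAB
  · have hj0 : 0 ≤ A / (A + B) * N := by positivity
    have hf := Nat.floor_le hj0
    have hf' := Nat.lt_floor_add_one (A / (A + B) * N)
    set j := ⌊A / (A + B) * N⌋₊
    have hjN : (j : ℝ) ≤ N := hf.trans (by nlinarith)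
    have hjN' : j ≤ N := by exact_mod_cast hjN
    refine ⟨j, hjN', ?_⟩
    have hy2 : y * (1 - y) = A ^ 2 * B ^ 2 := by rw [hA2, hB2]
    rw [hg j hjN', hy2]
    nth_rewrite 1 [← hA2]
    refine grid_aux hA hAB h1 (by positivity) (sub_nonneg.2 ((div_le_one hN').2 hjN)) (by ring) ?_ ?_
    · rw [div_mul_eq_mul_div, div_le_iff₀ hN']
      rw [div_mul_eq_mul_div, le_div_iff₀ hS] at hf
      linarith
    · rw [div_mul_eq_mul_div, div_lt_iff₀ hS] at hf'
      rw [div_mul_eq_mul_div, div_mul_eq_mul_div, sub_le_iff_le_add, ← add_div,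
        le_div_iff₀ hN']
      nlinarith
  · have hj0 : 0 ≤ A / (A + B) * N := by positivity
    have hf := Nat.le_ceil (A / (A + B) * N)
    have hf' := Nat.ceil_lt_add_one hj0
    have hjN' : ⌈A / (A + B) * N⌉₊ ≤ N := Nat.ceil_le.2 (by nlinarith)
    set j := ⌈A / (A + B) * N⌉₊
    have hjN : (j : ℝ) ≤ N := by exact_mod_cast hjN'
    refine ⟨j, hjN', ?_⟩
    have hb0 : (0 : ℝ) ≤ j / N := by positivity
    have hb1 : (0 : ℝ) ≤ 1 - j / N := sub_nonneg.2 ((div_le_one hN').2 hjN)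
    have hpos : (0 : ℝ) < (j / N : ℝ) ^ 2 + (1 - j / N : ℝ) ^ 2 := by
      nlinarith [sq_nonneg ((j / N : ℝ) - (1 - j / N))]
    have := grid_aux (A := B) (B := A) (a := 1 - j / N) (b := j / N) (d := 1 / N) hB hAB
      (by linarith) hb1 hb0 (by ring) ?_ ?_
    · rw [hg j hjN']
      have e1 : B ^ 2 - (1 - j / N : ℝ) ^ 2 / ((1 - j / N : ℝ) ^ 2 + (j / N : ℝ) ^ 2) =
          -(y - (j / N : ℝ) ^ 2 / ((j / N : ℝ) ^ 2 + (1 - j / N : ℝ) ^ 2)) := by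
        have e : (1 - j / N : ℝ) ^ 2 / ((1 - j / N : ℝ) ^ 2 + (j / N : ℝ) ^ 2) =
            1 - (j / N : ℝ) ^ 2 / ((j / N : ℝ) ^ 2 + (1 - j / N : ℝ) ^ 2) := by
          rw [eq_sub_iff_add_eq, add_comm ((1 - j / N : ℝ) ^ 2), ← add_div,
            add_comm ((1 - j / N : ℝ) ^ 2), div_self hpos.ne']
        rw [hB2, e]
        ring
      rw [e1, neg_sq, hA2, hB2] at this
      linarith
    · rw [div_mul_eq_mul_div, div_le_iff₀ hS] at hf
      rw [sub_mul, div_mul_eq_mul_div, one_mul, sub_le_iff_le_add, ← sub_le_iff_le_add',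
        le_div_iff₀ hN']
      linarith
    · rw [div_mul_eq_mul_div] at hf'
      have : (j : ℝ) * (B + A) < A * N + (B + A) := by
        have h7 := mul_lt_mul_of_pos_right hf' hS
        rw [add_mul, div_mul_cancel₀ _ hS.ne'] at h7
        linarith
      have e : (1 - j / N : ℝ) * (B + A) = (B + A) - j * (B + A) / N := by ring
      rw [e, div_mul_eq_mul_div, one_mul]
      have e2 : (j : ℝ) * (B + A) / N ≤ (A * N + (B + A)) / N :=
        div_le_div_of_nonneg_right this.le hN'.le
      rw [add_div, mul_div_cancel_right₀ _ hN'.ne'] at e2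
      linarith

/-- Some member of the family is a relative approximation. -/
theorem exists_fam_approx {ε x y τ : ℝ} {N : ℕ} (hε : 0 < ε) (hε1 : ε ≤ 1)
    (hN : 74 ≤ (N : ℝ) * N * ε) (hy : 0 < y) (hy1 : y < 1) (hτ : 0 < τ)
    (ht : τ ≤ |(x - y) / (y * (1 - y))|) :
    ∃ k j : ℕ, j ≤ N ∧ τ * (1 + 1 / (N : ℝ)) ^ k ≤ |(x - y) / (y * (1 - y))| ∧
      ∃ σ : ℝ, (σ = 1 ∨ σ = -1) ∧
      stat x y ≤ (1 + ε) * fam (σ * (τ * (1 + 1 / (N : ℝ)) ^ k)) (gridPt N j) x y := by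
  have hN0 : 0 < N := by
    rcases Nat.eq_zero_or_pos N with rfl | h
    · norm_num at hN
    · exact h
  have hN' : (0 : ℝ) < N := by exact_mod_cast hN0
  set t := (x - y) / (y * (1 - y)) with htdef
  have hh : 0 < y * (1 - y) := mul_pos hy (by linarith)
  -- The exponent is chosen such that the slope T of the family satisfies T ≤ |t| < (1 + 1/N)T.
  obtain ⟨k, hk1, hk2⟩ := exists_nat_pow_near ((one_le_div hτ).2 ht)
    (by have : 0 < 1 / (N : ℝ) := by positivity
        linarith : 1 < 1 + 1 / (N : ℝ))
  rw [le_div_iff₀ hτ, mul_comm] at hk1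
  rw [div_lt_iff₀ hτ, pow_succ] at hk2
  set T := τ * (1 + 1 / (N : ℝ)) ^ k with hT
  have hk2' : |t| ≤ T + T / N := by
    refine hk2.le.trans_eq ?_
    rw [hT]; field_simp
  have hT0 : 0 < T := by positivity
  obtain ⟨j, hj, hg⟩ := exists_gridPt hN0 hy hy1
  obtain ⟨σ, hσ, hσt⟩ : ∃ σ : ℝ, (σ = 1 ∨ σ = -1) ∧ t = σ * |t| := by
    rcases le_total 0 t with h | h
    · exact ⟨1, Or.inl rfl, by rw [abs_of_nonneg h, one_mul]⟩
    · exact ⟨-1, Or.inr rfl, by rw [abs_of_nonpos h]; ring⟩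
  have hσ2 : σ ^ 2 = 1 := by rcases hσ with rfl | rfl <;> norm_num
  refine ⟨k, j, hj, hk1, σ, hσ, ?_⟩
  have hs := stat_eq hy hy1 htdef
  have hd := stat_sub_fam hy hy1 htdef (σ * T) (gridPt N j)
  have e1 : (t - σ * T) ^ 2 = (|t| - T) ^ 2 := by
    conv_lhs => rw [hσt]
    calc (σ * |t| - σ * T) ^ 2 = σ ^ 2 * (|t| - T) ^ 2 := by ring
      _ = _ := by rw [hσ2, one_mul]
  have e2 : (σ * T) ^ 2 = T ^ 2 := by rw [mul_pow, hσ2, one_mul]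
  have b1 : (|t| - T) ^ 2 ≤ (1 / N) ^ 2 * t ^ 2 := by
    have : |t| - T ≤ 1 / N * |t| := by
      have : T / N ≤ |t| / N := div_le_div_of_nonneg_right hk1 hN'.le
      rw [div_mul_eq_mul_div, one_mul]; linarith
    calc (|t| - T) ^ 2 ≤ (1 / N * |t|) ^ 2 := pow_le_pow_left₀ (by linarith) this 2
      _ = _ := by rw [mul_pow, sq_abs]
  have b2 : T ^ 2 ≤ t ^ 2 := by
    rw [← sq_abs t]; exact pow_le_pow_left₀ hT0.le hk1 2
  have b3 : T ^ 2 * (y - gridPt N j) ^ 2 ≤ t ^ 2 * (36 * (1 / (N : ℝ)) ^ 2 * (y * (1 - y))) :=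
    mul_le_mul b2 hg (sq_nonneg _) (sq_nonneg _)
  -- The slope contributes 1/N² and the base point 36/N² to the relative error; half of ε is twice
  -- 37 divided by 2N², whence 74.
  have b4 : 74 * (1 / (N : ℝ)) ^ 2 ≤ ε := by
    rw [div_pow, one_pow, mul_one_div, div_le_iff₀ (by positivity)]
    linarith [hN, sq (N : ℝ)]
  rw [e1, e2] at hd
  have b5 := mul_le_mul_of_nonneg_left b1 hh.le
  have b6 : stat x y - fam (σ * T) (gridPt N j) x y ≤ ε / 2 * stat x y := by
    rw [hd, hs]
    have : 74 * (1 / (N : ℝ)) ^ 2 * (t ^ 2 * (y * (1 - y))) ≤ ε * (t ^ 2 * (y * (1 - y))) :=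
      mul_le_mul_of_nonneg_right b4 (by positivity)
    nlinarith
  have hs0 : 0 ≤ stat x y := by rw [hs]; positivity
  have b7 : (1 - ε / 2) * stat x y ≤ fam (σ * T) (gridPt N j) x y := by linarith
  have b8 := mul_le_mul_of_nonneg_left b7 (by linarith : 0 ≤ 1 + ε)
  -- This is the surplus of (1 + ε)(1 - ε/2) over 1, nonnegative since ε ≤ 1.
  have b9 : 0 ≤ (ε / 2 * (1 - ε)) * stat x y :=
    mul_nonneg (mul_nonneg (by linarith) (by linarith)) hs0
  nlinarith

theorem gaussian_eq (c : ℝ) (p : ℝ × ℝ) : gaussian c p = c * stat p.1 p.2 := rfl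

/-- With d = C/n the interval [d, 1-d] is nonempty, so d ≤ 1/2. On it y(1-y) ≥ d(1-d) ≥ d/2. -/
theorem supportSquare_bounds {C : ℝ} {n : ℕ} (hC : 0 < C) (hn : 0 < n) {p : ℝ × ℝ}
    (hp : p ∈ supportSquare C n) :
    0 < p.2 ∧ p.2 < 1 ∧ C / (2 * n) ≤ p.2 * (1 - p.2) ∧ C / n ≤ 1 / 2 := by
  have hn' : (0 : ℝ) < n := by exact_mod_cast hn
  obtain ⟨-, h1, h2⟩ := hp
  have hd : 0 < C / n := by positivity
  have hd2 : C / n ≤ 1 / 2 := by linarith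
  refine ⟨by linarith, by linarith, ?_, hd2⟩
  have e : C / (2 * n) = C / n / 2 := by field_simp
  rw [e]
  nlinarith [mul_nonneg (sub_nonneg.2 h1) (by linarith : 0 ≤ 1 - p.2 - C / n)]

/-- From C/(2n) ≤ y(1-y) ≤ 1. The natural upper bound is 2wn/C; the constant 3 makes it strict, to
match the strict test of the loop over the slopes. -/
theorem abs_slope_bounds {C w : ℝ} {n : ℕ} (hC : 0 < C) (hn : 0 < n) {p : ℝ × ℝ}
    (hp : p ∈ deviationBand C n w) (hw : 0 < w) :
    w * C / n ≤ |(p.1 - p.2) / (p.2 * (1 - p.2))| ∧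
      |(p.1 - p.2) / (p.2 * (1 - p.2))| < 3 * w * n / C := by
  have hn' : (0 : ℝ) < n := by exact_mod_cast hn
  obtain ⟨hS, h1, h2⟩ := hp
  obtain ⟨hy, hy1, hh, -⟩ := supportSquare_bounds hC hn hS
  have h0 : 0 < p.2 * (1 - p.2) := mul_pos hy (by linarith)
  rw [abs_div, abs_of_pos h0, le_div_iff₀ h0, div_lt_iff₀ h0]
  constructor
  · have : w * C / n * (p.2 * (1 - p.2)) ≤ w * C / n * 1 :=
      mul_le_mul_of_nonneg_left (by nlinarith) (by positivity)
    calc _ ≤ w * C / n * 1 := this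
      _ = C / n * w := by ring
      _ ≤ _ := h1
  · have : 3 * w * n / C * (C / (2 * n)) ≤ 3 * w * n / C * (p.2 * (1 - p.2)) :=
      mul_le_mul_of_nonneg_left hh (by positivity)
    have e : 3 * w * n / C * (C / (2 * n)) = 3 / 2 * w := by field_simp
    linarith

/-- Points of small deviation cannot be maximal. -/
theorem stat_le_of_small {C w : ℝ} {n : ℕ} (hC : 0 < C) (hn : 0 < n) {p q : ℝ × ℝ}
    (hp : p ∈ supportSquare C n) (hq : q ∈ supportSquare C n) (hw : |q.1 - q.2| = w)
    (hpw : |p.1 - p.2| < C / n * w) : stat p.1 p.2 < stat q.1 q.2 := by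
  have hn' : (0 : ℝ) < n := by exact_mod_cast hn
  obtain ⟨hy, hy1, hh, hC2⟩ := supportSquare_bounds hC hn hp
  obtain ⟨hz, hz1, -, -⟩ := supportSquare_bounds hC hn hq
  have h0 : 0 < p.2 * (1 - p.2) := mul_pos hy (by linarith)
  have h1 : 0 < q.2 * (1 - q.2) := mul_pos hz (by linarith)
  have hd : 0 < C / n := by positivity
  have a1 : (p.1 - p.2) ^ 2 < (C / n * w) ^ 2 := by
    rw [← sq_abs]; exact pow_lt_pow_left₀ hpw (abs_nonneg _) (by norm_num)
  -- With d = C/n the numerator is below d²w² and the denominator is at least d/2, so the quotient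
  -- is below 2dw² ≤ w². At `q` the numerator is w² and the denominator at most 1.
  have a2 : stat p.1 p.2 < w ^ 2 := by
    rw [stat, div_lt_iff₀ h0]
    have e : C / (2 * n) = C / n / 2 := by field_simp
    rw [e] at hh
    have b1 : w ^ 2 * (C / n / 2) ≤ w ^ 2 * (p.2 * (1 - p.2)) :=
      mul_le_mul_of_nonneg_left hh (sq_nonneg _)
    have b2 : (C / n * w) ^ 2 ≤ w ^ 2 * (C / n / 2) := by
      have : (C / n) ^ 2 ≤ C / n / 2 := by nlinarith
      calc (C / n * w) ^ 2 = w ^ 2 * (C / n) ^ 2 := by ring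
        _ ≤ _ := mul_le_mul_of_nonneg_left this (sq_nonneg _)
    linarith
  have a3 : w ^ 2 ≤ stat q.1 q.2 := by
    rw [stat, le_div_iff₀ h1, ← sq_abs (q.1 - q.2), hw]
    have : q.2 * (1 - q.2) ≤ 1 := by nlinarith
    nlinarith [sq_nonneg w]
  linarith

theorem mem_band_of_isMaxOn {C c w : ℝ} {n : ℕ} (hC : 0 < C) (hn : 0 < n) (hc : 0 < c)
    {A : Set (ℝ × ℝ)} (hA : A ⊆ supportSquare C n)
    (hg : IsGreatest ((fun p : ℝ × ℝ => |p.1 - p.2|) '' A) w) {p : ℝ × ℝ} (hp : p ∈ A)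
    (hm : IsMaxOn (gaussian c) A p) : p ∈ deviationBand C n w := by
  refine ⟨hA hp, ?_, hg.2 ⟨p, hp, rfl⟩⟩
  by_contra hlt
  obtain ⟨q, hq, hqw⟩ := hg.1
  have h1 := stat_le_of_small hC hn (hA hp) (hA hq) hqw (not_le.1 hlt)
  have h2 : gaussian c q ≤ gaussian c p := hm hq
  rw [gaussian_eq, gaussian_eq] at h2
  exact absurd (le_of_mul_le_mul_left h2 hc) (not_le.2 h1)

/-- The logarithm of the range of slopes is at most this multiple of `log n`. -/
noncomputable def rangeConst (C : ℝ) : ℝ := |Real.log (3 / C ^ 2)| / Real.log 2 + 2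

theorem rangeConst_nonneg (C : ℝ) : 0 ≤ rangeConst C := by
  have := Real.log_pos (by norm_num : (1 : ℝ) < 2)
  unfold rangeConst
  positivity

theorem log_two_le_log {n : ℕ} (hn : 2 ≤ n) : Real.log 2 ≤ Real.log n :=
  Real.log_le_log (by norm_num) (by exact_mod_cast hn)

theorem half_le_log_two : (1 : ℝ) / 2 ≤ Real.log 2 := by
  have := Real.log_two_gt_d9
  linarith

/-- Taking logarithms: the range of slopes has ratio 3n²/C², and log(1 + 1/N) ≥ 1/(N+1) ≥ 1/(2N).
The constant |log(3/C²)| is absorbed into a multiple of log n by means of n ≥ 2. -/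
theorem scale_le {C w : ℝ} {n N k : ℕ} (hC : 0 < C) (hn : 2 ≤ n) (hw : 0 < w) (hN : 0 < N)
    (hk : w * C / n * (1 + 1 / (N : ℝ)) ^ k < 3 * w * n / C) :
    (k : ℝ) ≤ 2 * N * (rangeConst C * Real.log n) := by
  have hn' : (0 : ℝ) < n := by exact_mod_cast (by omega : 0 < n)
  have hN' : (1 : ℝ) ≤ N := by exact_mod_cast hN
  have hl2 := Real.log_pos (by norm_num : (1 : ℝ) < 2)
  have hln := log_two_le_log hn
  have hq : (0 : ℝ) < 1 + 1 / (N : ℝ) := by positivity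
  have h1 : (1 + 1 / (N : ℝ)) ^ k < 3 / C ^ 2 * (n : ℝ) ^ 2 := by
    have h2 : w * C / n * (1 + 1 / (N : ℝ)) ^ k < w * C / n * (3 / C ^ 2 * (n : ℝ) ^ 2) := by
      refine hk.trans_eq ?_
      field_simp
    exact lt_of_mul_lt_mul_left h2 (by positivity)
  have h3 := Real.log_lt_log (by positivity) h1
  rw [Real.log_pow, Real.log_mul (by positivity) (by positivity), Real.log_pow] at h3
  have h4 : 1 / (2 * (N : ℝ)) ≤ Real.log (1 + 1 / (N : ℝ)) := by
    refine le_trans ?_ (Real.one_sub_inv_le_log_of_pos hq)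
    have e : 1 - (1 + 1 / (N : ℝ))⁻¹ = 1 / (N + 1) := by field_simp; ring
    rw [e]
    exact one_div_le_one_div_of_le (by linarith) (by linarith)
  have h5 : Real.log (3 / C ^ 2) + (2 : ℕ) * Real.log n ≤ rangeConst C * Real.log n := by
    unfold rangeConst
    have h6 : Real.log (3 / C ^ 2) ≤ |Real.log (3 / C ^ 2)| / Real.log 2 * Real.log n := by
      refine (le_abs_self _).trans ?_
      rw [div_mul_eq_mul_div, le_div_iff₀ hl2]
      exact mul_le_mul_of_nonneg_left hln (abs_nonneg _)
    push_cast
    linarith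
  have h7 : (k : ℝ) * (1 / (2 * (N : ℝ))) ≤ rangeConst C * Real.log n :=
    (mul_le_mul_of_nonneg_left h4 (Nat.cast_nonneg k)).trans (h3.le.trans h5)
  rw [mul_one_div, div_le_iff₀ (by positivity)] at h7
  linarith

/-- A grid size of the right order. -/
theorem exists_gridSize {ε : ℝ} (hε : 0 < ε) (hε1 : ε ≤ 1) :
    ∃ N : ℕ, 0 < N ∧ 74 ≤ (N : ℝ) * N * ε ∧ (N : ℝ) ^ 2 ≤ 296 * (1 / ε) ∧
      ∀ m < N, (m : ℝ) * m * ε < 74 := by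
  classical
  have hex : ∃ N : ℕ, 74 ≤ (N : ℝ) * N * ε := by
    obtain ⟨N, hN⟩ := exists_nat_ge (74 / ε)
    refine ⟨N + 1, ?_⟩
    rw [div_le_iff₀ hε] at hN
    push_cast
    have : (0 : ℝ) ≤ N := Nat.cast_nonneg N
    nlinarith [mul_nonneg this hε.le, mul_nonneg (mul_nonneg this this) hε.le]
  have hs := Nat.find_spec hex
  have hm : ∀ m < Nat.find hex, (m : ℝ) * m * ε < 74 := fun m hm => not_le.1 (Nat.find_min hex hm)
  set N := Nat.find hex
  have hN2 : 2 ≤ N := by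
    by_contra h
    have hN1 : (N : ℝ) ≤ 1 := by exact_mod_cast (by omega : N ≤ 1)
    have hN0 : (0 : ℝ) ≤ N := Nat.cast_nonneg N
    have : (N : ℝ) * N ≤ 1 := by nlinarith
    nlinarith
  refine ⟨N, by omega, hs, ?_, hm⟩
  -- Minimality gives (N-1)²ε < 74, and N ≤ 2(N-1) then gives N² ≤ 4·74/ε = 296/ε.
  have h1 := hm (N - 1) (by omega)
  rw [Nat.cast_sub (by omega)] at h1
  have h2 : (2 : ℝ) ≤ N := by exact_mod_cast hN2
  rw [mul_one_div, le_div_iff₀ hε]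
  push_cast at h1
  have : (N : ℝ) ^ 2 ≤ 4 * ((N - 1) * (N - 1)) := by nlinarith
  nlinarith

/-- Number of members of the family, in terms of the accuracy and the number of points. -/
theorem family_count {C ε : ℝ} {n N J : ℕ} (hn : 2 ≤ n) (hN : 0 < N)
    (hN2 : (N : ℝ) ^ 2 ≤ 296 * (1 / ε))
    (hJ : (J : ℝ) ≤ 2 * N * (rangeConst C * Real.log n)) :
    (2 * (N + 1) * (J + 1) : ℝ) ≤ 1184 * (2 * rangeConst C + 2) * (1 / ε * Real.log n) := by
  have hN' : (1 : ℝ) ≤ N := by exact_mod_cast hN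
  have hln : 1 / 2 ≤ Real.log n := half_le_log_two.trans (log_two_le_log hn)
  have hR := rangeConst_nonneg C
  have h1 : (J + 1 : ℝ) ≤ N * ((2 * rangeConst C + 2) * Real.log n) := by nlinarith
  have h0 : (0 : ℝ) ≤ J + 1 := by positivity
  have hp : 0 ≤ (2 * rangeConst C + 2) * Real.log n :=
    mul_nonneg (by linarith) (by linarith)
  calc (2 * (N + 1) * (J + 1) : ℝ) ≤ 4 * N * (N * ((2 * rangeConst C + 2) * Real.log n)) :=
        mul_le_mul (by linarith) h1 h0 (by positivity)
    _ = 4 * (N : ℝ) ^ 2 * ((2 * rangeConst C + 2) * Real.log n) := by ring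
    _ ≤ 4 * (296 * (1 / ε)) * ((2 * rangeConst C + 2) * Real.log n) :=
        mul_le_mul_of_nonneg_right (by linarith) hp
    _ = _ := by ring

/-- Coefficients of `c` times a member of the family. -/
noncomputable def famCoef (c t z : ℝ) : ℝ × ℝ × ℝ :=
  (c * (2 * t), c * (-(2 * t) - t ^ 2 * (1 - 2 * z)), c * (-(t ^ 2 * z ^ 2)))

theorem linear_famCoef (c t z : ℝ) (p : ℝ × ℝ) :
    linear (famCoef c t z) p = c * fam t z p.1 p.2 := by
  simp only [linear, famCoef, fam]
  ring

/-- Relative approximate families of the required size exist at every scale. -/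
theorem exists_relativeFamily {C ε c w : ℝ} {n : ℕ} (hC : 0 < C) (hn : 2 ≤ n) (hε : 0 < ε)
    (hε1 : ε ≤ 1) (hc : 0 < c) (hw : 0 < w) :
    ∃ L : Finset (ℝ × ℝ × ℝ),
      (L.card : ℝ) ≤ 1184 * (2 * rangeConst C + 2) * (1 / ε * Real.log n) ∧
      (∀ a ∈ L, ∀ p ∈ supportSquare C n, linear a p ≤ gaussian c p) ∧
      IsRelativeFamily ε (gaussian c) (deviationBand C n w) L := by
  classical
  obtain ⟨N, hN, hNε, hN2, -⟩ := exists_gridSize hε hε1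
  have hn0 : 0 < n := by omega
  have hn' : (0 : ℝ) < n := by exact_mod_cast hn0
  have hx0 : 0 ≤ 2 * N * (rangeConst C * Real.log n) :=
    mul_nonneg (by positivity) (mul_nonneg (rangeConst_nonneg C)
      ((Real.log_pos (by norm_num)).le.trans (log_two_le_log hn)))
  set J := ⌊2 * N * (rangeConst C * Real.log n)⌋₊ with hJdef
  have hJ : (J : ℝ) ≤ 2 * N * (rangeConst C * Real.log n) := Nat.floor_le hx0
  let F : Bool × ℕ × ℕ → ℝ × ℝ × ℝ := fun v =>
    famCoef c ((if v.1 then 1 else -1) * (w * C / n * (1 + 1 / (N : ℝ)) ^ v.2.2)) (gridPt N v.2.1)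
  let L : Finset (ℝ × ℝ × ℝ) :=
    (Finset.univ ×ˢ (Finset.range (N + 1) ×ˢ Finset.range (J + 1))).image F
  have hlow : ∀ a ∈ L, ∀ p ∈ supportSquare C n, linear a p ≤ gaussian c p := by
    intro a ha p hp
    obtain ⟨v, -, rfl⟩ := Finset.mem_image.1 ha
    obtain ⟨hy, hy1, -, -⟩ := supportSquare_bounds hC hn0 hp
    rw [linear_famCoef, gaussian_eq]
    exact mul_le_mul_of_nonneg_left (fam_le_stat hy hy1 _ _) hc.le
  refine ⟨L, ?_, hlow, ?_⟩
  · refine le_trans ?_ (family_count (C := C) hn hN hN2 hJ)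
    have h1 : L.card ≤ 2 * ((N + 1) * (J + 1)) := by
      refine Finset.card_image_le.trans_eq ?_
      simp
    calc (L.card : ℝ) ≤ ((2 * ((N + 1) * (J + 1)) : ℕ) : ℝ) := by exact_mod_cast h1
      _ = _ := by push_cast; ring
  · have hL : L.Nonempty :=
      ⟨F (true, 0, 0), Finset.mem_image_of_mem _ (by simp)⟩
    refine ⟨hL, fun p hp => ⟨?_, ?_⟩⟩
    · exact Finset.sup'_le _ _ fun a ha => hlow a ha p hp.1
    · obtain ⟨hy, hy1, -, -⟩ := supportSquare_bounds hC hn0 hp.1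
      obtain ⟨h1, h2⟩ := abs_slope_bounds hC hn0 hp hw
      obtain ⟨k, j, hj, hk, σ, hσ, happ⟩ :=
        exists_fam_approx hε hε1 hNε hy hy1 (by positivity : 0 < w * C / n) h1
      -- The selected slope does not exceed that of the point, hence lies in the range that
      -- `scale_le` counts.
      have hkJ : k ≤ J := Nat.le_floor (scale_le hC hn hw hN (hk.trans_lt h2))
      have hmem : famCoef c (σ * (w * C / n * (1 + 1 / (N : ℝ)) ^ k)) (gridPt N j) ∈ L := by
        rcases hσ with rfl | rfl
        · exact Finset.mem_image.2 ⟨(true, j, k), by simp; omega, by simp [F]⟩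
        · exact Finset.mem_image.2 ⟨(false, j, k), by simp; omega, by simp [F]⟩
      have h3 := Finset.le_sup' (fun a => linear a p) hmem
      rw [linear_famCoef] at h3
      rw [gaussian_eq]
      calc c * stat p.1 p.2
          ≤ c * ((1 + ε) * fam (σ * (w * C / n * (1 + 1 / (N : ℝ)) ^ k)) (gridPt N j) p.1 p.2) :=
            mul_le_mul_of_nonneg_left happ hc.le
        _ = (1 + ε) * (c * fam (σ * (w * C / n * (1 + 1 / (N : ℝ)) ^ k)) (gridPt N j) p.1 p.2) := by
            ring
        _ ≤ _ := mul_le_mul_of_nonneg_left h3 (by linarith)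

end ScanStat

/-! ## Sorting, normalisation and ranks -/

namespace ScanStat

open RealRAM Finset

/-- Count the `j < n` (register 23) that pass the test, in register 22. -/
def countC (b : BExp) : Cmd :=
  .iset 22 (.const 0) ;; forC 23 (.reg 0) (.ite b (.iset 22 (.add (.reg 22) (.const 1))) .skip)

open Classical in
/-- Number of `j < n` with the property `c`. -/
noncomputable def cnt (n : ℕ) (c : ℕ → Prop) : ℕ := #{j ∈ range n | c j}

theorem cnt_succ (n : ℕ) (c : ℕ → Prop) [Decidable (c n)] :
    cnt (n + 1) c = if c n then cnt n c + 1 else cnt n c := by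
  classical
  unfold cnt
  rw [range_add_one, filter_insert]
  split_ifs <;> simp

theorem countC_spec {b : BExp} {s : State} {n : ℕ} {c : ℕ → Prop} (hn : s.ireg 0 = n)
    (hb : ∀ s₁, Same (countC b) s s₁ → (b.Holds s₁ ↔ c (s₁.ireg 23))) :
    Runs (countC b) s (n * (b.cost + 13) + 8) fun s' => s'.ireg 22 = cnt n c := by
  classical
  unfold countC
  refine Runs.le (Runs.seq_iset (Runs.forC (m := n) (T := b.cost + 5)
    (fun k s' => s'.ireg 22 = cnt k c) rfl (fun s₁ hs₁ => by simpa [hn] using hs₁.i 0 rfl)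
    (by simp [cnt]) (fun k s₁ hk hs₁ hi h₁ => ?_) (fun _ _ _ h => h))) ?_
  · have hs : Same (countC b) s s₁ := by
      have h0 : Same (countC b) s (s.setI 22 0) := (Same.refl _ s).setI_of (by simp [countC, Cmd.wI])
      exact h0.trans (hs₁.weaken (by simp +contextual [countC, Cmd.wI])
        (by simp +contextual [countC, Cmd.wR]) (by simp +contextual [countC, Cmd.wIA])
        (by simp +contextual [countC, Cmd.wRA]))
    have hb' := hb s₁ hs
    rw [hi] at hb'
    refine Runs.le (Runs.ite (fun h => Runs.iset ?_) (fun h => Runs.skip ?_)) (by simp)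
    · simp [cnt_succ, hb'.1 h, h₁]
    · have hc : ¬ c k := fun h' => h (hb'.2 h')
      simp [cnt_succ, hc, h₁]
  · simp only [IExp.cost]
    ring_nf
    omega

/-- Position of point `i` in the order by ordinate, ties broken by index. -/
noncomputable def posY (n : ℕ) (y : ℕ → ℝ) (i : ℕ) : ℕ :=
  cnt n fun j => y j < y i ∨ y j = y i ∧ j < i

/-- Number of points to the left of point `i`. -/
noncomputable def rankX (n : ℕ) (x : ℕ → ℝ) (i : ℕ) : ℕ := cnt n fun j => x j < x i

theorem cnt_lt_cnt {n k : ℕ} {c d : ℕ → Prop} (h : ∀ j < n, c j → d j) (hk : k < n) (hc : ¬ c k)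
    (hd : d k) : cnt n c < cnt n d := by
  classical
  unfold cnt
  refine card_lt_card ((ssubset_iff_of_subset fun j hj => ?_).2 ⟨k, by simp [hk, hd], by simp [hc]⟩)
  simp only [mem_filter, mem_range] at hj ⊢
  exact ⟨hj.1, h j hj.1 hj.2⟩

theorem cnt_lt {n k : ℕ} {c : ℕ → Prop} (hk : k < n) (hc : ¬ c k) : cnt n c < n := by
  have h := cnt_lt_cnt (c := c) (d := fun _ => True) (fun _ _ _ => trivial) hk hc trivial
  simpa [cnt] using h

theorem posY_lt {n i : ℕ} (y : ℕ → ℝ) (hi : i < n) : posY n y i < n := cnt_lt hi (by simp)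

theorem posY_lt_posY {n i j : ℕ} {y : ℕ → ℝ} (hi : i < n)
    (h : y i < y j ∨ y i = y j ∧ i < j) : posY n y i < posY n y j := by
  refine cnt_lt_cnt (fun k _ hk => ?_) hi (by simp) h
  rcases h with h | ⟨h, h'⟩ <;> rcases hk with hk | ⟨hk, hk'⟩
  · exact Or.inl (hk.trans h)
  · exact Or.inl (hk ▸ h)
  · exact Or.inl (h ▸ hk)
  · exact Or.inr ⟨hk.trans h, hk'.trans h'⟩

theorem posY_inj {n i j : ℕ} {y : ℕ → ℝ} (hi : i < n) (hj : j < n)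
    (h : posY n y i = posY n y j) : i = j := by
  rcases lt_trichotomy (y i) (y j) with h1 | h1 | h1
  · exact absurd h (posY_lt_posY hi (Or.inl h1)).ne
  · rcases lt_trichotomy i j with h2 | h2 | h2
    · exact absurd h (posY_lt_posY hi (Or.inr ⟨h1, h2⟩)).ne
    · exact h2
    · exact absurd h (posY_lt_posY hj (Or.inr ⟨h1.symm, h2⟩)).ne'
  · exact absurd h (posY_lt_posY hj (Or.inl h1)).ne'

theorem posY_surj {n j : ℕ} (y : ℕ → ℝ) (hj : j < n) : ∃ i < n, posY n y i = j := by
  have h := Finset.surj_on_of_inj_on_of_card_le (s := range n) (t := range n)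
    (fun i _ => posY n y i) (fun i hi => by simpa using posY_lt y (by simpa using hi))
    (fun i j hi hj h => posY_inj (by simpa using hi) (by simpa using hj) h) le_rfl j (by simpa)
  obtain ⟨i, hi, h⟩ := h
  exact ⟨i, by simpa using hi, h.symm⟩

/-- Since ties are broken by index, `posY` permutes the indices; sums over the sorted arrays are
sums over the input. -/
theorem sum_posY {n : ℕ} (y : ℕ → ℝ) (g : ℕ → ℝ) :
    ∑ i ∈ range n, g (posY n y i) = ∑ j ∈ range n, g j :=
  Finset.sum_nbij (posY n y) (fun i hi => by simpa using posY_lt y (by simpa using hi))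
    (fun i hi j hj h => posY_inj (by simpa using hi) (by simpa using hj) h)
    (fun j hj => by
      obtain ⟨i, hi, h⟩ := posY_surj y (by simpa using hj)
      exact ⟨i, by simpa using hi, h⟩) (fun _ _ => rfl)

theorem rankX_lt {n i : ℕ} (x : ℕ → ℝ) (hi : i < n) : rankX n x i < n := cnt_lt hi (by simp)

theorem rankX_le_iff {n i j : ℕ} {x : ℕ → ℝ} (hj : j < n) :
    x i ≤ x j ↔ rankX n x i ≤ rankX n x j := by
  constructor
  · intro h
    classical
    unfold rankX cnt
    exact card_le_card fun k hk => by
      simp only [mem_filter, mem_range] at hk ⊢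
      exact ⟨hk.1, hk.2.trans_le h⟩
  · intro h
    by_contra hlt
    refine absurd h (not_le.2 ?_)
    exact cnt_lt_cnt (fun k _ hk => hk.trans (not_le.1 hlt)) hj (by simp) (not_le.1 hlt)

/-- Totals of the weights, in real registers 20 and 21. -/
def totalsC : Cmd :=
  .rset 20 (.ofNat (.const 0)) ;; .rset 21 (.ofNat (.const 0)) ;;
  forC 21 (.reg 0) (.rset 20 (.add (.reg 20) (.load 2 (.reg 21))) ;;
    .rset 21 (.add (.reg 21) (.load 3 (.reg 21))))

/-- Put point `i` (register 21) at its place. -/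
def placeC : Cmd :=
  countC (.not (.and (.not (.rlt (.load 1 (.reg 23)) (.load 1 (.reg 21))))
    (.not (.and (.not (.rlt (.load 1 (.reg 21)) (.load 1 (.reg 23))))
      (.ilt (.reg 23) (.reg 21)))))) ;;
  .rstore 4 (.reg 22) (.load 0 (.reg 21)) ;; .rstore 5 (.reg 22) (.load 1 (.reg 21)) ;;
  .rstore 6 (.reg 22) (.div (.load 2 (.reg 21)) (.reg 20)) ;;
  .rstore 7 (.reg 22) (.div (.load 3 (.reg 21)) (.reg 21))

/-- Rank of point `i` (register 21) by abscissa. -/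
def xrankC : Cmd :=
  countC (.rlt (.load 4 (.reg 23)) (.load 4 (.reg 21))) ;; .istore 0 (.reg 21) (.reg 22)

/-- Positions and ranks are found by counting, in quadratic time. This is within the budget and
avoids an efficient sorting algorithm. -/
def sortC : Cmd := totalsC ;; forC 21 (.reg 0) placeC ;; forC 21 (.reg 0) xrankC

/-- The arrays hold the sorted and normalised points. -/
structure Sorted (n : ℕ) (x y m b : ℕ → ℝ) (s : State) : Prop where
  X : ∀ i < n, s.rarr 4 (posY n y i) = x i
  Y : ∀ i < n, s.rarr 5 (posY n y i) = y i
  mu : ∀ i < n, s.rarr 6 (posY n y i) = m i / ∑ j ∈ range n, m j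
  be : ∀ i < n, s.rarr 7 (posY n y i) = b i / ∑ j ∈ range n, b j

variable {n : ℕ} {x y m b : ℕ → ℝ} {s : State}

theorem totalsC_spec (hn : s.ireg 0 = n) (h2 : s.rarr 2 = m) (h3 : s.rarr 3 = b) :
    Runs totalsC s (20 * n + 30) fun s' =>
      s'.rreg 20 = ∑ j ∈ range n, m j ∧ s'.rreg 21 = ∑ j ∈ range n, b j := by
  unfold totalsC
  refine Runs.le (Runs.seq_rset (Runs.seq_rset (Runs.forC (m := n) (T := 10) (fun k s' =>
    s'.rreg 20 = ∑ j ∈ range k, m j ∧ s'.rreg 21 = ∑ j ∈ range k, b j) rfl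
    (fun s₁ hs₁ => by simpa [hn] using hs₁.i 0 rfl) (by simp) (fun k s₁ hk hs₁ hi h₁ => ?_)
    (fun _ _ _ h => h)))) ?_
  · have e2 := hs₁.ra 2 rfl
    have e3 := hs₁.ra 3 rfl
    refine (Runs.seq_rset (Runs.rset ?_)).le (by simp)
    simp_all [Finset.sum_range_succ]
  · simp
    omega

/-- Tests have neither disjunction nor equality of reals, so the lexicographic comparison is written
by negations of `<`; its equivalence with the order in `posY` is part of the proof. -/
theorem placeC_spec {k : ℕ} (hn : s.ireg 0 = n) (h0 : s.rarr 0 = x) (h1 : s.rarr 1 = y)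
    (h2 : s.rarr 2 = m) (h3 : s.rarr 3 = b) (h20 : s.rreg 20 = ∑ j ∈ range n, m j)
    (h21 : s.rreg 21 = ∑ j ∈ range n, b j) (hk : s.ireg 21 = k) :
    Runs placeC s (40 * n + 60) fun s' =>
      s'.rarr 4 = Function.update (s.rarr 4) (posY n y k) (x k) ∧
      s'.rarr 5 = Function.update (s.rarr 5) (posY n y k) (y k) ∧
      s'.rarr 6 = Function.update (s.rarr 6) (posY n y k) (m k / ∑ j ∈ range n, m j) ∧
      s'.rarr 7 = Function.update (s.rarr 7) (posY n y k) (b k / ∑ j ∈ range n, b j) := by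
  unfold placeC
  refine Runs.le (Runs.seq (countC_spec (c := fun j => y j < y k ∨ y j = y k ∧ j < k) hn
    fun s₁ hs₁ => ?_) fun s₁ hs₁ h₁ => Runs.seq_rstore (Runs.seq_rstore (Runs.seq_rstore
    (Runs.rstore ?_)))) ?_
  · have e1 := hs₁.ra 1 rfl
    have e2 := hs₁.i 21 rfl
    simp only [BExp.Holds, RExp.eval, IExp.eval, e1, e2, h1, hk]
    generalize s₁.ireg 23 = j
    constructor
    · intro h
      by_contra h'
      push Not at h'
      refine h ⟨not_lt.2 h'.1, fun h'' => ?_⟩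
      exact absurd h''.2 (not_lt.2 (h'.2 (le_antisymm (not_lt.1 h''.1) h'.1)))
    · rintro (h | ⟨h, h'⟩) ⟨g1, g2⟩
      · exact g1 h
      · exact g2 ⟨not_lt.2 h.le, h'⟩
  · have e0 := hs₁.ra 0 rfl
    have e1 := hs₁.ra 1 rfl
    have e2 := hs₁.ra 2 rfl
    have e3 := hs₁.ra 3 rfl
    have e4 := hs₁.ra 4 rfl
    have e5 := hs₁.ra 5 rfl
    have e6 := hs₁.ra 6 rfl
    have e7 := hs₁.ra 7 rfl
    have f1 := hs₁.i 21 rfl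
    have f2 := hs₁.r 20 rfl
    have f3 := hs₁.r 21 rfl
    simp [e0, e1, e2, e3, e4, e5, e6, e7, f1, f2, f3, h0, h1, h2, h3, h20, h21, hk, h₁, posY]
  · simp
    omega

theorem sortC_spec (hn : s.ireg 0 = n) (h0 : s.rarr 0 = x) (h1 : s.rarr 1 = y)
    (h2 : s.rarr 2 = m) (h3 : s.rarr 3 = b) :
    Runs sortC s (80 * n ^ 2 + 140 * n + 60) fun s' =>
      Sorted n x y m b s' ∧ ∀ i < n, s'.iarr 0 i = rankX n (s'.rarr 4) i := by
  unfold sortC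
  refine Runs.le (Runs.seq (totalsC_spec hn h2 h3) fun s₁ hs₁ h₁ => Runs.seq (R := fun s' =>
    Sorted n x y m b s') (Runs.forC (m := n) (T := 40 * n + 60) (fun k s' => ∀ i < k,
      s'.rarr 4 (posY n y i) = x i ∧ s'.rarr 5 (posY n y i) = y i ∧
      s'.rarr 6 (posY n y i) = m i / ∑ j ∈ range n, m j ∧
      s'.rarr 7 (posY n y i) = b i / ∑ j ∈ range n, b j) rfl
    (fun s₂ hs₂ => ?_) (by simp) (fun k s₂ hk hs₂ hi h => ?_) (fun s₂ _ _ h =>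
      ⟨fun i hi => (h i hi).1, fun i hi => (h i hi).2.1, fun i hi => (h i hi).2.2.1,
        fun i hi => (h i hi).2.2.2⟩))
    fun s₂ hs₂ h₂ => Runs.forC (m := n) (T := 20 * n + 20) (fun k s' => ∀ i < k,
      s'.iarr 0 i = rankX n (s₂.rarr 4) i) rfl (fun s₃ hs₃ => ?_) (by simp)
      (fun k s₃ hk hs₃ hi h => ?_) (fun s₃ hs₃ _ h => ?_)) ?_
  · rw [IExp.eval, hs₂.i 0 rfl, hs₁.i 0 rfl, hn]
  · refine (placeC_spec (n := n) (x := x) (y := y) (m := m) (b := b) ?_ ?_ ?_ ?_ ?_ ?_ ?_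
      hi).conseq le_rfl ?_
    · rw [hs₂.i 0 rfl, hs₁.i 0 rfl, hn]
    · rw [hs₂.ra 0 rfl, hs₁.ra 0 rfl, h0]
    · rw [hs₂.ra 1 rfl, hs₁.ra 1 rfl, h1]
    · rw [hs₂.ra 2 rfl, hs₁.ra 2 rfl, h2]
    · rw [hs₂.ra 3 rfl, hs₁.ra 3 rfl, h3]
    · rw [hs₂.r 20 rfl, h₁.1]
    · rw [hs₂.r 21 rfl, h₁.2]
    · rintro s₄ - ⟨g4, g5, g6, g7⟩ i hik
      simp only [setI_rarr, g4, g5, g6, g7]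
      rcases Nat.lt_succ_iff_lt_or_eq.1 hik with hik | rfl
      · have : posY n y i ≠ posY n y k := fun e => hik.ne (posY_inj (hik.trans hk) hk e)
        simpa [Function.update_of_ne this] using h i hik
      · simp
  · rw [IExp.eval, hs₃.i 0 rfl, hs₂.i 0 rfl, hs₁.i 0 rfl, hn]
  · have e4 : s₃.rarr 4 = s₂.rarr 4 := hs₃.ra 4 rfl
    unfold xrankC
    refine Runs.le (Runs.seq (countC_spec (n := n) (c := fun j => s₂.rarr 4 j < s₂.rarr 4 k) ?_
      fun s₄ hs₄ => ?_) fun s₄ hs₄ h₄ => Runs.istore ?_) ?_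
    · rw [hs₃.i 0 rfl, hs₂.i 0 rfl, hs₁.i 0 rfl, hn]
    · simp [hs₄.ra 4 rfl, hs₄.i 21 rfl, hi, e4]
    · intro i hik
      have e21 := hs₄.i 21 rfl
      have e0 := hs₄.ia 0 rfl
      rcases Nat.lt_succ_iff_lt_or_eq.1 hik with hik | rfl
      · simpa [e21, hi, e0, Function.update_of_ne hik.ne] using h i hik
      · simp [e21, hi, h₄, rankX]
    · simp
      omega
  · have e4 : s₃.rarr 4 = s₂.rarr 4 := hs₃.ra 4 rfl
    refine ⟨⟨?_, ?_, ?_, ?_⟩, by rwa [e4]⟩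
    · rw [e4]; exact h₂.X
    · rw [hs₃.ra 5 rfl]; exact h₂.Y
    · rw [hs₃.ra 6 rfl]; exact h₂.mu
    · rw [hs₃.ra 7 rfl]; exact h₂.be
  · simp
    ring_nf
    omega

end ScanStat

/-! ## Preprocessing -/

namespace ScanStat

open RealRAM Finset

/-- The least power of two that is at least `n`, in register 1. -/
def powC : Cmd :=
  .iset 1 (.const 1) ;; .loop (.ilt (.reg 1) (.reg 0)) (.iset 1 (.add (.reg 1) (.reg 1)))

/-- Parents in a binary tree, in array 2. -/
def parC : Cmd :=
  forC 21 (.reg 1) (.istore 2 (.add (.reg 21) (.reg 21)) (.reg 21) ;;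
    .istore 2 (.add (.add (.reg 21) (.reg 21)) (.const 1)) (.reg 21))

/-- Size of the grid for the accuracy in real register 5, in register 2. -/
def gridC : Cmd :=
  .iset 2 (.const 0) ;;
  .loop (.rlt (.mul (.mul (.ofNat (.reg 2)) (.ofNat (.reg 2))) (.reg 5)) (.ofNat (.const 74)))
    (.iset 2 (.add (.reg 2) (.const 1)))

def prepC : Cmd :=
  sortC ;; .rset 5 (.reg 0) ;; .rset 6 (.reg 1) ;; .rset 7 (.reg 2) ;;
  .rset 8 (.div (.reg 6) (.ofNat (.reg 0))) ;; .rset 9 (.sub (.ofNat (.const 1)) (.reg 8)) ;;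
  .rset 4 (.sub (.ofNat (.const 0)) (.ofNat (.const 1))) ;; powC ;; parC ;; gridC

variable {n : ℕ} {s : State}

/-- Each doubling increases the power by at least one, so `n` iterations are enough; this crude
linear bound suffices. -/
theorem powC_spec (hn : s.ireg 0 = n) (hn0 : 0 < n) :
    Runs powC s (8 * n + 10) fun s' => ∃ h, s'.ireg 1 = 2 ^ h ∧ n ≤ 2 ^ h ∧ 2 ^ h < 2 * n := by
  have key := Runs.loop (b := .ilt (.reg 1) (.reg 0)) (p := .iset 1 (.add (.reg 1) (.reg 1)))
    (T := 4) (fun k s' => s'.ireg 0 = n ∧ ∃ h, s'.ireg 1 = 2 ^ h ∧ 2 ^ h < 2 * n ∧ n ≤ 2 ^ h + k)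
    (fun k s' hk hb => ?_) n (s.setI 1 1)
    ⟨by simp [hn], 0, by simp, by simp; omega, by simp⟩
  · unfold powC
    refine Runs.le (Runs.seq_iset (e := .const 1) (key.conseq le_rfl ?_)) (by simp; omega)
    rintro s' - ⟨hb, k, h0, h, h1, h2, -⟩
    simp [h0, h1] at hb
    exact ⟨h, h1, hb, h2⟩
  · obtain ⟨h0, h, h1, h2, h3⟩ := hk
    simp [h0, h1] at hb
    refine ⟨by omega, Runs.iset ⟨by simp [h0], h + 1, ?_, ?_, ?_⟩⟩
    · simp [h1, pow_succ]; ring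
    · rw [pow_succ]; omega
    · have := Nat.one_le_two_pow (n := h)
      rw [pow_succ]; omega

theorem parC_spec {Z : ℕ} (hZ : s.ireg 1 = Z) :
    Runs parC s (30 * Z + 10) fun s' => ∀ v < Z + Z, s'.iarr 2 v = v / 2 := by
  unfold parC
  refine Runs.le (Runs.forC (m := Z) (T := 12) (fun k s' => ∀ v < k + k, s'.iarr 2 v = v / 2) rfl
    (fun s₁ hs₁ => by simpa [hZ] using hs₁.i 1 rfl) (by simp) (fun k s₁ hk hs₁ hi h₁ => ?_)
    (fun _ _ _ h => h)) (by simp; omega)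
  refine (Runs.seq_istore (Runs.istore ?_)).le (by simp)
  intro v hv
  simp [hi, Function.update_apply]
  split_ifs with e1 e2
  · omega
  · omega
  · exact h₁ v (by omega)

/-- The machine cannot round a real to a natural number, so the grid size is found by counting
upwards. The minimality of `N` identifies the exit of the loop. -/
theorem gridC_spec {N : ℕ} {ε : ℝ} (h5 : s.rreg 5 = ε) (hN : 74 ≤ (N : ℝ) * N * ε)
    (hN' : ∀ m < N, (m : ℝ) * m * ε < 74) :
    Runs gridC s (16 * N + 20) fun s' => s'.ireg 2 = N := by
  have key := Runs.loop
    (b := .rlt (.mul (.mul (.ofNat (.reg 2)) (.ofNat (.reg 2))) (.reg 5)) (.ofNat (.const 74)))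
    (p := .iset 2 (.add (.reg 2) (.const 1))) (T := 4)
    (fun k s' => s'.rreg 5 = ε ∧ s'.ireg 2 + k = N) (fun k s' hk hb => ?_) N (s.setI 2 0)
    ⟨by simp [h5], by simp⟩
  · unfold gridC
    refine Runs.le (Runs.seq_iset (e := .const 0) (key.conseq le_rfl ?_)) (by simp; omega)
    rintro s' - ⟨hb, k, h0, h1⟩
    simp [h0] at hb
    by_contra hne
    exact absurd (hN' (s'.ireg 2) (by omega)) (not_lt.2 hb)
  · obtain ⟨h0, h1⟩ := hk
    simp [h0] at hb
    have : s'.ireg 2 ≠ N := by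
      rintro rfl
      exact absurd hb (not_lt.2 hN)
    refine ⟨by omega, Runs.iset ⟨by simp [h0], ?_⟩⟩
    simp
    omega

/-- The memory after preprocessing. -/
structure Ready (n N h : ℕ) (x y m b : ℕ → ℝ) (ε C c : ℝ) (s : State) : Prop where
  sorted : Sorted n x y m b s
  rank : ∀ i < n, s.iarr 0 i = rankX n (s.rarr 4) i
  i0 : s.ireg 0 = n
  Z : s.ireg 1 = 2 ^ h
  par : ∀ v < 2 ^ h + 2 ^ h, s.iarr 2 v = v / 2
  i2 : s.ireg 2 = N
  r4 : s.rreg 4 = -1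
  r5 : s.rreg 5 = ε
  r6 : s.rreg 6 = C
  r7 : s.rreg 7 = c
  r8 : s.rreg 8 = C / n
  r9 : s.rreg 9 = 1 - C / n

theorem prepC_spec {N : ℕ} {x y m b : ℕ → ℝ} {ε C c : ℝ} (hn : s.ireg 0 = n) (hn0 : 0 < n)
    (h0 : s.rarr 0 = x) (h1 : s.rarr 1 = y) (h2 : s.rarr 2 = m) (h3 : s.rarr 3 = b)
    (hε : s.rreg 0 = ε) (hC : s.rreg 1 = C) (hc : s.rreg 2 = c) (hN : 74 ≤ (N : ℝ) * N * ε)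
    (hN' : ∀ m < N, (m : ℝ) * m * ε < 74) :
    Runs prepC s (80 * n ^ 2 + 220 * n + 16 * N + 200) fun s' =>
      ∃ h, n ≤ 2 ^ h ∧ 2 ^ h < 2 * n ∧ Ready n N h x y m b ε C c s' := by
  unfold prepC
  refine Runs.le (Runs.seq (sortC_spec hn h0 h1 h2 h3) fun s₁ hs₁ h₁ => Runs.seq_rset
    (Runs.seq_rset (Runs.seq_rset (Runs.seq_rset (Runs.seq_rset (Runs.seq_rset (Runs.seq
    (powC_spec (n := n) ?_ hn0) (T₂ := 60 * n + 16 * N + 30) fun s₂ hs₂ h₂ => ?_))))))) ?_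
  · simpa [hs₁.i 0 rfl] using hn
  · obtain ⟨h, hZ, hh, hh'⟩ := h₂
    refine Runs.le (Runs.seq (parC_spec hZ) fun s₃ hs₃ h₃ => (gridC_spec (ε := ε) ?_ hN hN').conseq
      le_rfl fun s₄ hs₄ h₄ => ⟨h, hh, hh', ?_⟩) (by omega)
    · rw [hs₃.r 5 rfl, hs₂.r 5 rfl]; simp [hs₁.r 0 rfl, hε]
    · have i0 : s₄.ireg 0 = n := by
        rw [hs₄.i 0 rfl, hs₃.i 0 rfl, hs₂.i 0 rfl]; simp [hs₁.i 0 rfl, hn]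
      have a0 : s₄.iarr 0 = s₁.iarr 0 := by
        rw [hs₄.ia 0 rfl, hs₃.ia 0 rfl, hs₂.ia 0 rfl]; simp
      have a4 : s₄.rarr 4 = s₁.rarr 4 := by
        rw [hs₄.ra 4 rfl, hs₃.ra 4 rfl, hs₂.ra 4 rfl]; simp
      have a5 : s₄.rarr 5 = s₁.rarr 5 := by
        rw [hs₄.ra 5 rfl, hs₃.ra 5 rfl, hs₂.ra 5 rfl]; simp
      have a6 : s₄.rarr 6 = s₁.rarr 6 := by
        rw [hs₄.ra 6 rfl, hs₃.ra 6 rfl, hs₂.ra 6 rfl]; simp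
      have a7 : s₄.rarr 7 = s₁.rarr 7 := by
        rw [hs₄.ra 7 rfl, hs₃.ra 7 rfl, hs₂.ra 7 rfl]; simp
      have r0 := hs₁.r 0 rfl
      have r1 := hs₁.r 1 rfl
      have r2 := hs₁.r 2 rfl
      have e0 := hs₁.i 0 rfl
      refine ⟨⟨?_, ?_, ?_, ?_⟩, ?_, i0, ?_, ?_, h₄, ?_, ?_, ?_, ?_, ?_, ?_⟩
      · rw [a4]; exact h₁.1.X
      · rw [a5]; exact h₁.1.Y
      · rw [a6]; exact h₁.1.mu
      · rw [a7]; exact h₁.1.be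
      · rw [a0, a4]; exact h₁.2
      · rw [hs₄.i 1 rfl, hs₃.i 1 rfl, hZ]
      · rw [hs₄.ia 2 rfl]; exact h₃
      · rw [hs₄.r 4 rfl, hs₃.r 4 rfl, hs₂.r 4 rfl]; simp
      · rw [hs₄.r 5 rfl, hs₃.r 5 rfl, hs₂.r 5 rfl]; simp [r0, hε]
      · rw [hs₄.r 6 rfl, hs₃.r 6 rfl, hs₂.r 6 rfl]; simp [r1, hC]
      · rw [hs₄.r 7 rfl, hs₃.r 7 rfl, hs₂.r 7 rfl]; simp [r2, hc]
      · rw [hs₄.r 8 rfl, hs₃.r 8 rfl, hs₂.r 8 rfl]; simp [r1, hC, e0, hn]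
      · rw [hs₄.r 9 rfl, hs₃.r 9 rfl, hs₂.r 9 rfl]; simp [r1, hC, e0, hn]
  · simp
    omega

end ScanStat

/-! ## The search over all scales -/

namespace ScanStat

open RealRAM Finset

/-- Exhaustive search of the strips that miss few points. -/
def extremesC (k0 : ℕ) : Cmd :=
  forC 60 (.const k0) (forC 61 (.const k0)
    (.ite (.and (.ilt (.reg 60) (.reg 0)) (.ilt (.reg 61) (.reg 0)))
      (.iset 6 (.reg 60) ;; .iset 7 (.sub (.sub (.reg 0) (.const 1)) (.reg 61)) ;; brute) .skip))

/-- Optimise the linear function with the given coefficients. -/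
def linC (k0 : ℕ) (e₁ e₂ e₃ : RExp) : Cmd :=
  .rset 10 e₁ ;; .rset 11 e₂ ;; .rset 12 e₃ ;; roundC k0

/-- The largest deviation, in real register 14. -/
def scaleC (k0 : ℕ) : Cmd :=
  linC k0 (.ofNat (.const 1)) (.sub (.ofNat (.const 0)) (.ofNat (.const 1))) (.ofNat (.const 0)) ;;
  .rset 14 (.reg 13) ;;
  linC k0 (.sub (.ofNat (.const 0)) (.ofNat (.const 1))) (.ofNat (.const 1)) (.ofNat (.const 0)) ;;
  .ite (.rlt (.reg 14) (.reg 13)) (.rset 14 (.reg 13)) .skip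

/-- The members of the family with slope parameter in real register `r` and base point in real
register 18. -/
def famC (k0 r : ℕ) : Cmd :=
  linC k0 (.mul (.ofNat (.const 2)) (.reg r))
    (.sub (.sub (.ofNat (.const 0)) (.mul (.ofNat (.const 2)) (.reg r)))
      (.mul (.mul (.reg r) (.reg r))
        (.sub (.ofNat (.const 1)) (.mul (.ofNat (.const 2)) (.reg 18)))))
    (.sub (.ofNat (.const 0)) (.mul (.mul (.reg r) (.reg r)) (.mul (.reg 18) (.reg 18))))

/-- The members of the family with slope parameters `t` and `-t` for all base points. -/
def slopeC (k0 : ℕ) : Cmd :=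
  .rset 19 (.sub (.ofNat (.const 0)) (.reg 15)) ;;
  forC 62 (.add (.reg 2) (.const 1))
    (.rset 18 (.div (.mul (.ofNat (.reg 62)) (.ofNat (.reg 62)))
        (.add (.mul (.ofNat (.reg 62)) (.ofNat (.reg 62)))
          (.mul (.ofNat (.sub (.reg 2) (.reg 62))) (.ofNat (.sub (.reg 2) (.reg 62)))))) ;;
      famC k0 15 ;; famC k0 19)

/-- All members of the family at the scale in real register 14. -/
def familyC (k0 : ℕ) : Cmd :=
  .rset 15 (.div (.mul (.reg 14) (.reg 6)) (.ofNat (.reg 0))) ;;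
  .rset 16 (.div (.mul (.mul (.ofNat (.const 3)) (.reg 14)) (.ofNat (.reg 0))) (.reg 6)) ;;
  .rset 17 (.add (.ofNat (.const 1)) (.div (.ofNat (.const 1)) (.ofNat (.reg 2)))) ;;
  .loop (.rlt (.reg 15) (.reg 16)) (slopeC k0 ;; .rset 15 (.mul (.reg 15) (.reg 17)))

/-- The search. -/
def searchC (k0 : ℕ) : Cmd :=
  extremesC k0 ;; scaleC k0 ;;
  .ite (.rlt (.ofNat (.const 0)) (.reg 14)) (familyC k0) .skip

/-- The points of boxes with sufficient support in strips that miss enough. -/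
def Inner (I : Inst) (xr : ℕ → ℕ) : Set (ℝ × ℝ) :=
  {q | ∃ p < I.n, ∃ k, I.Last k ∧ I.Y p ≤ I.Y k ∧ I.strip I.mu p k ≤ 1 - I.thr ∧
    I.strip I.be p k ≤ 1 - I.thr ∧ ∃ l < I.n, ∃ r < I.n,
    q = (I.rankBox xr I.mu p k l r, I.rankBox xr I.be p k l r) ∧ I.thr ≤ q.1 ∧ I.thr ≤ q.2}

theorem Inner.rankCand {I : Inst} {xr : ℕ → ℕ} {q : ℝ × ℝ} (hq : q ∈ Inner I xr)
    (a₁ a₂ a₃ : ℝ) :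
    ∃ p < I.n, ∃ k, RankCand I xr a₁ a₂ a₃ p k (a₃ + (a₁ * q.1 + a₂ * q.2)) := by
  obtain ⟨p, hp, k, hk, hY, h1, h2, l, hl, r, hr, rfl, h3, h4⟩ := hq
  exact ⟨p, hp, k, hk, hY, h1, h2, l, hl, r, hr, h3, h4, rfl⟩

/-- The memory holds the instance, the tree and the ranks. -/
def Base (I : Inst) (h : ℕ) (xr : ℕ → ℕ) (s : State) : Prop :=
  Aux I h xr (s.rreg 10) (s.rreg 11) (s.rreg 12) s

/-- Number of steps of a round. -/
def roundTime (n h k0 : ℕ) : ℕ :=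
  n * (n * (600 * (k0 + 1) ^ 2 + 50 * h + 260) + 160 * 2 ^ h + 40 * k0 + 80) + 160 * n ^ 2 +
    100 * n + 60

section

variable {I : Inst} {h k0 : ℕ} {xr : ℕ → ℕ} {δ : ℝ} {s : State} {C : ℝ}

theorem Base.of_same {p : Cmd} {s' : State} (hB : Base I h xr s) (hs : Same p s s')
    (hp : (p.wI 0 || p.wRA 4 || p.wRA 5 || p.wRA 6 || p.wRA 7 || p.wR 7 || p.wR 8 || p.wR 9)
      = false) (hp' : (p.wI 1 || p.wIA 0 || p.wIA 2) = false) : Base I h xr s' := by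
  simp only [Bool.or_eq_false_iff] at hp'
  obtain ⟨⟨h1, h2⟩, h3⟩ := hp'
  have hA : Aux I h xr (s.rreg 10) (s.rreg 11) (s.rreg 12) s := hB
  exact ⟨hA.env.of_same hs hp, by rw [hs.i _ h1, hA.Z], by rw [hs.ia _ h3]; exact hA.par,
    by rw [hs.ia _ h2, hA.xr], rfl, rfl, rfl⟩

theorem Base.env (hB : Base I h xr s) : I.Env s := Aux.env hB

theorem Base.setR (hB : Base I h xr s) {r : ℕ} {v : ℝ} (h7 : r ≠ 7) (h8 : r ≠ 8) (h9 : r ≠ 9) :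
    Base I h xr (s.setR r v) := by
  have hA : Aux I h xr (s.rreg 10) (s.rreg 11) (s.rreg 12) s := hB
  exact ⟨⟨hA.env.n, hA.env.X, hA.env.Y, hA.env.mu, hA.env.be, by simp [hA.env.thr, h8.symm],
    by simp [hA.env.thr', h9.symm], by simp [hA.env.cc, h7.symm]⟩, hA.Z, hA.par, hA.xr,
    rfl, rfl, rfl⟩

theorem extremesC_spec (hG : Good I k0 δ xr) (hE : I.Env s) (hR : I.Recorded s) :
    Runs (extremesC k0) s
      (k0 * (k0 * (160 * I.n ^ 2 + 100 * I.n + 60) + 20) + 20) fun s' => I.Improves s s' ∧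
      ∀ c < k0, ∀ e < k0, c < I.n → e < I.n → ∀ l < I.n, ∀ r < I.n, I.X l ≤ I.X r →
        I.Adm l r c (I.n - 1 - e) → I.val l r c (I.n - 1 - e) ≤ s'.rreg 4 := by
  have hmu0 : ∀ i < I.n, 0 ≤ I.mu i := fun i hi => hG.δ_pos.le.trans (hG.mu_ge i hi)
  have hn := hG.pos
  unfold extremesC
  refine Runs.le (Runs.forC (m := k0) (T := k0 * (160 * I.n ^ 2 + 100 * I.n + 60) + 10)
    (fun k s' => I.Improves s s' ∧
      ∀ c < k, ∀ e < k0, c < I.n → e < I.n → ∀ l < I.n, ∀ r < I.n, I.X l ≤ I.X r →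
        I.Adm l r c (I.n - 1 - e) → I.val l r c (I.n - 1 - e) ≤ s'.rreg 4) rfl
    (fun s₁ hs₁ => rfl) ⟨⟨by simpa [Inst.Recorded] using hR, by simp⟩, by simp⟩
    (fun c s₁ hc hs₁ hi h₁ => ?_) (fun _ _ _ h => h)) ?_
  · have hE1 := hE.of_same hs₁ rfl
    refine Runs.le (Runs.forC (m := k0) (T := 160 * I.n ^ 2 + 100 * I.n + 50)
      (fun k s' => I.Improves s₁ s' ∧ ∀ e < k, c < I.n → e < I.n → ∀ l < I.n, ∀ r < I.n,
        I.X l ≤ I.X r → I.Adm l r c (I.n - 1 - e) → I.val l r c (I.n - 1 - e) ≤ s'.rreg 4) rfl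
      (fun s₁ hs₁ => rfl) ⟨⟨by simpa [Inst.Recorded] using h₁.1.recorded, by simp⟩, by simp⟩
      (fun e s₂ he hs₂ hi' h₂ => ?_) (fun s₂ hs₂ _ h₂ => ?_)) ?_
    · have hE2 := hE1.of_same hs₂ rfl
      have hi2 : s₂.ireg 60 = c := by rw [hs₂.i 60 rfl, hi]
      refine Runs.le (Runs.ite (T₂ := 1) (fun hb => Runs.seq_iset (Runs.seq_iset
        ((Inst.brute_spec (I := I) (b := c) (t := I.n - 1 - e) ?_ hG.thr_pos hmu0 ?_ ?_ ?_ ?_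
          ?_).conseq le_rfl fun s₃ _ h₃ => ?_))) (fun hb => Runs.skip ?_)) ?_
      · exact (hE2.setI (by norm_num)).setI (by norm_num)
      · simp [hi2]
      · simp [hE2.n, hi']
      · simpa [hi2, hi', hE2.n] using hb.1
      · omega
      · simpa [Inst.Recorded] using h₂.1.recorded
      · have m3 := h₃.1.mono
        simp only [setI_rreg] at m3
        refine ⟨⟨by simpa [Inst.Recorded] using h₃.1.recorded, by
          simpa using h₂.1.mono.trans m3⟩, fun e' he' hcn hen l hl r hr hX hA => ?_⟩
        rcases Nat.lt_succ_iff_lt_or_eq.1 he' with he' | rfl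
        · simpa using (h₂.2 e' he' hcn hen l hl r hr hX hA).trans m3
        · simpa using h₃.2 l hl r hr hX hA
      · refine ⟨⟨by simpa [Inst.Recorded] using h₂.1.recorded, by simpa using h₂.1.mono⟩,
          fun e' he' hcn hen => ?_⟩
        rcases Nat.lt_succ_iff_lt_or_eq.1 he' with he' | rfl
        · simpa using h₂.2 e' he' hcn hen
        · exact absurd ⟨by simpa [hi2, hE2.n] using hcn, by simpa [hi', hE2.n] using hen⟩ hb
      · simp
        omega
    · refine ⟨⟨by simpa [Inst.Recorded] using h₂.1.recorded, by
          simpa using h₁.1.mono.trans h₂.1.mono⟩, fun c' hc' e he hcn hen l hl r hr hX hA => ?_⟩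
      rcases Nat.lt_succ_iff_lt_or_eq.1 hc' with hc' | rfl
      · simpa using (h₁.2 c' hc' e he hcn hen l hl r hr hX hA).trans h₂.1.mono
      · simpa using h₂.2 e he hcn hen l hl r hr hX hA
    · simp
      ring_nf
      omega
  · simp
    ring_nf
    omega

/-- What a round guarantees. -/
structure LinPost (I : Inst) (C : ℝ) (xr : ℕ → ℕ) (a₁ a₂ a₃ : ℝ) (s s' : State) : Prop where
  improves : I.Improves s s'
  up : ∀ q ∈ Inner I xr, a₃ + (a₁ * q.1 + a₂ * q.2) ≤ s'.rreg 13
  attained : s'.rreg 13 = -1 ∨ ∃ q ∈ supportSquare C I.n,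
    s'.rreg 13 = a₃ + (a₁ * q.1 + a₂ * q.2) ∧ gaussian I.cc q ≤ s'.rreg 4

theorem linC_spec {e₁ e₂ e₃ : RExp} {a₁ a₂ a₃ : ℝ} (hG : Good I k0 δ xr)
    (hthr : I.thr = C / I.n) (hB : Base I h xr s) (hnZ : I.n ≤ 2 ^ h)
    (hR : I.Recorded s) (h₁ : e₁.eval s = a₁) (h₂ : e₂.eval (s.setR 10 a₁) = a₂)
    (h₃ : e₃.eval ((s.setR 10 a₁).setR 11 a₂) = a₃) :
    Runs (linC k0 e₁ e₂ e₃) s (roundTime I.n h k0 + e₁.cost + e₂.cost + e₃.cost + 3) fun s' =>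
      LinPost I C xr a₁ a₂ a₃ s s' := by
  unfold linC
  refine Runs.le (Runs.seq_rset (Runs.seq_rset (Runs.seq_rset
    ((roundC_spec (a₁ := a₁) (a₂ := a₂) (a₃ := a₃) hG ?_ hnZ ?_).conseq le_rfl
      fun s' hs' h' => ?_)))) (by unfold roundTime; omega)
  · have := ((hB.setR (r := 10) (v := a₁) (by norm_num) (by norm_num) (by norm_num)).setR
      (r := 11) (v := a₂) (by norm_num) (by norm_num) (by norm_num)).setR (r := 12) (v := a₃)
      (by norm_num) (by norm_num) (by norm_num)
    simpa [Base, h₁, h₂, h₃] using this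
  · simpa [Inst.Recorded] using hR
  · refine ⟨⟨h'.improves.recorded, by simpa using h'.improves.mono⟩, fun q hq => ?_, ?_⟩
    · obtain ⟨p, hp, k, hk⟩ := Inner.rankCand hq a₁ a₂ a₃
      exact h'.up p hp k _ hk
    · refine h'.attained.imp_right ?_
      rintro ⟨l, r, b, t, hA, hv, -, hval⟩
      refine ⟨I.boxPt l r b t, ?_, hv, hval⟩
      rw [supportSquare, ← hthr]
      exact ⟨hA.1, hA.2⟩

/-- What is known about the largest deviation. -/
structure ScalePost (I : Inst) (C : ℝ) (xr : ℕ → ℕ) (s s' : State) : Prop where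
  improves : I.Improves s s'
  up : ∀ q ∈ Inner I xr, |q.1 - q.2| ≤ s'.rreg 14
  nonneg : ∀ q ∈ Inner I xr, 0 ≤ s'.rreg 4
  attained : 0 < s'.rreg 14 → ∃ q ∈ supportSquare C I.n, |q.1 - q.2| = s'.rreg 14 ∧
    gaussian I.cc q ≤ s'.rreg 4

theorem gaussian_nonneg_of_mem {c : ℝ} {n : ℕ} (hC : 0 < C) (hn : 0 < n) (hc : 0 ≤ c) {q : ℝ × ℝ}
    (hq : q ∈ supportSquare C n) : 0 ≤ gaussian c q := by
  obtain ⟨h1, h2, -, -⟩ := supportSquare_bounds hC hn hq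
  exact Inst.gaussian_nonneg hc h1.le h2.le

theorem Inner.mem (hG : Good I k0 δ xr) (hthr : I.thr = C / I.n) {q : ℝ × ℝ}
    (hq : q ∈ Inner I xr) : q ∈ supportSquare C I.n := by
  obtain ⟨p, hp, k, hk, hY, h1, h2, l, hl, r, hr, rfl, h3, h4⟩ := hq
  rw [supportSquare, ← hthr]
  exact ⟨⟨h3, (Inst.rankBox_le_strip fun i hi => hG.δ_pos.le.trans (hG.mu_ge i hi)).trans h1⟩,
    ⟨h4, (Inst.rankBox_le_strip fun i hi => hG.δ_pos.le.trans (hG.be_ge i hi)).trans h2⟩⟩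

/-- Every deviation exceeds -1, the initial value of a round. Hence a round for x-y or y-x finds a
candidate as soon as `Inner` is nonempty. -/
theorem Inner.abs_lt_one (hG : Good I k0 δ xr) (hC : 0 < C) (hthr : I.thr = C / I.n) {q : ℝ × ℝ}
    (hq : q ∈ Inner I xr) : |q.1 - q.2| < 1 := by
  obtain ⟨⟨h1, h2⟩, h3, h4⟩ := Inner.mem hG hthr hq
  have hd : 0 < C / I.n := div_pos hC (by exact_mod_cast hG.pos)
  rw [abs_lt]
  constructor <;> linarith

/-- The deviation |x-y| is the larger of two linear functions, so two rounds find its maximum. They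
also record the statistic of a box that attains it, which later dominates the boxes of small
deviation. -/
theorem scaleC_spec (hG : Good I k0 δ xr) (hC : 0 < C) (hthr : I.thr = C / I.n)
    (hcc : 0 ≤ I.cc) (hB : Base I h xr s) (hnZ : I.n ≤ 2 ^ h) (hR : I.Recorded s) :
    Runs (scaleC k0) s (2 * roundTime I.n h k0 + 50) fun s' => ScalePost I C xr s s' := by
  unfold scaleC
  refine Runs.le (Runs.seq (linC_spec (a₁ := 1) (a₂ := -1) (a₃ := 0) hG hthr hB hnZ hR
    (by simp) (by simp) (by simp)) fun s₁ hs₁ h₁ => Runs.seq_rset (Runs.seq (linC_spec (I := I)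
    (h := h) (a₁ := -1) (a₂ := 1) (a₃ := 0) hG hthr ?_ hnZ ?_ (by simp) (by simp) (by simp))
    (T₂ := 7) fun s₂ hs₂ h₂ => ?_)) ?_
  · exact (hB.of_same hs₁ rfl rfl).setR (by norm_num) (by norm_num) (by norm_num)
  · simpa [Inst.Recorded] using h₁.improves.recorded
  · have e14 : s₂.rreg 14 = s₁.rreg 13 := by rw [hs₂.r 14 rfl]; simp
    have m2 := h₂.improves.mono
    simp only [setR_rreg, if_neg (by norm_num : (4 : ℕ) ≠ 14)] at m2
    have himp : I.Improves s s₂ := ⟨h₂.improves.recorded, h₁.improves.mono.trans m2⟩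
    have hup : ∀ q ∈ Inner I xr, q.1 - q.2 ≤ s₁.rreg 13 ∧ q.2 - q.1 ≤ s₂.rreg 13 := by
      intro q hq
      have g1 := h₁.up q hq
      have g2 := h₂.up q hq
      constructor <;> linarith
    -- As soon as `Inner` has a member, the first round does not end with -1, so a box was taken
    -- into account and the recorded value is at least its nonnegative statistic.
    have hnn : ∀ q ∈ Inner I xr, 0 ≤ s₂.rreg 4 := by
      intro q hq
      have g1 := (hup q hq).1
      have g2 := abs_lt.1 (Inner.abs_lt_one hG hC hthr hq)
      rcases h₁.attained with h' | ⟨q', hq', -, hv⟩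
      · linarith
      · exact ((gaussian_nonneg_of_mem hC hG.pos hcc hq').trans hv).trans m2
    have at1 : 0 < s₁.rreg 13 → ∃ q ∈ supportSquare C I.n, |q.1 - q.2| = s₁.rreg 13 ∧
        gaussian I.cc q ≤ s₂.rreg 4 := by
      intro hpos
      rcases h₁.attained with h' | ⟨q', hq', hv', hv⟩
      · linarith
      · have e : q'.1 - q'.2 = s₁.rreg 13 := by linarith
        exact ⟨q', hq', by rw [e, abs_of_pos hpos], hv.trans m2⟩
    have at2 : 0 < s₂.rreg 13 → ∃ q ∈ supportSquare C I.n, |q.1 - q.2| = s₂.rreg 13 ∧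
        gaussian I.cc q ≤ s₂.rreg 4 := by
      intro hpos
      rcases h₂.attained with h' | ⟨q', hq', hv', hv⟩
      · linarith
      · have e : q'.2 - q'.1 = s₂.rreg 13 := by linarith
        exact ⟨q', hq', by rw [abs_sub_comm, e, abs_of_pos hpos], hv⟩
    refine Runs.le (Runs.ite (fun hb => Runs.rset ?_) (fun hb => Runs.skip ?_)) (by simp)
    · simp [e14] at hb
      refine ⟨⟨by simpa [Inst.Recorded] using himp.recorded, by simpa using himp.mono⟩, ?_,
        by simpa using hnn, by simpa using at2⟩
      intro q hq
      obtain ⟨g1, g2⟩ := hup q hq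
      simp only [RExp.eval, setR_rreg, if_true]
      exact abs_le.2 ⟨by linarith, by linarith⟩
    · simp [e14] at hb
      refine ⟨himp, ?_, hnn, by rwa [e14]⟩
      intro q hq
      obtain ⟨g1, g2⟩ := hup q hq
      rw [e14]
      exact abs_le.2 ⟨by linarith, by linarith⟩
  · simp
    omega

/-- What optimising a member of the family guarantees. -/
def FamPost (I : Inst) (xr : ℕ → ℕ) (t z : ℝ) (s' : State) : Prop :=
  ∀ q ∈ Inner I xr, -1 < fam t z q.1 q.2 → I.cc * fam t z q.1 q.2 ≤ s'.rreg 4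

theorem FamPost.mono {t z : ℝ} {s' : State} (h : FamPost I xr t z s) (hs : s.rreg 4 ≤ s'.rreg 4) :
    FamPost I xr t z s' :=
  fun q hq hv => (h q hq hv).trans hs

/-- If the round is maximised at q', then c·fam(q) ≤ c·fam(q') ≤ `gaussian` at q', which is at most
the recorded value. The hypothesis -1 < fam(q) excludes that the round kept its initial value. The
coefficients are computed without the factor c, so the threshold -1 does not depend on it. -/
theorem famC_spec {r : ℕ} {t z : ℝ} (hG : Good I k0 δ xr) (hC : 0 < C) (hthr : I.thr = C / I.n)
    (hcc : 0 ≤ I.cc) (hB : Base I h xr s) (hnZ : I.n ≤ 2 ^ h) (hR : I.Recorded s)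
    (ht : s.rreg r = t) (hr : 12 < r) (hz : s.rreg 18 = z) :
    Runs (famC k0 r) s (roundTime I.n h k0 + 50) fun s' =>
      I.Improves s s' ∧ FamPost I xr t z s' := by
  have h10 : r ≠ 10 := by omega
  have h11 : r ≠ 11 := by omega
  unfold famC
  refine Runs.conseq (linC_spec (a₁ := 2 * t) (a₂ := -(2 * t) - t ^ 2 * (1 - 2 * z))
    (a₃ := -(t ^ 2 * z ^ 2)) hG hthr hB hnZ hR ?_ ?_ ?_) (by simp)
    fun s' hs' h' => ⟨h'.improves, fun q hq hv => ?_⟩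
  · simp [ht]
  · simp [ht, hz, h10, sq]
  · simp [ht, hz, h10, h11, sq]
  · have g := h'.up q hq
    rcases h'.attained with h0 | ⟨q', hq', hv', hval⟩
    · unfold fam at hv
      linarith
    · obtain ⟨g1, g2, -, -⟩ := supportSquare_bounds hC hG.pos hq'
      have g3 : fam t z q.1 q.2 ≤ stat q'.1 q'.2 := by
        refine le_trans ?_ (fam_le_stat g1 g2 t z)
        unfold fam
        linarith
      refine (mul_le_mul_of_nonneg_left g3 hcc).trans ?_
      rw [← gaussian_eq]
      exact hval

theorem slopeC_spec {N : ℕ} {t : ℝ} (hG : Good I k0 δ xr) (hC : 0 < C) (hthr : I.thr = C / I.n)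
    (hcc : 0 ≤ I.cc) (hB : Base I h xr s) (hnZ : I.n ≤ 2 ^ h) (hR : I.Recorded s)
    (hN : s.ireg 2 = N) (ht : s.rreg 15 = t) :
    Runs (slopeC k0) s ((N + 1) * (2 * roundTime I.n h k0 + 140) + 20) fun s' =>
      I.Improves s s' ∧ ∀ j ≤ N, FamPost I xr t (gridPt N j) s' ∧
        FamPost I xr (-t) (gridPt N j) s' := by
  unfold slopeC
  refine Runs.le (Runs.seq_rset (Runs.forC (m := N + 1) (T := 2 * roundTime I.n h k0 + 125)
    (fun k s' => I.Improves s s' ∧ ∀ j < k, FamPost I xr t (gridPt N j) s' ∧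
        FamPost I xr (-t) (gridPt N j) s') rfl (fun s₁ hs₁ => ?_) ?_
    (fun j s₁ hj hs₁ hi h₁ => ?_) (fun s₁ _ _ h => ⟨h.1, fun j hj => h.2 j (by omega)⟩))) ?_
  · simpa [hN] using hs₁.i 2 rfl
  · exact ⟨⟨by simpa [Inst.Recorded] using hR, by simp⟩, by simp⟩
  · have hB1 : Base I h xr s₁ :=
      (hB.setR (by norm_num) (by norm_num) (by norm_num)).of_same hs₁ rfl rfl
    have e2 : s₁.ireg 2 = N := by simpa [hN] using hs₁.i 2 rfl
    have e15 : s₁.rreg 15 = t := by simpa [ht] using hs₁.r 15 rfl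
    have e19 : s₁.rreg 19 = -t := by simpa [ht] using hs₁.r 19 rfl
    refine Runs.le (Runs.seq_rset (Runs.seq (famC_spec (I := I) (h := h) (t := t)
      (z := gridPt N j) hG hC hthr hcc ?_ hnZ ?_ ?_ (by norm_num) ?_) fun s₂ hs₂ h₂ =>
      (famC_spec (I := I) (h := h) (t := -t) (z := gridPt N j) hG hC hthr hcc ?_ hnZ
        h₂.1.recorded ?_ (by norm_num) ?_).conseq le_rfl fun s₃ hs₃ h₃ => ?_)) ?_
    · exact hB1.setR (by norm_num) (by norm_num) (by norm_num)
    · simpa [Inst.Recorded] using h₁.1.recorded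
    · simp [e15]
    · simp [e2, hi, gridPt, sq]
    · exact (hB1.setR (by norm_num) (by norm_num) (by norm_num)).of_same hs₂ rfl rfl
    · rw [hs₂.r 19 rfl]; simp [e19]
    · rw [hs₂.r 18 rfl]; simp [e2, hi, gridPt, sq]
    · have m2 := h₂.1.mono
      simp only [setR_rreg, if_neg (by norm_num : (4 : ℕ) ≠ 18)] at m2
      have m3 := h₃.1.mono
      refine ⟨⟨by simpa [Inst.Recorded] using h₃.1.recorded,
        by simpa using h₁.1.mono.trans (m2.trans m3)⟩, fun j' hj' => ?_⟩
      rcases Nat.lt_succ_iff_lt_or_eq.1 hj' with hj' | rfl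
      · exact ⟨(h₁.2 j' hj').1.mono (by simpa using m2.trans m3),
          (h₁.2 j' hj').2.mono (by simpa using m2.trans m3)⟩
      · exact ⟨h₂.2.mono (by simpa using m3), h₃.2.mono (by simp)⟩
    · simp
      omega
  · simp
    ring_nf
    omega

end

end ScanStat

/-! ## Correctness of the search -/

namespace ScanStat

open RealRAM Finset

section

variable {I : Inst} {h k0 : ℕ} {xr : ℕ → ℕ} {δ : ℝ} {s : State} {C : ℝ}

theorem familyC_spec {N J : ℕ} {w : ℝ} (hG : Good I k0 δ xr) (hC : 0 < C)
    (hthr : I.thr = C / I.n) (hcc : 0 ≤ I.cc) (hB : Base I h xr s) (hnZ : I.n ≤ 2 ^ h)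
    (hR : I.Recorded s) (hN : s.ireg 2 = N) (h14 : s.rreg 14 = w) (h6 : s.rreg 6 = C)
    (hw : 0 ≤ w) (hJ : ∀ k, w * C / I.n * (1 + 1 / (N : ℝ)) ^ k < 3 * w * I.n / C → k ≤ J) :
    Runs (familyC k0) s
      ((J + 1) * ((N + 1) * (2 * roundTime I.n h k0 + 140) + 40) + 40) fun s' =>
      I.Improves s s' ∧ ∀ k, w * C / I.n * (1 + 1 / (N : ℝ)) ^ k < 3 * w * I.n / C → ∀ j ≤ N,
        FamPost I xr (w * C / I.n * (1 + 1 / (N : ℝ)) ^ k) (gridPt N j) s' ∧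
        FamPost I xr (-(w * C / I.n * (1 + 1 / (N : ℝ)) ^ k)) (gridPt N j) s' := by
  let τ : ℕ → ℝ := fun k => w * C / I.n * (1 + 1 / (N : ℝ)) ^ k
  let s₀ : State := ((s.setR 15 (τ 0)).setR 16 (3 * w * I.n / C)).setR 17 (1 + 1 / (N : ℝ))
  have key := Runs.loop (b := .rlt (.reg 15) (.reg 16))
    (p := slopeC k0 ;; .rset 15 (.mul (.reg 15) (.reg 17)))
    (T := (N + 1) * (2 * roundTime I.n h k0 + 140) + 24)
    (fun f s' => ∃ i, i + f = J + 1 ∧ s'.rreg 15 = τ i ∧ s'.rreg 16 = 3 * w * I.n / C ∧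
      s'.rreg 17 = 1 + 1 / (N : ℝ) ∧ s'.ireg 2 = N ∧ Base I h xr s' ∧ I.Improves s s' ∧
      ∀ i' < i, ∀ j ≤ N, FamPost I xr (τ i') (gridPt N j) s' ∧
        FamPost I xr (-(τ i')) (gridPt N j) s') (fun f s₁ hinv hb => ?_) (J + 1) s₀
    ⟨0, by simp, by simp [s₀], by simp [s₀], by simp [s₀], by simp [s₀, hN], ?_,
      ⟨by simpa [s₀, Inst.Recorded] using hR, by simp [s₀]⟩, by simp⟩
  · have e1 : RExp.eval s (.div (.mul (.reg 14) (.reg 6)) (.ofNat (.reg 0))) = τ 0 := by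
      simp [τ, h14, h6, hB.env.n]
    have e2 : RExp.eval (s.setR 15 (τ 0)) (.div (.mul (.mul (.ofNat (.const 3)) (.reg 14))
        (.ofNat (.reg 0))) (.reg 6)) = 3 * w * I.n / C := by
      simp [h14, h6, hB.env.n]
    have e3 : RExp.eval ((s.setR 15 (τ 0)).setR 16 (3 * w * I.n / C)) (.add (.ofNat (.const 1))
        (.div (.ofNat (.const 1)) (.ofNat (.reg 2)))) = 1 + 1 / (N : ℝ) := by
      simp [hN]
    unfold familyC
    refine Runs.le (Runs.seq_rset (Runs.seq_rset (Runs.seq_rset ?_))) (?_ : _ + (_ + (_ +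
      ((J + 1) * (3 + ((N + 1) * (2 * roundTime I.n h k0 + 140) + 24) + 1) + 3 + 1))) ≤ _)
    · rw [e1, e2, e3]
      refine key.conseq le_rfl ?_
      -- The loop stopped at a slope outside the range. The slopes are nondecreasing in the
      -- exponent, so every exponent within the range has been treated.
      rintro s' - ⟨hb, f, i, hi, h15, h16, -, -, -, himp, hfam⟩
      refine ⟨himp, fun k hk j hj => hfam k ?_ j hj⟩
      simp only [BExp.Holds, RExp.eval, h15, h16] at hb
      by_contra hki
      refine hb (lt_of_le_of_lt ?_ hk)
      have hq : (1 : ℝ) ≤ 1 + 1 / (N : ℝ) := by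
        have : (0 : ℝ) ≤ 1 / N := by positivity
        linarith
      exact mul_le_mul_of_nonneg_left (pow_le_pow_right₀ hq (not_lt.1 hki)) (by positivity)
    · simp
      ring_nf
      omega
  · obtain ⟨i, hi, h15, h16, h17, h2, hB1, himp, hfam⟩ := hinv
    simp only [BExp.Holds, RExp.eval, h15, h16] at hb
    have hiJ := hJ i hb
    refine ⟨by omega, Runs.le (Runs.seq (slopeC_spec (N := N) hG hC hthr hcc hB1 hnZ
      himp.recorded h2 h15) fun s₂ hs₂ h₂ => Runs.rset ?_) (by simp)⟩
    have m2 := h₂.1.mono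
    refine ⟨i + 1, by omega, ?_, ?_, ?_, ?_, ?_, ?_, fun i' hi' j hj => ?_⟩
    · simp [hs₂.r 15 rfl, hs₂.r 17 rfl, h15, h17, τ, pow_succ, mul_assoc]
    · simp [hs₂.r 16 rfl, h16]
    · simp [hs₂.r 17 rfl, h17]
    · simp [hs₂.i 2 rfl, h2]
    · exact (hB1.of_same hs₂ rfl rfl).setR (by norm_num) (by norm_num) (by norm_num)
    · exact ⟨by simpa [Inst.Recorded] using h₂.1.recorded, by simpa using himp.mono.trans m2⟩
    · rcases Nat.lt_succ_iff_lt_or_eq.1 hi' with hi' | rfl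
      · exact ⟨(hfam i' hi' j hj).1.mono (by simpa using m2),
          (hfam i' hi' j hj).2.mono (by simpa using m2)⟩
      · exact ⟨(h₂.2 j hj).1.mono (by simp), (h₂.2 j hj).2.mono (by simp)⟩
  · exact ((hB.setR (by norm_num) (by norm_num) (by norm_num)).setR (by norm_num) (by norm_num)
      (by norm_num)).setR (by norm_num) (by norm_num) (by norm_num)

/-- Number of steps of the search. -/
def searchTime (n h k0 N J : ℕ) : ℕ :=
  k0 * (k0 * (160 * n ^ 2 + 100 * n + 60) + 20) + 2 * roundTime n h k0 +
    (J + 1) * ((N + 1) * (2 * roundTime n h k0 + 140) + 40) + 130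

theorem stat_zero {x y : ℝ} (h : |x - y| ≤ 0) : stat x y = 0 := by
  have : x - y = 0 := abs_eq_zero.1 (le_antisymm h (abs_nonneg _))
  simp [stat, this]

/-- The recorded value is nearly optimal. -/
theorem searchC_spec {N J : ℕ} {ε : ℝ} (hG : Good I k0 δ xr) (hC : 0 < C) (hn2 : 2 ≤ I.n)
    (hthr : I.thr = C / I.n) (hcc : 0 < I.cc) (hB : Base I h xr s) (hnZ : I.n ≤ 2 ^ h)
    (hR : I.Recorded s) (hN : s.ireg 2 = N) (h6 : s.rreg 6 = C) (hε : 0 < ε) (hε1 : ε ≤ 1)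
    (hN0 : 0 < N) (hNε : 74 ≤ (N : ℝ) * N * ε)
    (hJ : J = ⌊2 * N * (rangeConst C * Real.log I.n)⌋₊) :
    Runs (searchC k0) s (searchTime I.n h k0 N J) fun s' => I.Recorded s' ∧
      ∀ l r b t, I.Adm l r b t → I.val l r b t ≤ (1 + ε) * s'.rreg 4 ∧ 0 ≤ s'.rreg 4 := by
  have hmu0 : ∀ i < I.n, 0 ≤ I.mu i := fun i hi => hG.δ_pos.le.trans (hG.mu_ge i hi)
  have hbox : ∀ l r b t, I.Adm l r b t → ∃ p < I.n, ∃ k, I.Last k ∧ I.Y p ≤ I.Y k ∧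
      ∃ u < I.n, ∃ v < I.n, ∀ f, I.box f l r b t = I.rankBox xr f p k u v := by
    intro l r b t hA
    have h1 : I.box I.mu l r b t ≠ 0 := (hG.thr_pos.trans_le hA.1.1).ne'
    obtain ⟨i₀, hi₀, hne⟩ := Finset.exists_ne_zero_of_sum_ne_zero h1
    have hc := (ite_ne_right_iff.1 hne).1
    exact Inst.exists_rankBox_eq_box hG (mem_range.1 hi₀) hc
  have hval : ∀ l r b t l' r' b' t', (∀ f, I.box f l r b t = I.box f l' r' b' t') →
      (I.Adm l r b t → I.Adm l' r' b' t') ∧ I.val l r b t = I.val l' r' b' t' := by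
    intro l r b t l' r' b' t' hf
    refine ⟨fun hA => ?_, by simp [Inst.val, Inst.boxPt, hf]⟩
    unfold Inst.Adm at hA ⊢
    rwa [← hf, ← hf]
  -- An admissible box is a rank box. Its strip either leaves enough weight outside, so that the box
  -- belongs to `Inner`, or it is one of the extreme strips that were searched exhaustively.
  have hfin : ∀ s₁ s' : State, s₁.rreg 4 ≤ s'.rreg 4 →
      (∀ c < k0, ∀ e < k0, c < I.n → e < I.n → ∀ l < I.n, ∀ r < I.n, I.X l ≤ I.X r →
        I.Adm l r c (I.n - 1 - e) → I.val l r c (I.n - 1 - e) ≤ s₁.rreg 4) →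
      (∀ q ∈ Inner I xr, gaussian I.cc q ≤ (1 + ε) * s'.rreg 4 ∧ 0 ≤ s'.rreg 4) →
      ∀ l r b t, I.Adm l r b t → I.val l r b t ≤ (1 + ε) * s'.rreg 4 ∧ 0 ≤ s'.rreg 4 := by
    intro s₁ s' hm hx hi l r b t hA
    obtain ⟨p, hp, k, hk, hY, u, hu, v, hv, hf⟩ := hbox l r b t hA
    have hext : (∃ c < k0, ∃ e < k0, c < I.n ∧ e < I.n ∧ I.Y c = I.Y p ∧ I.n - 1 - e = k) →
        I.val l r b t ≤ (1 + ε) * s'.rreg 4 ∧ 0 ≤ s'.rreg 4 := by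
      rintro ⟨c, hc, e, he, hcn, hen, hYc, hek⟩
      obtain ⟨a, ha, a', ha', haa, hb⟩ := Inst.exists_box_eq_rankBox (l := u) (r := v) hG hp hY
      have hf' : ∀ f, I.box f l r b t = I.box f a a' c (I.n - 1 - e) := fun f => by
        rw [hf, hb, hek]; simp [Inst.box, hYc]
      obtain ⟨g1, g2⟩ := hval _ _ _ _ _ _ _ _ hf'
      have g3 := (hx c hc e he hcn hen a ha a' ha' haa (g1 hA)).trans hm
      have g4 : 0 ≤ I.val l r b t := by
        refine gaussian_nonneg_of_mem hC hG.pos hcc.le ?_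
        rw [supportSquare, ← hthr]
        exact ⟨hA.1, hA.2⟩
      rw [← g2] at g3
      exact ⟨by nlinarith, g4.trans g3⟩
    by_cases h1 : I.strip I.mu p k ≤ 1 - I.thr
    · by_cases h2 : I.strip I.be p k ≤ 1 - I.thr
      · refine hi (I.boxPt l r b t) ⟨p, hp, k, hk, hY, h1, h2, u, hu, v, hv, ?_, hA.1.1, hA.2.1⟩
        simp [Inst.boxPt, hf]
      · exact hext (Inst.exists_extreme_strip hG hp hk hG.be_ge hG.be_sum (not_le.1 h2))
    · exact hext (Inst.exists_extreme_strip hG hp hk hG.mu_ge hG.mu_sum (not_le.1 h1))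
  unfold searchC searchTime
  refine Runs.le (Runs.seq (extremesC_spec hG hB.env hR) fun s₁ hs₁ h₁ => Runs.seq
    (scaleC_spec hG hC hthr hcc.le (hB.of_same hs₁ rfl rfl) hnZ h₁.1.recorded)
    fun s₂ hs₂ h₂ => Runs.ite (T₂ := 1) (fun hb => (familyC_spec (N := N) (w := s₂.rreg 14)
      (J := J) hG hC hthr hcc.le ((hB.of_same hs₁ rfl rfl).of_same hs₂ rfl rfl) hnZ
      h₂.improves.recorded ?_ rfl ?_ ?_ ?_).conseq le_rfl fun s₃ hs₃ h₃ => ?_)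
      (fun hb => Runs.skip ?_)) ?_
  · rw [hs₂.i 2 rfl, hs₁.i 2 rfl, hN]
  · rw [hs₂.r 6 rfl, hs₁.r 6 rfl, h6]
  · have hw : 0 < s₂.rreg 14 := by simpa using hb
    exact hw.le
  · intro k hk
    have hw : 0 < s₂.rreg 14 := by simpa using hb
    rw [hJ]
    exact Nat.le_floor (scale_le hC hn2 hw hN0 hk)
  · have hw : 0 < s₂.rreg 14 := by simpa using hb
    refine ⟨h₃.1.recorded, hfin s₁ s₃ (h₂.improves.mono.trans h₃.1.mono) h₁.2 fun q hq => ?_⟩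
    have hqS := Inner.mem hG hthr hq
    have hnn := (h₂.nonneg q hq).trans h₃.1.mono
    refine ⟨?_, hnn⟩
    -- Boxes below the band are dominated by the recorded box of largest deviation; the family is
    -- needed only inside the band.
    by_cases hsm : |q.1 - q.2| < C / I.n * s₂.rreg 14
    · obtain ⟨q', hq', hw', hv⟩ := h₂.attained hw
      have g := stat_le_of_small hC hG.pos hqS hq' hw' hsm
      rw [gaussian_eq] at hv ⊢
      have g' := (mul_le_mul_of_nonneg_left g.le hcc.le).trans (hv.trans h₃.1.mono)
      nlinarith
    · have hband : q ∈ deviationBand C I.n (s₂.rreg 14) := ⟨hqS, not_lt.1 hsm, h₂.up q hq⟩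
      obtain ⟨hy, hy1, -, -⟩ := supportSquare_bounds hC hG.pos hqS
      obtain ⟨g1, g2⟩ := abs_slope_bounds hC hG.pos hband hw
      have hn' : (0 : ℝ) < I.n := by exact_mod_cast hG.pos
      obtain ⟨k, j, hj, hk, σ, hσ, happ⟩ := exists_fam_approx hε hε1 hNε hy hy1
        (by positivity : 0 < s₂.rreg 14 * C / I.n) g1
      have hs0 : 0 ≤ stat q.1 q.2 := by
        have : 0 < 1 - q.2 := by linarith
        unfold stat
        positivity
      obtain ⟨f1, f2⟩ := h₃.2 k (hk.trans_lt g2) j hj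
      -- An approximating member of the family is nonnegative at `q`, because the statistic is; this
      -- meets the requirement of `FamPost`.
      have hf : ∀ v, stat q.1 q.2 ≤ (1 + ε) * v → -1 < v := by
        intro v hv
        have : 0 ≤ v := by
          by_contra hv'
          nlinarith [mul_pos (by linarith : 0 < 1 + ε) (neg_pos.2 (not_le.1 hv'))]
        linarith
      have hle : ∀ v, stat q.1 q.2 ≤ (1 + ε) * v → I.cc * v ≤ s₃.rreg 4 →
          gaussian I.cc q ≤ (1 + ε) * s₃.rreg 4 := by
        intro v hv hv'
        rw [gaussian_eq]
        calc I.cc * stat q.1 q.2 ≤ I.cc * ((1 + ε) * v) := mul_le_mul_of_nonneg_left hv hcc.le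
          _ = (1 + ε) * (I.cc * v) := by ring
          _ ≤ _ := mul_le_mul_of_nonneg_left hv' (by linarith)
      rcases hσ with rfl | rfl
      · rw [one_mul] at happ
        exact hle _ happ (f1 q hq (hf _ happ))
      · rw [neg_one_mul] at happ
        exact hle _ happ (f2 q hq (hf _ happ))
  · have hw : s₂.rreg 14 ≤ 0 := by simpa using hb
    refine ⟨h₂.improves.recorded, hfin s₁ s₂ h₂.improves.mono h₁.2 fun q hq => ?_⟩
    have hnn := h₂.nonneg q hq
    refine ⟨?_, hnn⟩
    -- Without positive deviation all remaining boxes have statistic zero, and the family can be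
    -- skipped.
    rw [gaussian_eq, stat_zero ((h₂.up q hq).trans hw), mul_zero]
    positivity
  · simp
    omega

end

end ScanStat

/-! ## From point sets to instances -/

namespace ScanStat

open RealRAM Finset

/-- Weight of the points in a rectangle. -/
noncomputable def Inst.region (I : Inst) (f : ℕ → ℝ) (lo hi : ℝ × ℝ) : ℝ :=
  ∑ i ∈ range I.n,
    if (lo.2 ≤ I.Y i ∧ I.Y i ≤ hi.2) ∧ lo.1 ≤ I.X i ∧ I.X i ≤ hi.1 then f i else 0

/-- A rectangle that contains a point can be shrunk to a bounding box. -/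
theorem Inst.exists_box_eq_region {I : Inst} {lo hi : ℝ × ℝ} {g : ℕ → ℝ}
    (h : I.region g lo hi ≠ 0) :
    ∃ l r b t, ∀ f, I.region f lo hi = I.box f l r b t := by
  classical
  obtain ⟨i₀, hi₀, hne⟩ := Finset.exists_ne_zero_of_sum_ne_zero h
  have hc := (ite_ne_right_iff.1 hne).1
  let A : Finset ℕ := {i ∈ range I.n |
    (lo.2 ≤ I.Y i ∧ I.Y i ≤ hi.2) ∧ lo.1 ≤ I.X i ∧ I.X i ≤ hi.1}
  have hA : A.Nonempty := ⟨i₀, by simp only [A, mem_filter]; exact ⟨hi₀, hc⟩⟩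
  obtain ⟨l, hl, hl'⟩ := A.exists_min_image I.X hA
  obtain ⟨r, hr, hr'⟩ := A.exists_max_image I.X hA
  obtain ⟨b, hb, hb'⟩ := A.exists_min_image I.Y hA
  obtain ⟨t, ht, ht'⟩ := A.exists_max_image I.Y hA
  refine ⟨l, r, b, t, fun f => Finset.sum_congr rfl fun i hi => if_congr ?_ rfl rfl⟩
  simp only [A, mem_filter] at hl hr hb ht hl' hr' hb' ht'
  constructor
  · intro hi'
    exact ⟨⟨hb' i ⟨hi, hi'⟩, ht' i ⟨hi, hi'⟩⟩, hl' i ⟨hi, hi'⟩, hr' i ⟨hi, hi'⟩⟩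
  · rintro ⟨⟨h1, h2⟩, h3, h4⟩
    exact ⟨⟨hb.2.1.1.trans h1, h2.trans ht.2.1.2⟩, hl.2.2.1.trans h3, h4.trans hr.2.2.2⟩

/-- The instance in the memory after preprocessing. -/
noncomputable def instOf (n : ℕ) (C c : ℝ) (s : State) : Inst :=
  ⟨n, s.rarr 4, s.rarr 5, s.rarr 6, s.rarr 7, C / n, c⟩

/-- An array of the input. -/
noncomputable def arr {n : ℕ} (w : Fin n → ℝ) (i : ℕ) : ℝ := if h : i < n then w ⟨i, h⟩ else 0

theorem arr_val {n : ℕ} (w : Fin n → ℝ) (i : Fin n) : arr w i = w i := by simp [arr]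

section

variable {n N h : ℕ} {P : PointSet n} {ε C c : ℝ} {s : State}

theorem sum_arr {n : ℕ} (w : Fin n → ℝ) : ∑ j ∈ range n, arr w j = ∑ i, w i := by
  rw [Finset.sum_range]
  simp [arr_val]

theorem fraction_eq {w : Fin n → ℝ} {f : ℕ → ℝ}
    (hS : Sorted n (arr fun i => (P.pt i).1) (arr fun i => (P.pt i).2) (arr P.m) (arr P.b) s)
    (hf : ∀ i < n, f (posY n (arr fun i => (P.pt i).2) i) = arr w i / ∑ j ∈ range n, arr w j)
    (lo hi : ℝ × ℝ) :
    P.fraction w (Set.Icc lo hi) = (instOf n C c s).region f lo hi := by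
  let g : ℕ → ℝ := fun k => if (lo.2 ≤ s.rarr 5 k ∧ s.rarr 5 k ≤ hi.2) ∧ lo.1 ≤ s.rarr 4 k ∧
    s.rarr 4 k ≤ hi.1 then f k else 0
  have h1 : ∑ i ∈ range n, g (posY n (arr fun i => (P.pt i).2) i) =
      (instOf n C c s).region f lo hi := sum_posY _ g
  rw [← h1, Finset.sum_range, PointSet.fraction, Finset.sum_filter, Finset.sum_div]
  refine Finset.sum_congr rfl fun i _ => ?_
  have hq : P.pt i ∈ Set.Icc lo hi ↔ (lo.2 ≤ (P.pt i).2 ∧ (P.pt i).2 ≤ hi.2) ∧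
      lo.1 ≤ (P.pt i).1 ∧ (P.pt i).1 ≤ hi.1 := by
    simp only [Set.mem_Icc, Prod.le_def]
    tauto
  simp only [g, hS.X i i.2, hS.Y i i.2, hf i i.2, arr_val, sum_arr]
  by_cases hp : P.pt i ∈ Set.Icc lo hi
  · rw [if_pos hp, if_pos (hq.1 hp)]
  · rw [if_neg hp, if_neg fun h => hp (hq.2 h), zero_div]

theorem coords_eq
    (hS : Sorted n (arr fun i => (P.pt i).1) (arr fun i => (P.pt i).2) (arr P.m) (arr P.b) s)
    (lo hi : ℝ × ℝ) :
    P.coords (Set.Icc lo hi) = ((instOf n C c s).region (s.rarr 6) lo hi,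
      (instOf n C c s).region (s.rarr 7) lo hi) :=
  Prod.ext (fraction_eq hS hS.mu lo hi) (fraction_eq hS hS.be lo hi)

/-- The source of δ = c₁/(n c₂): a weight of at least c₁ is divided by a total of at most n c₂. -/
theorem normalised_ge {w : Fin n → ℝ} {c₁ c₂ : ℝ} (hc₁ : 0 < c₁) (hw : ∀ i, w i ∈ Set.Icc c₁ c₂)
    (i : Fin n) : c₁ / (n * c₂) ≤ arr w i / ∑ j ∈ range n, arr w j := by
  rw [sum_arr, arr_val]
  have h1 : ∑ j, w j ≤ n * c₂ := by
    have := Finset.sum_le_card_nsmul univ w c₂ fun j _ => (hw j).2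
    simpa using this
  have h2 : 0 < ∑ j, w j :=
    Finset.sum_pos (fun j _ => hc₁.trans_le (hw j).1) ⟨i, mem_univ i⟩
  exact div_le_div₀ (hc₁.le.trans (hw i).1) (hw i).1 h2 h1

theorem sum_normalised {w : Fin n → ℝ} {c₁ : ℝ} (hc₁ : 0 < c₁) (hw : ∀ i, c₁ ≤ w i)
    (hn : 0 < n) {y f : ℕ → ℝ}
    (hf : ∀ i < n, f (posY n y i) = arr w i / ∑ j ∈ range n, arr w j) :
    ∑ i ∈ range n, f i = 1 := by
  have h2 : 0 < ∑ j ∈ range n, arr w j := by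
    rw [sum_arr]
    exact Finset.sum_pos (fun j _ => hc₁.trans_le (hw j)) ⟨⟨0, hn⟩, mem_univ _⟩
  rw [← sum_posY y, Finset.sum_congr rfl fun i hi => hf i (mem_range.1 hi), ← Finset.sum_div,
    div_self h2.ne']

/-- Number of points whose weight surely exceeds the threshold. -/
noncomputable def supportCount (C c₁ c₂ : ℝ) : ℕ := ⌈C * c₂ / c₁⌉₊

theorem good_instOf {c₁ c₂ : ℝ} (hn : 0 < n) (hC : 0 < C) (hc₁ : 0 < c₁)
    (hP : P.BoundedBy c₁ c₂)
    (hr : Ready n N h (arr fun i => (P.pt i).1) (arr fun i => (P.pt i).2) (arr P.m) (arr P.b)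
      ε C c s) :
    Good (instOf n C c s) (supportCount C c₁ c₂) (c₁ / (n * c₂)) (s.iarr 0) := by
  have hn' : (0 : ℝ) < n := by exact_mod_cast hn
  have hc₂ : 0 < c₂ := hc₁.trans_le ((hP ⟨0, hn⟩).1.1.trans (hP ⟨0, hn⟩).1.2)
  have hS := hr.sorted
  refine ⟨hn, ?_, by positivity, ?_, ?_, ?_, ?_, by simp only [instOf]; positivity, ?_, ?_, ?_⟩
  · intro i j hij hj
    obtain ⟨i', hi', rfl⟩ := posY_surj (arr fun i => (P.pt i).2) (lt_of_le_of_lt hij hj)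
    obtain ⟨j', hj', rfl⟩ := posY_surj (arr fun i => (P.pt i).2) hj
    simp only [instOf, hS.Y i' hi', hS.Y j' hj']
    by_contra hlt
    exact absurd (posY_lt_posY hj' (Or.inl (not_le.1 hlt))) (not_lt.2 hij)
  · intro i hi
    obtain ⟨i', hi', rfl⟩ := posY_surj (arr fun i => (P.pt i).2) hi
    simp only [instOf, hS.mu i' hi']
    exact normalised_ge hc₁ (fun i => (hP i).1) ⟨i', hi'⟩
  · intro i hi
    obtain ⟨i', hi', rfl⟩ := posY_surj (arr fun i => (P.pt i).2) hi
    simp only [instOf, hS.be i' hi']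
    exact normalised_ge hc₁ (fun i => (hP i).2) ⟨i', hi'⟩
  · exact sum_normalised hc₁ (fun i => (hP i).1.1) hn hS.mu
  · exact sum_normalised hc₁ (fun i => (hP i).2.1) hn hS.be
  · have h1 : C * c₂ / c₁ ≤ supportCount C c₁ c₂ := Nat.le_ceil _
    simp only [instOf]
    -- Here the window size is determined: C/n equals C c₂/c₁ times δ, independently of `n`, so the
    -- program is the same for all inputs.
    calc C / n = C * c₂ / c₁ * (c₁ / (n * c₂)) := by field_simp
      _ ≤ _ := mul_le_mul_of_nonneg_right h1 (by positivity)
  · intro i hi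
    rw [hr.rank i hi]
    exact rankX_lt _ hi
  · intro i hi j hj
    rw [hr.rank i hi, hr.rank j hj]
    exact rankX_le_iff hj

theorem base_instOf {x y m b : ℕ → ℝ} (hr : Ready n N h x y m b ε C c s) :
    Base (instOf n C c s) h (s.iarr 0) s :=
  ⟨⟨hr.i0, rfl, rfl, rfl, rfl, hr.r8, hr.r9, hr.r7⟩, hr.Z, hr.par, rfl, rfl, rfl, rfl⟩

/-- The program. -/
def scanC (k0 : ℕ) : Cmd := prepC ;; searchC k0

theorem scanC_spec {J : ℕ} {c₁ c₂ : ℝ} (hn : 2 ≤ n) (hC : 0 < C) (hc₁ : 0 < c₁) (hε : 0 < ε)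
    (hε1 : ε ≤ 1) (hc : 0 < c) (hP : P.BoundedBy c₁ c₂) (hN0 : 0 < N)
    (hNε : 74 ≤ (N : ℝ) * N * ε) (hN' : ∀ m < N, (m : ℝ) * m * ε < 74)
    (hJ : J = ⌊2 * N * (rangeConst C * Real.log n)⌋₊) {T : ℕ}
    (hT : ∀ h, 2 ^ h < 2 * n → 80 * n ^ 2 + 220 * n + 16 * N + 200 +
      searchTime n h (supportCount C c₁ c₂) N J ≤ T) :
    Runs (scanC (supportCount C c₁ c₂)) (P.input ε C c) T fun s =>
      (∃ lo hi : ℝ × ℝ, P.Admissible C lo hi) → P.CorrectOutput ε C c s := by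
  have hin : ∀ a, (P.input ε C c).rarr a = fun i => if h : i < n then
      match a with
      | 0 => (P.pt ⟨i, h⟩).1
      | 1 => (P.pt ⟨i, h⟩).2
      | 2 => P.m ⟨i, h⟩
      | 3 => P.b ⟨i, h⟩
      | _ => 0
    else 0 := fun a => rfl
  obtain ⟨t₁, s₁, he₁, ht₁, h, hh, hh', hr⟩ := prepC_spec (s := P.input ε C c) (n := n) (N := N)
    (x := arr fun i => (P.pt i).1) (y := arr fun i => (P.pt i).2) (m := arr P.m) (b := arr P.b)
    (ε := ε) (C := C) (c := c) rfl (by omega) rfl rfl rfl rfl rfl rfl rfl hNε hN'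
  set I := instOf n C c s₁ with hI
  have hG := good_instOf (by omega) hC hc₁ hP hr
  obtain ⟨t₂, s₂, he₂, ht₂, hrec, hopt⟩ := searchC_spec (I := I) (J := J) (N := N) (ε := ε) hG hC hn
    rfl hc (base_instOf hr) hh (Or.inl hr.r4) hr.i2 hr.r6 hε hε1 hN0 hNε hJ
  refine ⟨_, s₂, .seq he₁ he₂, (add_le_add ht₁ ht₂).trans (hT h hh'), fun hex => ?_⟩
  have hco : ∀ lo hi, P.coords (Set.Icc lo hi) = (I.region I.mu lo hi, I.region I.be lo hi) :=
    fun lo hi => coords_eq hr.sorted lo hi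
  have hbox : ∀ l r b t, P.coords (Set.Icc (I.X l, I.Y b) (I.X r, I.Y t)) = I.boxPt l r b t :=
    fun l r b t => hco _ _
  have hadm : ∀ l r b t, I.Adm l r b t ↔ P.Admissible C (I.X l, I.Y b) (I.X r, I.Y t) := by
    intro l r b t
    rw [PointSet.Admissible, hbox]
    rfl
  have hall : ∀ lo hi, P.Admissible C lo hi →
      gaussian c (P.coords (Set.Icc lo hi)) ≤ (1 + ε) * s₂.rreg 4 ∧ 0 ≤ s₂.rreg 4 := by
    intro lo hi hA
    -- The support is positive, so an admissible rectangle contains a point and can be shrunk to a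
    -- bounding box of points.
    have hpos : I.region I.mu lo hi ≠ 0 := by
      have := hA.1.1
      rw [hco] at this
      exact (lt_of_lt_of_le (div_pos hC (by positivity)) this).ne'
    obtain ⟨l, r, b, t, hb⟩ := Inst.exists_box_eq_region hpos
    have e : P.coords (Set.Icc lo hi) = I.boxPt l r b t := by rw [hco, hb, hb]; rfl
    have hA' : I.Adm l r b t := by
      rw [hadm, PointSet.Admissible, hbox, ← e]
      exact hA
    rw [e]
    exact hopt l r b t hA'
  obtain ⟨lo, hi, hA⟩ := hex
  have h0 := (hall lo hi hA).2
  rcases hrec with hrec | ⟨l, r, b, t, -, -, -, -, hA', e0, e1, e2, e3, e4⟩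
  -- The initial value -1 contradicts `h0`: an admissible rectangle forces a nonnegative recorded
  -- value.
  · linarith
  · refine ⟨?_, ?_, fun lo hi hA => ?_⟩
    · rw [e0, e1, e2, e3]
      exact (hadm l r b t).1 hA'
    · rw [e0, e1, e2, e3, e4, hbox]
      rfl
    · rw [one_div, inv_mul_le_iff₀ (by linarith)]
      exact (hall lo hi hA).1

end

end ScanStat

/-! ## Running time -/

namespace ScanStat

/-- Constant in the running time of a round. -/
noncomputable def roundConst (k0 : ℕ) : ℝ := 1200 * ((k0 : ℝ) + 1) ^ 2 + 80 * k0 + 2160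

theorem roundTime_le {n h k0 : ℕ} (hn : 2 ≤ n) (hh : 2 ^ h < 2 * n) :
    (roundTime n h k0 : ℝ) ≤ roundConst k0 * ((n : ℝ) ^ 2 * Real.log n) := by
  have hn' : (2 : ℝ) ≤ n := by exact_mod_cast hn
  have hL : 1 / 2 ≤ Real.log n := half_le_log_two.trans (log_two_le_log hn)
  have hh' : (2 : ℝ) ^ h ≤ 2 * n := by exact_mod_cast hh.le
  have hh4 : (h : ℝ) ≤ 4 * Real.log n := by
    have h1 := Real.log_le_log (by positivity) hh'
    rw [Real.log_pow, Real.log_mul (by norm_num) (by positivity)] at h1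
    have h2 := log_two_le_log hn
    have h3 : (h : ℝ) * (1 / 2) ≤ h * Real.log 2 :=
      mul_le_mul_of_nonneg_left half_le_log_two (Nat.cast_nonneg h)
    linarith
  set L := Real.log n
  set k := (k0 : ℝ)
  have hk : 0 ≤ k := Nat.cast_nonneg k0
  have e : (roundTime n h k0 : ℝ) = (n : ℝ) * (n * (600 * (k + 1) ^ 2 + 50 * h + 260) +
      160 * 2 ^ h + 40 * k + 80) + 160 * (n : ℝ) ^ 2 + 100 * n + 60 := by
    simp [roundTime, k]
  have h1 : (n : ℝ) * 1 ≤ n * n := mul_le_mul_of_nonneg_left (by linarith) (by linarith)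
  have h2 : (n : ℝ) * 2 ^ h ≤ n * (2 * n) := mul_le_mul_of_nonneg_left hh' (by linarith)
  have h3 : k * n * 1 ≤ k * n * n := mul_le_mul_of_nonneg_left (by linarith) (by positivity)
  have h4 : (1 : ℝ) ≤ n * n := by nlinarith
  calc (roundTime n h k0 : ℝ)
      ≤ (n : ℝ) ^ 2 * ((600 * (k + 1) ^ 2 + 40 * k + 980) * 1 + 50 * h) := by
        rw [e]; nlinarith
    _ ≤ (n : ℝ) ^ 2 * ((600 * (k + 1) ^ 2 + 40 * k + 980) * (2 * L) + 50 * (4 * L)) := by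
        have : 0 ≤ 600 * (k + 1) ^ 2 + 40 * k + 980 := by positivity
        gcongr
        linarith
    _ = _ := by unfold roundConst; ring

/-- Constant in the running time of the program. -/
noncomputable def timeConst (C : ℝ) (k0 : ℕ) : ℝ :=
  592 * (2 * rangeConst C + 2) * (2 * roundConst k0 + 360) + 4 * roundConst k0 +
    1280 * (k0 : ℝ) ^ 2 + 80 * k0 + 8000

theorem roundConst_nonneg (k0 : ℕ) : 0 ≤ roundConst k0 := by unfold roundConst; positivity

theorem timeConst_nonneg (C : ℝ) (k0 : ℕ) : 0 ≤ timeConst C k0 := by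
  have := rangeConst_nonneg C
  have := roundConst_nonneg k0
  unfold timeConst
  positivity

/-- The main term is 2(N+1)(J+1) = O(log n/ε) rounds of O(n² log n) steps each. All other terms are
absorbed by means of 1/ε ≥ 1 and log n ≥ 1/2. -/
theorem time_le {n h k0 N J : ℕ} {C ε : ℝ} (hn : 2 ≤ n) (hh : 2 ^ h < 2 * n) (hε : 0 < ε)
    (hε1 : ε ≤ 1) (hN : 0 < N) (hN2 : (N : ℝ) ^ 2 ≤ 296 * (1 / ε))
    (hJ : (J : ℝ) ≤ 2 * N * (rangeConst C * Real.log n)) :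
    ((80 * n ^ 2 + 220 * n + 16 * N + 200 + searchTime n h k0 N J : ℕ) : ℝ) ≤
      timeConst C k0 * (1 / ε * (n : ℝ) ^ 2 * Real.log n ^ 2) := by
  have hn' : (2 : ℝ) ≤ n := by exact_mod_cast hn
  have hL : 1 / 2 ≤ Real.log n := half_le_log_two.trans (log_two_le_log hn)
  have hN' : (1 : ℝ) ≤ N := by exact_mod_cast hN
  have hr := roundTime_le (k0 := k0) hn hh
  have hF := family_count (C := C) hn hN hN2 hJ
  have hR := roundConst_nonneg k0
  have hRC := rangeConst_nonneg C
  have hE : 1 ≤ 1 / ε := (one_le_div hε).2 hε1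
  unfold timeConst
  set L := Real.log n
  set k := (k0 : ℝ)
  set R := roundConst k0
  set E := 1 / ε
  set F := 2 * rangeConst C + 2
  set rt := (roundTime n h k0 : ℝ)
  set U := E * (n : ℝ) ^ 2 * L ^ 2
  have hk : 0 ≤ k := Nat.cast_nonneg k0
  have hn2 : (n : ℝ) ^ 2 ≤ 4 * U := by
    have h1 : 1 ≤ E * (4 * L ^ 2) := by nlinarith
    calc (n : ℝ) ^ 2 = n ^ 2 * 1 := by ring
      _ ≤ n ^ 2 * (E * (4 * L ^ 2)) := mul_le_mul_of_nonneg_left h1 (by positivity)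
      _ = 4 * U := by ring
  have hnL : (n : ℝ) ^ 2 * L ≤ 2 * U := by
    have h1 : 1 ≤ E * (2 * L) := by nlinarith
    calc (n : ℝ) ^ 2 * L = n ^ 2 * L * 1 := by ring
      _ ≤ n ^ 2 * L * (E * (2 * L)) := mul_le_mul_of_nonneg_left h1 (by positivity)
      _ = 2 * U := by ring
  have hU : E ≤ U := by
    have h1 : 1 ≤ (n : ℝ) ^ 2 * L ^ 2 := by
      have : 1 ≤ n * L := by nlinarith
      rw [← mul_pow]
      exact one_le_pow₀ this
    calc E = E * 1 := by ring
      _ ≤ E * ((n : ℝ) ^ 2 * L ^ 2) := mul_le_mul_of_nonneg_left h1 (by linarith)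
      _ = U := by ring
  have hn1 : (n : ℝ) ≤ n ^ 2 := by nlinarith
  have h1n : 1 ≤ (n : ℝ) ^ 2 * L := by nlinarith
  have hmain : (J + 1) * ((N + 1) * (2 * rt + 140) + 40) ≤ 592 * F * (2 * R + 360) * U := by
    have h1 : (N + 1) * (2 * rt + 140) + 40 ≤ (N + 1) * ((2 * R + 360) * ((n : ℝ) ^ 2 * L)) := by
      have h2 : (2 * rt + 140) + 40 ≤ (2 * R + 360) * ((n : ℝ) ^ 2 * L) := by nlinarith
      have h3 := mul_le_mul_of_nonneg_left h2 (by linarith : (0 : ℝ) ≤ N + 1)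
      nlinarith
    have h4 : (0 : ℝ) ≤ (2 * R + 360) * ((n : ℝ) ^ 2 * L) := by positivity
    calc (J + 1) * ((N + 1) * (2 * rt + 140) + 40)
        ≤ (J + 1) * ((N + 1) * ((2 * R + 360) * ((n : ℝ) ^ 2 * L))) :=
          mul_le_mul_of_nonneg_left h1 (by positivity)
      _ = (2 * (N + 1) * (J + 1)) * ((2 * R + 360) * ((n : ℝ) ^ 2 * L) / 2) := by ring
      _ ≤ (1184 * F * (E * L)) * ((2 * R + 360) * ((n : ℝ) ^ 2 * L) / 2) :=
          mul_le_mul_of_nonneg_right hF (by positivity)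
      _ = 592 * F * (2 * R + 360) * U := by ring
  have hext : k * (k * (160 * (n : ℝ) ^ 2 + 100 * n + 60) + 20) ≤ (320 * k ^ 2 + 20 * k) * (4 * U) := by
    have h1 : 160 * (n : ℝ) ^ 2 + 100 * n + 60 ≤ 320 * (n : ℝ) ^ 2 := by nlinarith
    have h2 : (1 : ℝ) ≤ n ^ 2 := by nlinarith
    calc k * (k * (160 * (n : ℝ) ^ 2 + 100 * n + 60) + 20)
        ≤ k * (k * (320 * (n : ℝ) ^ 2) + 20 * (n : ℝ) ^ 2) := by gcongr; linarith
      _ = (320 * k ^ 2 + 20 * k) * (n : ℝ) ^ 2 := by ring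
      _ ≤ _ := mul_le_mul_of_nonneg_left hn2 (by positivity)
  have hrt : 2 * rt ≤ 4 * R * U := by
    have := mul_le_mul_of_nonneg_left hnL hR
    nlinarith
  have hNU : 16 * (N : ℝ) ≤ 4736 * U := by nlinarith
  have hconst : 80 * (n : ℝ) ^ 2 + 220 * n + 200 + 130 ≤ 815 * (4 * U) := by nlinarith
  have e : ((80 * n ^ 2 + 220 * n + 16 * N + 200 + searchTime n h k0 N J : ℕ) : ℝ) =
      80 * (n : ℝ) ^ 2 + 220 * n + 16 * N + 200 + (k * (k * (160 * (n : ℝ) ^ 2 + 100 * n + 60) + 20) +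
        2 * rt + (J + 1) * ((N + 1) * (2 * rt + 140) + 40) + 130) := by
    simp [searchTime, k, rt]
  rw [e]
  have hU0 : 0 ≤ U := by linarith
  calc _ ≤ 3260 * U + 4736 * U + (320 * k ^ 2 + 20 * k) * (4 * U) + 4 * R * U +
        592 * F * (2 * R + 360) * U := by linarith
    _ ≤ _ := by linarith

end ScanStat

theorem mainTheorem5 (C c₁ c₂ : ℝ) (hC : 0 < C) (hc₁ : 0 < c₁) :
    ∃ (prog : RealRAM.Cmd) (K : ℝ),
      ∀ (n : ℕ) (ε c : ℝ), 2 ≤ n → 0 < ε → ε ≤ 1 → 0 < c →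
        (∀ P : ScanStat.PointSet n, P.BoundedBy c₁ c₂ →
          ∃ (t : ℕ) (s : RealRAM.State),
            RealRAM.Exec prog (P.input ε C c) t s ∧
            (t : ℝ) ≤ K * (1 / ε * (n : ℝ) ^ 2 * Real.log n ^ 2) ∧
            ((∃ lo hi : ℝ × ℝ, P.Admissible C lo hi) → P.CorrectOutput ε C c s)) ∧
        (∀ w : ℝ, 0 < w →
          ∃ L : Finset (ℝ × ℝ × ℝ),
            (L.card : ℝ) ≤ K * (1 / ε * Real.log n) ∧
            (∀ a ∈ L, ∀ p ∈ ScanStat.supportSquare C n,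
              ScanStat.linear a p ≤ ScanStat.gaussian c p) ∧
            ScanStat.IsRelativeFamily ε (ScanStat.gaussian c) (ScanStat.deviationBand C n w) L ∧
            (∀ A : Set (ℝ × ℝ), A ⊆ ScanStat.supportSquare C n →
              IsGreatest ((fun p : ℝ × ℝ => |p.1 - p.2|) '' A) w →
              ∀ p ∈ A, IsMaxOn (ScanStat.gaussian c) A p →
                p ∈ ScanStat.deviationBand C n w)) := by
  have hF : 0 ≤ 1184 * (2 * ScanStat.rangeConst C + 2) := by
    have := ScanStat.rangeConst_nonneg C
    positivity
  have hT := ScanStat.timeConst_nonneg C (ScanStat.supportCount C c₁ c₂)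
  -- The program depends on the constants only through the window size. The sum of two nonnegative
  -- constants serves both parts of the theorem.
  refine ⟨ScanStat.scanC (ScanStat.supportCount C c₁ c₂),
    ScanStat.timeConst C (ScanStat.supportCount C c₁ c₂) +
      1184 * (2 * ScanStat.rangeConst C + 2), fun n ε c hn hε hε1 hc => ⟨fun P hP => ?_,
    fun w hw => ?_⟩⟩
  · obtain ⟨N, hN0, hNε, hN2, hN'⟩ := ScanStat.exists_gridSize hε hε1
    have hlog : 0 ≤ Real.log n :=
      (by norm_num : (0 : ℝ) ≤ 1 / 2).trans
        (ScanStat.half_le_log_two.trans (ScanStat.log_two_le_log hn))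
    have hJ : (⌊2 * N * (ScanStat.rangeConst C * Real.log n)⌋₊ : ℝ) ≤
        2 * N * (ScanStat.rangeConst C * Real.log n) :=
      Nat.floor_le (mul_nonneg (by positivity) (mul_nonneg (ScanStat.rangeConst_nonneg C) hlog))
    have hU : 0 ≤ 1 / ε * (n : ℝ) ^ 2 * Real.log n ^ 2 := by positivity
    obtain ⟨t, s, he, ht, hs⟩ := ScanStat.scanC_spec hn hC hc₁ hε hε1 hc hP hN0 hNε hN' rfl
      (T := ⌊ScanStat.timeConst C (ScanStat.supportCount C c₁ c₂) *
        (1 / ε * (n : ℝ) ^ 2 * Real.log n ^ 2)⌋₊) fun h hh =>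
        Nat.le_floor (ScanStat.time_le hn hh hε hε1 hN0 hN2 hJ)
    refine ⟨t, s, he, ?_, hs⟩
    have h1 : (t : ℝ) ≤ _ := (Nat.cast_le.2 ht).trans (Nat.floor_le (mul_nonneg hT hU))
    exact h1.trans (mul_le_mul_of_nonneg_right (by linarith) hU)
  · obtain ⟨L, h1, h2, h3⟩ := ScanStat.exists_relativeFamily hC hn hε hε1 hc hw
    have hlog : 0 ≤ Real.log n :=
      (by norm_num : (0 : ℝ) ≤ 1 / 2).trans
        (ScanStat.half_le_log_two.trans (ScanStat.log_two_le_log hn))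
    refine ⟨L, h1.trans (mul_le_mul_of_nonneg_right (by linarith) (by positivity)), h2, h3,
      fun A hA hg p hp hm => ScanStat.mem_band_of_isMaxOn hC (by omega) hc hA hg hp hm⟩
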